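/- Let $\Omega\subset\mathbb R^N$ be a bounded domain (nonempty, open, connected), let $p,q\in(1,N)$, and write $p^*=Np/(N-p)$, $q^*=Nq/(N-q)$. Let $a,b>1$ satisfy $\frac a{p_0}+\frac b{q_0}=1$ for some $p_0\in(1,p^*)$ and $q_0\in(1,q^*)$, and let $\lambda>0$. On $W=W^{1,p}_0(\Omega)\times W^{1,q}_0(\Omega)$, with norm $\|(u,v)\|=\|u\|_{W^{1,p}_0(\Omega)}+\|v\|_{W^{1,q}_0(\Omega)}$, consider $$E(u,v)=\int_\Omega\Big(\frac1p|\nabla u|^p+\frac1q|\nabla v|^q\Big)dx-\frac{\lambda}{a+b}\int_\Omega|u|^a|v|^b\,dx-\int_\Omega\Big(\frac1{p^*}|u|^{p^*}+\frac1{q^*}|v|^{q^*}\Big)dx,$$ the energy functional of the system $$-\Delta_pu=\frac{\lambda a}{a+b}|u|^{a-2}|v|^bu+|u|^{p^*-2}u,\qquad -\Delta_qv=\frac{\lambda b}{a+b}|u|^a|v|^{b-2}v+|v|^{q^*-2}v\quad\text{in }\Omega,\qquad u=v=0\ \text{on }\partial\Omega.$$ Let $$S_r=\inf_{u\in\mathcal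 D^{1,r}(\mathbb R^N)\setminus\{0\}}\frac{\int_{\mathbb R^N}|\nabla u|^r\,dx}{\left(\int_{\mathbb R^N}|u|^{r^*}dx\right)^{r/r^*}}\quad(r=p,q),\qquad c^*=\frac1N\min\big\{S_p^{N/p},S_q^{N/q}\big\},$$ where $\mathcal D^{1,r}(\mathbb R^N)$ is the space of all $u\in L^{r^*}(\mathbb R^N)$ with weak gradient $\nabla u\in L^r(\mathbb R^N)$. If $\gamma:=\frac ap+\frac bq\ge1$, then $E$ is of class $C^1$ on $W$ and satisfies the Palais–Smale condition at every level $c<c^*$: every sequence $(w_j)$ in $W$ with $E(w_j)\to c$ and $E'(w_j)\to0$ in the dual space $W^*$ has a subsequence that converges in the norm of $W$. -/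

import Mathlib

open MeasureTheory Filter Topology
open scoped ContDiff ENNReal

noncomputable section

namespace CriticalSystem

/-- Euclidean space `ℝ^N`, with the Euclidean norm and Lebesgue measure. -/
abbrev RN (N : ℕ) : Type := EuclideanSpace ℝ (Fin N)

instance factOneLeOfReal {p : ℝ} [hp : Fact (1 < p)] : Fact (1 ≤ ENNReal.ofReal p) :=
  ⟨by rw [← ENNReal.ofReal_one]; exact ENNReal.ofReal_le_ofReal hp.out.le⟩

/-- `φ ∈ C_c^∞(Ω)`: a smooth function on `ℝ^N` whose support is a compact subset of `Ω`. -/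
structure IsTestFunction {N : ℕ} (Ω : Set (RN N)) (φ : RN N → ℝ) : Prop where
  smooth : ContDiff ℝ ∞ φ
  compact : HasCompactSupport φ
  support : tsupport φ ⊆ Ω

/-- The ambient space `L^p(Ω) × L^p(Ω; ℝ^N)` of pairs `(u, g)`, with the norm
`(‖u‖_p^p + ‖g‖_p^p)^(1/p)`, which on pairs `(u, ∇u)` is the norm of `W^{1,p}(Ω)`. -/
abbrev PairSpace {N : ℕ} (Ω : Set (RN N)) (p : ℝ) : Type :=
  WithLp (ENNReal.ofReal p)
    (Lp ℝ (ENNReal.ofReal p) (volume.restrict Ω) ×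
      Lp (RN N) (ENNReal.ofReal p) (volume.restrict Ω))

lemma IsTestFunction.differentiable {N : ℕ} {Ω : Set (RN N)} {φ : RN N → ℝ}
    (h : IsTestFunction Ω φ) : Differentiable ℝ φ :=
  h.smooth.differentiable (by simp)

/-- The pairs `(φ, ∇φ)` with `φ ∈ C_c^∞(Ω)`. -/
def testPairs {N : ℕ} (Ω : Set (RN N)) (p : ℝ) [Fact (1 < p)] :
    Submodule ℝ (PairSpace Ω p) where
  carrier := {w | ∃ φ : RN N → ℝ, IsTestFunction Ω φ ∧
    w.fst =ᵐ[volume.restrict Ω] φ ∧ w.snd =ᵐ[volume.restrict Ω] gradient φ}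
  zero_mem' := by
    refine ⟨fun _ => 0, ⟨contDiff_const, HasCompactSupport.zero, by simp [tsupport]⟩, ?_, ?_⟩
    · exact Lp.coeFn_zero _ _ _
    · filter_upwards [Lp.coeFn_zero (RN N) (ENNReal.ofReal p) (volume.restrict Ω)] with x hx
      simpa [gradient] using hx
  add_mem' := by
    rintro w z ⟨φ, hφ, h1, h2⟩ ⟨ψ, hψ, h3, h4⟩
    refine ⟨φ + ψ, ⟨hφ.smooth.add hψ.smooth, hφ.compact.add hψ.compact,
      (tsupport_add φ ψ).trans (Set.union_subset hφ.support hψ.support)⟩, ?_, ?_⟩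
    · filter_upwards [h1, h3, Lp.coeFn_add w.fst z.fst] with x a b c
      simp only [WithLp.add_fst, c, Pi.add_apply, a, b]
    · filter_upwards [h2, h4, Lp.coeFn_add w.snd z.snd] with x a b c
      simp only [WithLp.add_snd, c, Pi.add_apply, a, b, gradient]
      rw [fderiv_add (hφ.differentiable x) (hψ.differentiable x), map_add]
  smul_mem' := by
    rintro r w ⟨φ, hφ, h1, h2⟩
    refine ⟨r • φ, ⟨hφ.smooth.const_smul r, hφ.compact.smul_left (f := fun _ => r),
      (closure_mono (Function.support_const_smul_subset r φ)).trans hφ.support⟩, ?_, ?_⟩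
    · filter_upwards [h1, Lp.coeFn_smul r w.fst] with x a c
      simp only [WithLp.smul_fst, c, Pi.smul_apply, a]
    · filter_upwards [h2, Lp.coeFn_smul r w.snd] with x a c
      simp only [WithLp.smul_snd, c, Pi.smul_apply, a, gradient]
      rw [fderiv_const_smul (hφ.differentiable x)]
      simp

/-- The Sobolev space `W^{1,p}_0(Ω)`: the closure of `C_c^∞(Ω)` in the `W^{1,p}(Ω)`-norm.
An element is the pair `(u, ∇u)` of a function and its weak gradient. -/
abbrev W0 {N : ℕ} (Ω : Set (RN N)) (p : ℝ) [Fact (1 < p)] : Type :=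
  ↥(testPairs Ω p).topologicalClosure

/-- The function `u` underlying an element of `W^{1,p}_0(Ω)`. -/
def W0.fn {N : ℕ} {Ω : Set (RN N)} {p : ℝ} [Fact (1 < p)] (u : W0 Ω p) : RN N → ℝ :=
  u.1.fst

/-- The weak gradient `∇u` of an element of `W^{1,p}_0(Ω)`. -/
def W0.grad {N : ℕ} {Ω : Set (RN N)} {p : ℝ} [Fact (1 < p)] (u : W0 Ω p) : RN N → RN N :=
  u.1.snd

/-- `W = W^{1,p}_0(Ω) × W^{1,q}_0(Ω)`, with the norm `‖(u, v)‖ = ‖u‖ + ‖v‖`. -/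
abbrev W {N : ℕ} (Ω : Set (RN N)) (p q : ℝ) [Fact (1 < p)] [Fact (1 < q)] : Type :=
  WithLp 1 (W0 Ω p × W0 Ω q)

/-- The critical Sobolev exponent `p^* = N p / (N - p)`. -/
def critExp (N : ℕ) (p : ℝ) : ℝ := N * p / (N - p)

/-- The energy functional of the system
`-Δ_p u = (lam a / (a + b)) |u|^(a-2) |v|^b u + |u|^(p^*-2) u`,
`-Δ_q v = (lam b / (a + b)) |u|^a |v|^(b-2) v + |v|^(q^*-2) v` in `Ω`, `u = v = 0` on `∂Ω`. -/
def energy {N : ℕ} (Ω : Set (RN N)) (p q a b lam : ℝ) [Fact (1 < p)] [Fact (1 < q)]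
    (w : W Ω p q) : ℝ :=
  (∫ x in Ω, (1 / p * ‖w.fst.grad x‖ ^ p + 1 / q * ‖w.snd.grad x‖ ^ q))
    - lam / (a + b) * (∫ x in Ω, |w.fst.fn x| ^ a * |w.snd.fn x| ^ b)
    - ∫ x in Ω, (1 / critExp N p * |w.fst.fn x| ^ critExp N p
        + 1 / critExp N q * |w.snd.fn x| ^ critExp N q)

/-- `g` is the weak (distributional) gradient of `u` on `ℝ^N`. -/
def HasWeakGradient {N : ℕ} (u : RN N → ℝ) (g : RN N → RN N) : Prop :=
  ∀ φ : RN N → ℝ, IsTestFunction Set.univ φ →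
    ∫ x, u x • gradient φ x = -∫ x, φ x • g x

/-- `u ∈ D^{1,p}(ℝ^N)` with `∇u = g`: `u ∈ L^{p^*}(ℝ^N)` has weak gradient `g ∈ L^p(ℝ^N)`. -/
structure MemD {N : ℕ} (p : ℝ) (u : RN N → ℝ) (g : RN N → RN N) : Prop where
  memLp : MemLp u (ENNReal.ofReal (critExp N p)) volume
  memLp_grad : MemLp g (ENNReal.ofReal p) volume
  weakGrad : HasWeakGradient u g

/-- The best Sobolev constant `S_p`: the infimum of `∫ |∇u|^p / (∫ |u|^{p^*})^(p/p^*)` over all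
nonzero `u ∈ D^{1,p}(ℝ^N)`. -/
def sobolevConst (N : ℕ) (p : ℝ) : ℝ :=
  sInf {r : ℝ | ∃ (u : RN N → ℝ) (g : RN N → RN N), MemD p u g ∧ ¬ u =ᵐ[volume] 0 ∧
    r = (∫ x, ‖g x‖ ^ p) / (∫ x, |u x| ^ critExp N p) ^ (p / critExp N p)}

/-- The threshold `c^* = (1/N) min {S_p^(N/p), S_q^(N/q)}`. -/
def critLevel (N : ℕ) (p q : ℝ) : ℝ :=
  1 / N * min (sobolevConst N p ^ (N / p)) (sobolevConst N q ^ (N / q))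

/-- The Palais–Smale condition at level `c` of a `C^1` functional `F` on a normed space: every
sequence with `F(w_j) → c` and `F'(w_j) → 0` in the dual has a norm convergent subsequence. -/
def PalaisSmale {X : Type*} [NormedAddCommGroup X] [NormedSpace ℝ X] (F : X → ℝ) (c : ℝ) : Prop :=
  ∀ w : ℕ → X, Tendsto (fun j => F (w j)) atTop (𝓝 c) →
    Tendsto (fun j => fderiv ℝ F (w j)) atTop (𝓝 0) →
    ∃ (k : ℕ → ℕ) (w₀ : X), StrictMono k ∧ Tendsto (fun j => w (k j)) atTop (𝓝 w₀)

end CriticalSystem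

end

noncomputable section

namespace CriticalSystem

/-! ### Elementary inequalities for powers -/

/-! The proof rests on `energy_identity`. Subtract from E(u, v) the fraction 1/p of the first
equation tested with u and the fraction 1/q of the second tested with v. What remains is λ(γ - 1)/(a
+ b) ∫|u|^a|v|^b + (1/N) ∫(|u|^{p*} + |v|^{q*}), and both terms are nonnegative because γ ≥ 1. This
serves twice: it bounds the critical integrals along a Palais–Smale sequence, hence the sequence
itself (`exists_bound_of_energy`), and it shows that the limit has nonnegative energy. The coupling
term is harmless: p₀ < p* and q₀ < q* give a/p* + b/q* < 1, so the term is strictly subcritical and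
converges along bounded, almost everywhere convergent sequences (`tendsto_integral_rpow_mul_rpow`).

Passing to the limit in the p-Laplacian needs almost everywhere convergence of the gradients. For a
bounded sequence of almost solutions the zero order terms are bounded in L^1. Testing the difference
of two equations with δ arctan((u_i - u_j)/δ) therefore costs only O(δ), up to a vanishing error.
Strict monotonicity of ξ ↦ |ξ|^{p-2}ξ, together with Rellich's theorem for u_j, then makes the
gradients Cauchy in L^1 (`W0.exists_integral_norm_grad_sub_le`). The pointwise limit lies in
W^{1,p}_0 by a Banach–Saks averaging argument (`mem_of_forall_exists_norm_add_rpow_le`), whose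
almost orthogonality hypothesis is supplied by the Brezis–Lieb lemma.

Let (u₀, v₀) be the limit and split all integrals by Brezis–Lieb. The limit satisfies its Nehari
identities, so for the remainder u_j - u₀ the integrals of |∇·|^p and |·|^{p*} become asymptotically
equal (`W0.nehari_of_tendsto_ae`), and likewise for v_j - v₀. Since 1/p - 1/p* = 1/N, the two
gradient integrals of the remainders add up in the limit to N(c - E(u₀, v₀)) ≤ Nc < Nc*. If A is a
limit of ∫|∇(u_j - u₀)|^p, Sobolev's inequality gives S_p A^{p/p*} ≤ A, so A = 0 or A ≥ S_p^{N/p};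
the second case is excluded by the level. Both remainders thus vanish, and Poincaré's inequality
gives norm convergence.

For the C^1 regularity, each term of E is a bounded linear map into Lebesgue spaces followed by an
integral functional. The latter has a Gateaux derivative that is continuous because Nemytskii
operators are (`continuous_nemytskii`). The coupling is treated on L^{p₀} × L^{q₀}, where it has the
exact homogeneity a/p₀ + b/q₀ = 1. -/

lemma add_rpow_le_two_rpow {x y r : ℝ} (hx : 0 ≤ x) (hy : 0 ≤ y) (hr : 0 ≤ r) :
    (x + y) ^ r ≤ 2 ^ r * (x ^ r + y ^ r) := by
  rcases le_total x y with h | h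
  · calc (x + y) ^ r ≤ (2 * y) ^ r := Real.rpow_le_rpow (by positivity) (by linarith) hr
      _ = 2 ^ r * y ^ r := Real.mul_rpow (by norm_num) hy
      _ ≤ _ := by gcongr; linarith [Real.rpow_nonneg hx r]
  · calc (x + y) ^ r ≤ (2 * x) ^ r := Real.rpow_le_rpow (by positivity) (by linarith) hr
      _ = 2 ^ r * x ^ r := Real.mul_rpow (by norm_num) hx
      _ ≤ _ := by gcongr; linarith [Real.rpow_nonneg hy r]

lemma rpow_sub_one_mul {x r : ℝ} (hx : 0 ≤ x) (hr : 1 < r) : x ^ (r - 1) * x = x ^ r := by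
  rcases hx.eq_or_lt with rfl | h
  · rw [mul_zero, Real.zero_rpow (by linarith)]
  · rw [Real.rpow_sub_one h.ne', div_mul_cancel₀ _ h.ne']

/-- Young's inequality with a small constant. -/
lemma exists_rpow_sub_one_mul_le {r : ℝ} (hr : 1 < r) {ε : ℝ} (hε : 0 < ε) :
    ∃ C, 0 ≤ C ∧ ∀ x y : ℝ, 0 ≤ x → 0 ≤ y → x ^ (r - 1) * y ≤ ε * x ^ r + C * y ^ r := by
  refine ⟨(1 / ε) ^ (r - 1), by positivity, fun x y hx hy => ?_⟩
  rcases le_total y (ε * x) with h | h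
  · have h1 : x ^ (r - 1) * y ≤ x ^ (r - 1) * (ε * x) := by gcongr
    have h2 : x ^ (r - 1) * (ε * x) = ε * x ^ r := by rw [← rpow_sub_one_mul hx hr]; ring
    have h3 : 0 ≤ (1 / ε) ^ (r - 1) * y ^ r := by positivity
    linarith
  · have h0 : x ≤ 1 / ε * y := by rw [one_div, inv_mul_eq_div, le_div_iff₀ hε]; linarith
    have h1 : x ^ (r - 1) * y ≤ (1 / ε * y) ^ (r - 1) * y := by
      gcongr
    have h2 : (1 / ε * y) ^ (r - 1) * y = (1 / ε) ^ (r - 1) * y ^ r := by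
      rw [Real.mul_rpow (by positivity) hy, mul_assoc, rpow_sub_one_mul hy hr]
    have h3 : 0 ≤ ε * x ^ r := by positivity
    linarith

/-- The graph of the convex function t ↦ t^r lies above its tangent at s; this is Bernoulli's
inequality at t / s, multiplied by s^r. -/
lemma rpow_sub_rpow_le {r s t : ℝ} (hr : 1 < r) (hs : 0 ≤ s) (ht : 0 ≤ t) :
    s ^ r - t ^ r ≤ r * s ^ (r - 1) * (s - t) := by
  rcases hs.eq_or_lt with rfl | hs'
  · rw [Real.zero_rpow (by linarith), Real.zero_rpow (by linarith)]
    have := Real.rpow_nonneg ht r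
    linarith
  · have h := one_add_mul_self_le_rpow_one_add (s := t / s - 1)
      (by linarith [div_nonneg ht hs]) hr.le
    rw [add_sub_cancel, Real.div_rpow ht hs, le_div_iff₀ (by positivity)] at h
    have e : s ^ r = s ^ (r - 1) * s := (rpow_sub_one_mul hs hr).symm
    have e2 : (1 + r * (t / s - 1)) * (s ^ (r - 1) * s)
        = s ^ (r - 1) * s + r * s ^ (r - 1) * (t - s) := by
      field_simp
    rw [e, e2] at h
    rw [e]
    linarith

lemma abs_rpow_sub_rpow_le {r s t m : ℝ} (hr : 1 < r) (hs : 0 ≤ s) (ht : 0 ≤ t) (hsm : s ≤ m)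
    (htm : t ≤ m) : |s ^ r - t ^ r| ≤ r * m ^ (r - 1) * |s - t| := by
  rcases le_total s t with h | h
  · rw [abs_sub_comm, abs_sub_comm s t, abs_of_nonneg (sub_nonneg.2 h),
      abs_of_nonneg (sub_nonneg.2 (Real.rpow_le_rpow hs h (by linarith)))]
    refine (rpow_sub_rpow_le hr ht hs).trans ?_
    have := Real.rpow_le_rpow ht htm (by linarith : 0 ≤ r - 1)
    have h2 : 0 ≤ t - s := by linarith
    gcongr
  · rw [abs_of_nonneg (sub_nonneg.2 h),
      abs_of_nonneg (sub_nonneg.2 (Real.rpow_le_rpow ht h (by linarith)))]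
    refine (rpow_sub_rpow_le hr hs ht).trans ?_
    have := Real.rpow_le_rpow hs hsm (by linarith : 0 ≤ r - 1)
    have h2 : 0 ≤ s - t := by linarith
    gcongr

/-- The pointwise input of the Brezis–Lieb lemma: the mean value bound r(‖x‖ + ‖y‖)^{r-1}‖y‖ is
split by Young's inequality, so that a merely bounded x is paid for with a small factor and a fixed
integrable y with a large one. -/
lemma exists_abs_norm_add_rpow_sub_le (E : Type*) [SeminormedAddCommGroup E] {r : ℝ} (hr : 1 < r)
    {ε : ℝ} (hε : 0 < ε) :
    ∃ C, 0 ≤ C ∧ ∀ x y : E, |‖x + y‖ ^ r - ‖x‖ ^ r| ≤ ε * ‖x‖ ^ r + C * ‖y‖ ^ r := by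
  have hr0 : 0 < r := by linarith
  -- The divisor anticipates the factor r of the mean value bound and the factor 2 ^ r from
  -- expanding (‖x‖ + ‖y‖) ^ r.
  obtain ⟨C, hC, h⟩ := exists_rpow_sub_one_mul_le hr (ε := ε / (r * 2 ^ r)) (by positivity)
  refine ⟨ε + r * C, by positivity, fun x y => ?_⟩
  have h1 := abs_rpow_sub_rpow_le hr (norm_nonneg (x + y)) (norm_nonneg x) (norm_add_le x y)
    (by linarith [norm_nonneg y])
  have h2 : |‖x + y‖ - ‖x‖| ≤ ‖y‖ := by simpa using abs_norm_sub_norm_le (x + y) x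
  have h3 := h (‖x‖ + ‖y‖) ‖y‖ (by positivity) (by positivity)
  have h4 := add_rpow_le_two_rpow (norm_nonneg x) (norm_nonneg y) hr0.le
  calc _ ≤ r * (‖x‖ + ‖y‖) ^ (r - 1) * ‖y‖ := h1.trans (by gcongr)
    _ = r * ((‖x‖ + ‖y‖) ^ (r - 1) * ‖y‖) := by ring
    _ ≤ r * (ε / (r * 2 ^ r) * (2 ^ r * (‖x‖ ^ r + ‖y‖ ^ r)) + C * ‖y‖ ^ r) := by
        gcongr
        exact h3.trans (by gcongr)
    _ = _ := by field_simp; ring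

/-- With M = x^s + y^t the product is at most M^θ, where θ = a/s + b/t < 1. A sublinear power is
below εM once M is large and bounded otherwise. This is where strict subcriticality becomes
compactness. -/
lemma exists_rpow_mul_rpow_le {a b s t : ℝ} (ha : 0 < a) (hb : 0 < b) (hs : 0 < s) (ht : 0 < t)
    (h : a / s + b / t < 1) {ε : ℝ} (hε : 0 < ε) :
    ∃ C, 0 ≤ C ∧ ∀ x y : ℝ, 0 ≤ x → 0 ≤ y → x ^ a * y ^ b ≤ ε * (x ^ s + y ^ t) + C := by
  set θ := a / s + b / t with hθ
  have hθ0 : 0 < θ := by positivity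
  -- The threshold beyond which M ^ θ ≤ ε * M, since K ^ (θ - 1) = ε and the exponent is negative.
  set K := ε ^ (1 / (θ - 1)) with hK
  have hK0 : 0 < K := by positivity
  have hKε : K ^ (θ - 1) = ε := by
    rw [hK, ← Real.rpow_mul hε.le, one_div_mul_cancel (by linarith), Real.rpow_one]
  refine ⟨K ^ θ, by positivity, fun x y hx hy => ?_⟩
  set M := x ^ s + y ^ t with hM
  have hxs : 0 ≤ x ^ s := by positivity
  have hyt : 0 ≤ y ^ t := by positivity
  have hM0 : 0 ≤ M := by positivity
  have h1 : x ^ a ≤ M ^ (a / s) := by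
    calc x ^ a = (x ^ s) ^ (a / s) := by
          rw [← Real.rpow_mul hx, mul_div_cancel₀ _ hs.ne']
      _ ≤ _ := Real.rpow_le_rpow hxs (by linarith) (by positivity)
  have h2 : y ^ b ≤ M ^ (b / t) := by
    calc y ^ b = (y ^ t) ^ (b / t) := by
          rw [← Real.rpow_mul hy, mul_div_cancel₀ _ ht.ne']
      _ ≤ _ := Real.rpow_le_rpow hyt (by linarith) (by positivity)
  have h3 : x ^ a * y ^ b ≤ M ^ θ := by
    rw [hθ, Real.rpow_add_of_nonneg hM0 (by positivity) (by positivity)]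
    gcongr
  rcases le_total M K with h4 | h4
  · have := Real.rpow_le_rpow hM0 h4 hθ0.le
    have : 0 ≤ ε * M := by positivity
    linarith
  · have hMpos : 0 < M := hK0.trans_le h4
    have h5 : M ^ θ = M ^ (θ - 1) * M := by
      rw [Real.rpow_sub_one hMpos.ne', div_mul_cancel₀ _ hMpos.ne']
    have h6 : M ^ (θ - 1) ≤ ε := by
      rw [← hKε]
      exact Real.rpow_le_rpow_of_nonpos hK0 h4 (by linarith)
    have h7 : M ^ (θ - 1) * M ≤ ε * M := by gcongr
    have : 0 ≤ K ^ θ := by positivity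
    linarith

/-! ### The power map -/

section Power

variable {E : Type*} [NormedAddCommGroup E] [InnerProductSpace ℝ E]

/-- The map `x ↦ ‖x‖^(s-2) x`, the gradient of `‖x‖^s / s`. -/
def powMap (s : ℝ) (x : E) : E := ‖x‖ ^ (s - 2) • x

lemma norm_powMap {s : ℝ} (hs : 1 < s) (x : E) : ‖powMap s x‖ = ‖x‖ ^ (s - 1) := by
  rw [powMap, norm_smul, Real.norm_of_nonneg (by positivity)]
  rcases (norm_nonneg x).eq_or_lt with h | h
  · rw [← h, mul_zero, Real.zero_rpow (by linarith)]
  · rw [show s - 1 = s - 2 + 1 by ring, Real.rpow_add_one h.ne']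

lemma inner_powMap_self {s : ℝ} (hs : 1 < s) (x : E) : inner ℝ (powMap s x) x = ‖x‖ ^ s := by
  rw [powMap, real_inner_smul_left, real_inner_self_eq_norm_sq]
  rcases (norm_nonneg x).eq_or_lt with h | h
  · rw [← h, Real.zero_rpow (x := s) (by linarith)]; ring
  · rw [← Real.rpow_natCast, ← Real.rpow_add h]; norm_num

lemma continuous_powMap {s : ℝ} (hs : 1 < s) : Continuous (powMap s : E → E) := by
  rw [continuous_iff_continuousAt]
  intro x
  by_cases hx : x = 0
  · subst hx
    rw [ContinuousAt, show powMap s (0 : E) = 0 by simp [powMap], tendsto_zero_iff_norm_tendsto_zero]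
    simp_rw [norm_powMap hs]
    have : Continuous fun y : E => ‖y‖ ^ (s - 1) :=
      continuous_norm.rpow_const fun _ => Or.inr (by linarith)
    have h := this.tendsto 0
    rwa [norm_zero, Real.zero_rpow (by linarith)] at h
  · unfold powMap
    exact (continuous_norm.continuousAt.rpow_const (Or.inl (norm_ne_zero_iff.2 hx))).smul
      continuousAt_id

/-- The monotonicity pairing splits into a radial part, nonnegative because powers are monotone, and
a multiple of the defect in the Cauchy–Schwarz inequality. This works for every s > 1, with no
distinction between s < 2 and s ≥ 2. -/
lemma inner_powMap_sub_nonneg_aux {s : ℝ} (hs : 1 < s) (x y : E) :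
    (‖x‖ ^ (s - 1) - ‖y‖ ^ (s - 1)) * (‖x‖ - ‖y‖)
        + (‖x‖ ^ (s - 2) + ‖y‖ ^ (s - 2)) * (‖x‖ * ‖y‖ - inner ℝ x y)
      = inner ℝ (powMap s x - powMap s y) (x - y) := by
  rw [inner_sub_left, inner_sub_right, inner_sub_right, inner_powMap_self hs, inner_powMap_self hs]
  simp only [powMap, real_inner_smul_left, real_inner_comm x y]
  have e : ∀ z : E, ‖z‖ ^ (s - 1) = ‖z‖ ^ (s - 2) * ‖z‖ := fun z => by
    rw [← norm_powMap hs, powMap, norm_smul, Real.norm_of_nonneg (by positivity)]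
  have e2 : ∀ z : E, ‖z‖ ^ s = ‖z‖ ^ (s - 1) * ‖z‖ := fun z =>
    (rpow_sub_one_mul (norm_nonneg z) hs).symm
  rw [e2 x, e2 y, e x, e y]
  ring

lemma rpow_sub_mul_sub_nonneg {s x y : ℝ} (hs : 0 ≤ s) (hx : 0 ≤ x) (hy : 0 ≤ y) :
    0 ≤ (x ^ s - y ^ s) * (x - y) := by
  rcases le_total x y with h | h
  · exact mul_nonneg_of_nonpos_of_nonpos (sub_nonpos.2 (Real.rpow_le_rpow hx h hs))
      (sub_nonpos.2 h)
  · exact mul_nonneg (sub_nonneg.2 (Real.rpow_le_rpow hy h hs)) (sub_nonneg.2 h)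

lemma inner_powMap_sub_nonneg {s : ℝ} (hs : 1 < s) (x y : E) :
    0 ≤ inner ℝ (powMap s x - powMap s y) (x - y) := by
  rw [← inner_powMap_sub_nonneg_aux hs]
  have h1 := rpow_sub_mul_sub_nonneg (by linarith : 0 ≤ s - 1) (norm_nonneg x) (norm_nonneg y)
  have h2 := sub_nonneg.2 (real_inner_le_norm x y)
  positivity

/-- If the pairing vanishes, so do both parts of the splitting: the radial part forces equal norms,
and then equality in Cauchy–Schwarz forces equal vectors. -/
lemma inner_powMap_sub_pos {s : ℝ} (hs : 1 < s) {x y : E} (hxy : x ≠ y) :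
    0 < inner ℝ (powMap s x - powMap s y) (x - y) := by
  refine (inner_powMap_sub_nonneg hs x y).lt_of_ne' fun h0 => hxy ?_
  rw [← inner_powMap_sub_nonneg_aux hs] at h0
  have h1 := rpow_sub_mul_sub_nonneg (by linarith : 0 ≤ s - 1) (norm_nonneg x) (norm_nonneg y)
  have h2 := sub_nonneg.2 (real_inner_le_norm x y)
  have h3 : 0 ≤ (‖x‖ ^ (s - 2) + ‖y‖ ^ (s - 2)) * (‖x‖ * ‖y‖ - inner ℝ x y) := by positivity
  have h4 : (‖x‖ ^ (s - 1) - ‖y‖ ^ (s - 1)) * (‖x‖ - ‖y‖) = 0 := by linarith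
  have h5 : ‖x‖ = ‖y‖ := by
    rcases mul_eq_zero.1 h4 with h | h
    · exact (Real.rpow_left_inj (norm_nonneg x) (norm_nonneg y) (by linarith : s - 1 ≠ 0)).1
        (sub_eq_zero.1 h)
    · exact sub_eq_zero.1 h
  by_cases hx : x = 0
  · rw [hx, norm_zero] at h5
    rw [hx, norm_eq_zero.1 h5.symm]
  · have hx' : 0 < ‖x‖ := norm_pos_iff.2 hx
    have h6 : ‖x‖ * ‖y‖ - inner ℝ x y = 0 := by
      have : (‖x‖ ^ (s - 2) + ‖y‖ ^ (s - 2)) * (‖x‖ * ‖y‖ - inner ℝ x y) = 0 := by linarith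
      rcases mul_eq_zero.1 this with h | h
      · have := Real.rpow_pos_of_pos hx' (s - 2)
        have := Real.rpow_nonneg (norm_nonneg y) (s - 2)
        linarith
      · exact h
    rw [← sub_eq_zero, ← norm_eq_zero, ← sq_eq_zero_iff, norm_sub_sq_real, ← h5]
    rw [← h5] at h6
    linarith [pow_two ‖x‖]

/-- Quantitative strict monotonicity of `powMap`. -/
lemma exists_norm_sub_le_powMap [FiniteDimensional ℝ E] {s : ℝ} (hs : 1 < s) {η : ℝ}
    (hη : 0 < η) : ∃ K, 0 ≤ K ∧ ∀ x y : E, ‖x - y‖ ≤ η * (1 + ‖x‖ ^ s + ‖y‖ ^ s)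
      + K * inner ℝ (powMap s x - powMap s y) (x - y) := by
  -- Chosen so that 2 * R ^ (1 - s) = η: outside the ball of radius R the superlinear term η‖x‖^s
  -- alone dominates ‖x - y‖ ≤ 2‖x‖.
  set R := (η / 2) ^ (1 / (1 - s)) with hR
  have hR0 : 0 < R := by positivity
  have hRη : R ^ (1 - s) = η / 2 := by
    rw [hR, ← Real.rpow_mul (by positivity), one_div_mul_cancel (by linarith), Real.rpow_one]
  have hlarge : ∀ x y : E, ‖y‖ ≤ ‖x‖ → R ≤ ‖x‖ → ‖x - y‖ ≤ η * ‖x‖ ^ s := by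
    intro x y hyx hx
    have hx0 : 0 < ‖x‖ := hR0.trans_le hx
    have h1 : ‖x‖ ^ (1 - s) ≤ η / 2 := by
      rw [← hRη]
      exact Real.rpow_le_rpow_of_nonpos hR0 hx (by linarith)
    have h2 : ‖x‖ = ‖x‖ ^ (1 - s) * ‖x‖ ^ s := by
      rw [← Real.rpow_add hx0]; simp
    calc ‖x - y‖ ≤ ‖x‖ + ‖y‖ := norm_sub_le _ _
      _ ≤ 2 * ‖x‖ := by linarith
      _ = 2 * (‖x‖ ^ (1 - s) * ‖x‖ ^ s) := by rw [← h2]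
      _ ≤ 2 * (η / 2 * ‖x‖ ^ s) := by gcongr
      _ = _ := by ring
  -- Inside the ball, pairs at distance at least η form a compact set on which the continuous
  -- pairing has a positive minimum c. The constant 2 * R / c then brings it above the diameter 2 *
  -- R.
  set S : Set (E × E) := (Metric.closedBall 0 R ×ˢ Metric.closedBall 0 R) ∩
    {z | η ≤ ‖z.1 - z.2‖} with hS
  have hSc : IsCompact S :=
    ((isCompact_closedBall 0 R).prod (isCompact_closedBall 0 R)).inter_right
      (isClosed_le continuous_const (continuous_fst.sub continuous_snd).norm)
  have hDc : Continuous fun z : E × E => inner ℝ (powMap s z.1 - powMap s z.2) (z.1 - z.2) :=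
    (((continuous_powMap hs).comp continuous_fst).sub
      ((continuous_powMap hs).comp continuous_snd)).inner (continuous_fst.sub continuous_snd)
  obtain ⟨c, hc0, hc⟩ : ∃ c > 0, ∀ z ∈ S,
      c ≤ inner ℝ (powMap s z.1 - powMap s z.2) (z.1 - z.2) := by
    rcases S.eq_empty_or_nonempty with h | h
    · exact ⟨1, one_pos, by simp [h]⟩
    · obtain ⟨z, hz, hmin⟩ := hSc.exists_isMinOn h hDc.continuousOn
      refine ⟨_, inner_powMap_sub_pos hs (x := z.1) (y := z.2) ?_, fun w hw => hmin hw⟩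
      intro h0
      have := hz.2
      simp only [Set.mem_ofPred_eq, h0, sub_self, norm_zero] at this
      linarith
  refine ⟨2 * R / c, by positivity, fun x y => ?_⟩
  have hD := inner_powMap_sub_nonneg hs x y
  have hx := Real.rpow_nonneg (norm_nonneg x) s
  have hy := Real.rpow_nonneg (norm_nonneg y) s
  have hKD : 0 ≤ 2 * R / c * inner ℝ (powMap s x - powMap s y) (x - y) := by positivity
  by_cases h1 : ‖x‖ ≤ R ∧ ‖y‖ ≤ R
  · by_cases h2 : η ≤ ‖x - y‖
    · have h3 := hc (x, y) ⟨⟨by simpa using h1.1, by simpa using h1.2⟩, h2⟩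
      have h4 : 2 * R = 2 * R / c * c := by field_simp
      have h5 : 2 * R / c * c ≤ 2 * R / c * inner ℝ (powMap s x - powMap s y) (x - y) := by
        gcongr
      have h6 : 0 ≤ η * (1 + ‖x‖ ^ s + ‖y‖ ^ s) := by positivity
      linarith [norm_sub_le x y]
    · nlinarith
  · rcases le_total ‖y‖ ‖x‖ with h | h
    · have := hlarge x y h (by by_contra hcon; exact h1 ⟨by linarith, by linarith⟩)
      nlinarith
    · have := hlarge y x h (by by_contra hcon; exact h1 ⟨by linarith, by linarith⟩)
      rw [norm_sub_rev] at this
      nlinarith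

end Power

/-! ### Passage to the limit under the integral sign -/

section Limits

variable {α : Type*} [MeasurableSpace α] {μ : Measure α}

lemma memLp_ofReal_iff {E : Type*} [NormedAddCommGroup E] {f : α → E} {r : ℝ} (hr : 0 < r)
    (hf : AEStronglyMeasurable f μ) :
    MemLp f (ENNReal.ofReal r) μ ↔ Integrable (fun x => ‖f x‖ ^ r) μ := by
  rw [← integrable_norm_rpow_iff hf (by simpa using hr) ENNReal.ofReal_ne_top,
    ENNReal.toReal_ofReal hr.le]

lemma integrable_norm_rpow_of_memLp {E : Type*} [NormedAddCommGroup E] {f : α → E} {r : ℝ}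
    (hr : 0 < r) (hf : MemLp f (ENNReal.ofReal r) μ) : Integrable (fun x => ‖f x‖ ^ r) μ :=
  (memLp_ofReal_iff hr hf.1).1 hf

lemma eLpNorm_ofReal_eq {E : Type*} [NormedAddCommGroup E] {f : α → E} {r : ℝ} (hr : 0 < r)
    (hf : MemLp f (ENNReal.ofReal r) μ) :
    eLpNorm f (ENNReal.ofReal r) μ = ENNReal.ofReal ((∫ x, ‖f x‖ ^ r ∂μ) ^ r⁻¹) := by
  rw [hf.eLpNorm_eq_integral_rpow_norm (by simpa using hr) ENNReal.ofReal_ne_top,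
    ENNReal.toReal_ofReal hr.le]

/-- A dominated convergence theorem tolerating a part `G n` that is small only in integral: the
positive part of `F n - G n` is dominated by |H| and tends to 0 pointwise. -/
lemma tendsto_integral_zero_of_le_add {F : ℕ → α → ℝ} (hF0 : ∀ n, ∀ᵐ x ∂μ, 0 ≤ F n x)
    (hFm : ∀ n, AEStronglyMeasurable (F n) μ)
    (hlim : ∀ᵐ x ∂μ, Tendsto (fun n => F n x) atTop (𝓝 0))
    (h : ∀ ε > 0, ∃ (G : ℕ → α → ℝ) (H : α → ℝ), Integrable H μ ∧ (∀ n, Integrable (G n) μ) ∧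
      (∀ᶠ n in atTop, ∫ x, G n x ∂μ ≤ ε) ∧ ∀ n, ∀ᵐ x ∂μ, 0 ≤ G n x ∧ F n x ≤ G n x + H x) :
    Tendsto (fun n => ∫ x, F n x ∂μ) atTop (𝓝 0) := by
  rw [Metric.tendsto_atTop']
  intro ε hε
  obtain ⟨G, H, hH, hG, hGε, hFG⟩ := h (ε / 2) (by positivity)
  have hm : ∀ n, AEStronglyMeasurable (fun x => max (F n x - G n x) 0) μ := fun n =>
    (((hFm n).sub (hG n).1).aemeasurable.max aemeasurable_const).aestronglyMeasurable
  have hbd : ∀ n, ∀ᵐ x ∂μ, ‖max (F n x - G n x) 0‖ ≤ |H x| := by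
    intro n
    filter_upwards [hFG n] with x hx
    rw [Real.norm_of_nonneg (le_max_right _ _)]
    exact max_le (by linarith [le_abs_self (H x), hx.2]) (abs_nonneg _)
  have hto : ∀ᵐ x ∂μ, Tendsto (fun n => max (F n x - G n x) 0) atTop (𝓝 0) := by
    filter_upwards [hlim, ae_all_iff.2 hF0, ae_all_iff.2 hFG] with x h1 h2 h3
    refine squeeze_zero (fun n => le_max_right _ _) (fun n => max_le ?_ (h2 n)) h1
    linarith [(h3 n).1]
  have hdct := tendsto_integral_of_dominated_convergence (fun x => |H x|) hm hH.abs hbd hto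
  rw [integral_zero] at hdct
  have hev := hdct.eventually (gt_mem_nhds (half_pos hε))
  obtain ⟨n₀, hn₀⟩ := eventually_atTop.1 (hev.and hGε)
  refine ⟨n₀, fun n hn => ?_⟩
  obtain ⟨h1, h2⟩ := hn₀ n hn.le
  have hmi : Integrable (fun x => max (F n x - G n x) 0) μ :=
    Integrable.mono' hH.abs (hm n) (hbd n)
  have hle : ∫ x, F n x ∂μ ≤ ∫ x, (G n x + max (F n x - G n x) 0) ∂μ := by
    refine integral_mono_of_nonneg (hF0 n) ((hG n).add hmi) (Eventually.of_forall fun x => ?_)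
    linarith [le_max_left (F n x - G n x) 0]
  rw [integral_add (hG n) hmi] at hle
  rw [Real.dist_0_eq_abs, abs_of_nonneg (integral_nonneg_of_ae (hF0 n))]
  linarith

/-- The form used with Young-type inequalities: the uncontrolled part is an arbitrarily small
multiple of a sequence bounded in L^1. -/
lemma tendsto_integral_zero_of_le_small_mul {F G : ℕ → α → ℝ} {C : ℝ}
    (hF0 : ∀ n, ∀ᵐ x ∂μ, 0 ≤ F n x)
    (hFm : ∀ n, AEStronglyMeasurable (F n) μ)
    (hlim : ∀ᵐ x ∂μ, Tendsto (fun n => F n x) atTop (𝓝 0))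
    (hG : ∀ n, Integrable (G n) μ) (hG0 : ∀ n, ∀ᵐ x ∂μ, 0 ≤ G n x) (hC : ∀ n, ∫ x, G n x ∂μ ≤ C)
    (h : ∀ ε > 0, ∃ H : α → ℝ, Integrable H μ ∧ ∀ n, ∀ᵐ x ∂μ, F n x ≤ ε * G n x + H x) :
    Tendsto (fun n => ∫ x, F n x ∂μ) atTop (𝓝 0) := by
  refine tendsto_integral_zero_of_le_add hF0 hFm hlim fun ε hε => ?_
  have hC' : 0 < |C| + 1 := by positivity
  obtain ⟨H, hH, hle⟩ := h (ε / (|C| + 1)) (by positivity)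
  refine ⟨fun n x => ε / (|C| + 1) * G n x, H, hH, fun n => (hG n).const_mul _,
    Eventually.of_forall fun n => ?_, fun n => ?_⟩
  · rw [integral_const_mul, div_mul_eq_mul_div, div_le_iff₀ hC']
    gcongr
    linarith [hC n, le_abs_self C]
  · filter_upwards [hle n, hG0 n] with x h1 h2
    exact ⟨by positivity, h1⟩

lemma tendsto_integral_of_abs_sub {F : ℕ → α → ℝ} {f : α → ℝ} (hF : ∀ n, Integrable (F n) μ)
    (hf : Integrable f μ)
    (h : Tendsto (fun n => ∫ x, |F n x - f x| ∂μ) atTop (𝓝 0)) :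
    Tendsto (fun n => ∫ x, F n x ∂μ) atTop (𝓝 (∫ x, f x ∂μ)) := by
  rw [tendsto_iff_norm_sub_tendsto_zero]
  refine squeeze_zero (fun n => norm_nonneg _) (fun n => ?_) h
  rw [← integral_sub (hF n) hf]
  exact norm_integral_le_integral_norm _

variable {E : Type*} [NormedAddCommGroup E]

/-- **Fatou's lemma** in `L^r`. -/
lemma memLp_of_tendsto_ae {f : ℕ → α → E} {g : α → E} {r : ℝ} (hr : 0 < r)
    (hf : ∀ n, MemLp (f n) (ENNReal.ofReal r) μ)
    (hlim : ∀ᵐ x ∂μ, Tendsto (fun n => f n x) atTop (𝓝 (g x)))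
    {C : ℝ} (hC : ∀ n, ∫ x, ‖f n x‖ ^ r ∂μ ≤ C) :
    MemLp g (ENNReal.ofReal r) μ ∧ ∫ x, ‖g x‖ ^ r ∂μ ≤ C := by
  have hgm : AEStronglyMeasurable g μ := aestronglyMeasurable_of_tendsto_ae _ (fun n => (hf n).1) hlim
  have hC0 : 0 ≤ C := (integral_nonneg fun x => by positivity).trans (hC 0)
  have hle : ∫⁻ x, ENNReal.ofReal (‖g x‖ ^ r) ∂μ ≤ ENNReal.ofReal C := by
    calc ∫⁻ x, ENNReal.ofReal (‖g x‖ ^ r) ∂μ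
        = ∫⁻ x, liminf (fun n => ENNReal.ofReal (‖f n x‖ ^ r)) atTop ∂μ := by
          refine lintegral_congr_ae ?_
          filter_upwards [hlim] with x hx
          exact (ENNReal.tendsto_ofReal (hx.norm.rpow_const (Or.inr hr.le))).liminf_eq.symm
      _ ≤ liminf (fun n => ∫⁻ x, ENNReal.ofReal (‖f n x‖ ^ r) ∂μ) atTop :=
          lintegral_liminf_le' fun n =>
            ((hf n).1.norm.aemeasurable.pow_const r).ennreal_ofReal
      _ ≤ ENNReal.ofReal C := by
          refine liminf_le_of_le (by isBoundedDefault) fun b hb => ?_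
          obtain ⟨n, hn⟩ := hb.exists
          refine hn.trans ?_
          rw [← ofReal_integral_eq_lintegral_ofReal (integrable_norm_rpow_of_memLp hr (hf n))
            (Eventually.of_forall fun x => by positivity)]
          exact ENNReal.ofReal_le_ofReal (hC n)
  have hint : Integrable (fun x => ‖g x‖ ^ r) μ := by
    refine ⟨(hgm.norm.aemeasurable.pow_const r).aestronglyMeasurable, ?_⟩
    rw [hasFiniteIntegral_iff_ofReal (Eventually.of_forall fun x => by positivity)]
    exact hle.trans_lt ENNReal.ofReal_lt_top
  refine ⟨(memLp_ofReal_iff hr hgm).2 hint, ?_⟩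
  rw [← ofReal_integral_eq_lintegral_ofReal hint (Eventually.of_forall fun x => by positivity)]
    at hle
  exact (ENNReal.ofReal_le_ofReal_iff hC0).1 hle

/-- The **Brezis–Lieb lemma**, in the form used to split `L^r`-norms. -/
lemma tendsto_integral_abs_norm_add_rpow_sub {h : ℕ → α → E} {s : α → E} {r C : ℝ} (hr : 1 < r)
    (hh : ∀ n, MemLp (h n) (ENNReal.ofReal r) μ) (hs : MemLp s (ENNReal.ofReal r) μ)
    (hlim : ∀ᵐ x ∂μ, Tendsto (fun n => h n x) atTop (𝓝 0))
    (hC : ∀ n, ∫ x, ‖h n x‖ ^ r ∂μ ≤ C) :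
    Tendsto (fun n => ∫ x, |‖h n x + s x‖ ^ r - ‖h n x‖ ^ r - ‖s x‖ ^ r| ∂μ) atTop (𝓝 0) := by
  have hr0 : 0 < r := by linarith
  have hsi := integrable_norm_rpow_of_memLp hr0 hs
  have hhi := fun n => integrable_norm_rpow_of_memLp hr0 (hh n)
  have hhsi := fun n => integrable_norm_rpow_of_memLp hr0 ((hh n).add hs)
  refine tendsto_integral_zero_of_le_small_mul (G := fun n x => ‖h n x‖ ^ r) (C := C)
    (fun n => Eventually.of_forall fun x => abs_nonneg _)
    (fun n => (((hhsi n).sub (hhi n)).sub hsi).abs.1) ?_ hhi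
    (fun n => Eventually.of_forall fun x => by positivity) hC fun ε hε => ?_
  · filter_upwards [hlim] with x hx
    have hc : Continuous fun y : E => |‖y + s x‖ ^ r - ‖y‖ ^ r - ‖s x‖ ^ r| :=
      ((((continuous_add_const (s x)).norm.rpow_const fun _ => Or.inr hr0.le).sub
        (continuous_norm.rpow_const fun _ => Or.inr hr0.le)).sub continuous_const).abs
    have := (hc.tendsto 0).comp hx
    simpa [Function.comp_def, Real.zero_rpow hr0.ne'] using this
  · obtain ⟨K, hK, hle⟩ := exists_abs_norm_add_rpow_sub_le E hr hε
    refine ⟨fun x => (K + 1) * ‖s x‖ ^ r, hsi.const_mul _, fun n => Eventually.of_forall fun x => ?_⟩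
    have h1 := hle (h n x) (s x)
    have h2 : 0 ≤ ‖s x‖ ^ r := by positivity
    calc _ ≤ |‖h n x + s x‖ ^ r - ‖h n x‖ ^ r| + |‖s x‖ ^ r| := abs_sub _ _
      _ ≤ _ := by rw [abs_of_nonneg h2]; linarith

lemma tendsto_integral_norm_add_rpow_sub {h : ℕ → α → E} {s : α → E} {r C : ℝ} (hr : 1 < r)
    (hh : ∀ n, MemLp (h n) (ENNReal.ofReal r) μ) (hs : MemLp s (ENNReal.ofReal r) μ)
    (hlim : ∀ᵐ x ∂μ, Tendsto (fun n => h n x) atTop (𝓝 0))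
    (hC : ∀ n, ∫ x, ‖h n x‖ ^ r ∂μ ≤ C) :
    Tendsto (fun n => ∫ x, ‖h n x + s x‖ ^ r ∂μ - ∫ x, ‖h n x‖ ^ r ∂μ) atTop
      (𝓝 (∫ x, ‖s x‖ ^ r ∂μ)) := by
  have hr0 : 0 < r := by linarith
  have hsi := integrable_norm_rpow_of_memLp hr0 hs
  have hhi := fun n => integrable_norm_rpow_of_memLp hr0 (hh n)
  have hhsi := fun n => integrable_norm_rpow_of_memLp hr0 ((hh n).add hs)
  have := tendsto_integral_of_abs_sub (fun n => (hhsi n).sub (hhi n)) hsi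
    (tendsto_integral_abs_norm_add_rpow_sub hr hh hs hlim hC)
  refine this.congr fun n => ?_
  exact integral_sub (hhsi n) (hhi n)

/-- `|u_n|^a |v_n|^b` converges in `L^1` if `u_n`, `v_n` converge almost everywhere and are
bounded in `L^s`, `L^t` with `a / s + b / t < 1`. -/
lemma tendsto_integral_rpow_mul_rpow [IsFiniteMeasure μ] {F : Type*} [NormedAddCommGroup F]
    {u : ℕ → α → E} {v : ℕ → α → F} {φ : E → F → ℝ}
    {u₀ : α → E} {v₀ : α → F} {a b s t K C : ℝ} (ha : 0 < a) (hb : 0 < b) (hs : 0 < s) (ht : 0 < t)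
    (hst : a / s + b / t < 1) (hu : ∀ n, MemLp (u n) (ENNReal.ofReal s) μ)
    (hv : ∀ n, MemLp (v n) (ENNReal.ofReal t) μ)
    (hulim : ∀ᵐ x ∂μ, Tendsto (fun n => u n x) atTop (𝓝 (u₀ x)))
    (hvlim : ∀ᵐ x ∂μ, Tendsto (fun n => v n x) atTop (𝓝 (v₀ x)))
    (huC : ∀ n, ∫ x, ‖u n x‖ ^ s ∂μ ≤ C) (hvC : ∀ n, ∫ x, ‖v n x‖ ^ t ∂μ ≤ C)
    (hφ : Continuous (Function.uncurry φ)) (hφK : ∀ x y, |φ x y| ≤ K * (‖x‖ ^ a * ‖y‖ ^ b)) :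
    Tendsto (fun n => ∫ x, φ (u n x) (v n x) ∂μ) atTop (𝓝 (∫ x, φ (u₀ x) (v₀ x) ∂μ)) := by
  obtain ⟨hu₀, hu₀C⟩ := memLp_of_tendsto_ae hs hu hulim huC
  obtain ⟨hv₀, hv₀C⟩ := memLp_of_tendsto_ae ht hv hvlim hvC
  have hui := fun n => integrable_norm_rpow_of_memLp hs (hu n)
  have hvi := fun n => integrable_norm_rpow_of_memLp ht (hv n)
  have hu₀i := integrable_norm_rpow_of_memLp hs hu₀
  have hv₀i := integrable_norm_rpow_of_memLp ht hv₀
  have hbd : ∀ ε > 0, ∃ D, ∀ x y, |φ x y| ≤ ε * (‖x‖ ^ s + ‖y‖ ^ t) + D := by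
    intro ε hε
    have hK' : 0 < |K| + 1 := by positivity
    obtain ⟨D, hD, h⟩ := exists_rpow_mul_rpow_le ha hb hs ht hst (ε := ε / (|K| + 1)) (by positivity)
    refine ⟨(|K| + 1) * D, fun x y => ?_⟩
    calc |φ x y| ≤ K * (‖x‖ ^ a * ‖y‖ ^ b) := hφK x y
      _ ≤ (|K| + 1) * (ε / (|K| + 1) * (‖x‖ ^ s + ‖y‖ ^ t) + D) := by
          gcongr
          · linarith [le_abs_self K]
          · exact h _ _ (norm_nonneg x) (norm_nonneg y)
      _ = _ := by field_simp
  have hm : ∀ {w : α → E} {z : α → F}, AEStronglyMeasurable w μ → AEStronglyMeasurable z μ →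
      AEStronglyMeasurable (fun x => φ (w x) (z x)) μ := fun hw hz =>
    hφ.comp_aestronglyMeasurable (hw.prodMk hz)
  have hint : ∀ {w : α → E} {z : α → F}, AEStronglyMeasurable w μ → AEStronglyMeasurable z μ →
      Integrable (fun x => ‖w x‖ ^ s) μ → Integrable (fun x => ‖z x‖ ^ t) μ →
      Integrable (fun x => φ (w x) (z x)) μ := by
    intro w z hw hz hwi hzi
    obtain ⟨D, hD⟩ := hbd 1 one_pos
    exact Integrable.mono' (((hwi.add hzi).const_mul 1).add (integrable_const D)) (hm hw hz)
      (Eventually.of_forall fun x => hD _ _)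
  refine tendsto_integral_of_abs_sub (fun n => hint (hu n).1 (hv n).1 (hui n) (hvi n))
    (hint hu₀.1 hv₀.1 hu₀i hv₀i) ?_
  refine tendsto_integral_zero_of_le_small_mul (G := fun n x => ‖u n x‖ ^ s + ‖v n x‖ ^ t)
    (C := C + C) (fun n => Eventually.of_forall fun x => abs_nonneg _)
    (fun n => ((hm (hu n).1 (hv n).1).sub (hm hu₀.1 hv₀.1)).norm) ?_ (fun n => (hui n).add (hvi n))
    (fun n => Eventually.of_forall fun x => by positivity) (fun n => ?_) fun ε hε => ?_
  · filter_upwards [hulim, hvlim] with x h1 h2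
    have := (((hφ.tendsto (u₀ x, v₀ x)).comp (h1.prodMk_nhds h2)).sub_const (φ (u₀ x) (v₀ x))).abs
    simpa using this
  · rw [integral_add (hui n) (hvi n)]
    exact add_le_add (huC n) (hvC n)
  · obtain ⟨D, hD⟩ := hbd ε hε
    refine ⟨fun x => D + (ε * (‖u₀ x‖ ^ s + ‖v₀ x‖ ^ t) + D),
      (integrable_const D).add (((hu₀i.add hv₀i).const_mul ε).add (integrable_const D)),
      fun n => Eventually.of_forall fun x => ?_⟩
    have h1 := hD (u n x) (v n x)
    have h2 := hD (u₀ x) (v₀ x)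
    linarith [abs_sub (φ (u n x) (v n x)) (φ (u₀ x) (v₀ x))]

/-- Replaces weak convergence of ‖f_n‖^{r-2} f_n in the dual Lebesgue space. Young's inequality puts
the small constant on the bounded sequence f_n and the large one on the fixed function k. -/
lemma tendsto_integral_inner_powMap [InnerProductSpace ℝ E]
    {f : ℕ → α → E} {g k : α → E} {r C : ℝ} (hr : 1 < r)
    (hf : ∀ n, MemLp (f n) (ENNReal.ofReal r) μ) (hk : MemLp k (ENNReal.ofReal r) μ)
    (hlim : ∀ᵐ x ∂μ, Tendsto (fun n => f n x) atTop (𝓝 (g x)))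
    (hC : ∀ n, ∫ x, ‖f n x‖ ^ r ∂μ ≤ C) :
    Tendsto (fun n => ∫ x, inner ℝ (powMap r (f n x)) (k x) ∂μ) atTop
      (𝓝 (∫ x, inner ℝ (powMap r (g x)) (k x) ∂μ)) := by
  have hr0 : 0 < r := by linarith
  obtain ⟨hg, -⟩ := memLp_of_tendsto_ae hr0 hf hlim hC
  have hfi := fun n => integrable_norm_rpow_of_memLp hr0 (hf n)
  have hgi := integrable_norm_rpow_of_memLp hr0 hg
  have hki := integrable_norm_rpow_of_memLp hr0 hk
  have hbd : ∀ ε > 0, ∃ D, ∀ x y : E, |inner ℝ (powMap r x) y| ≤ ε * ‖x‖ ^ r + D * ‖y‖ ^ r := by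
    intro ε hε
    obtain ⟨D, hD, h⟩ := exists_rpow_sub_one_mul_le hr hε
    refine ⟨D, fun x y => (abs_real_inner_le_norm _ _).trans ?_⟩
    rw [norm_powMap hr]
    exact h _ _ (norm_nonneg x) (norm_nonneg y)
  have hm : ∀ {w : α → E}, AEStronglyMeasurable w μ →
      AEStronglyMeasurable (fun x => inner ℝ (powMap r (w x)) (k x)) μ := fun hw =>
    ((continuous_powMap hr).comp_aestronglyMeasurable hw).inner hk.1
  have hint : ∀ {w : α → E}, AEStronglyMeasurable w μ → Integrable (fun x => ‖w x‖ ^ r) μ →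
      Integrable (fun x => inner ℝ (powMap r (w x)) (k x)) μ := by
    intro w hw hwi
    obtain ⟨D, hD⟩ := hbd 1 one_pos
    exact Integrable.mono' ((hwi.const_mul 1).add (hki.const_mul D)) (hm hw)
      (Eventually.of_forall fun x => hD _ _)
  refine tendsto_integral_of_abs_sub (fun n => hint (hf n).1 (hfi n)) (hint hg.1 hgi) ?_
  refine tendsto_integral_zero_of_le_small_mul (G := fun n x => ‖f n x‖ ^ r)
    (C := C) (fun n => Eventually.of_forall fun x => abs_nonneg _)
    (fun n => ((hm (hf n).1).sub (hm hg.1)).norm) ?_ hfi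
    (fun n => Eventually.of_forall fun x => by positivity) hC fun ε hε => ?_
  · filter_upwards [hlim] with x h1
    have := ((((continuous_powMap hr).tendsto (g x)).comp h1).inner
      (tendsto_const_nhds (x := k x))).sub_const (inner ℝ (powMap r (g x)) (k x)) |>.abs
    simpa using this
  · obtain ⟨D, hD⟩ := hbd ε hε
    refine ⟨fun x => D * ‖k x‖ ^ r + (ε * ‖g x‖ ^ r + D * ‖k x‖ ^ r),
      (hki.const_mul D).add ((hgi.const_mul ε).add (hki.const_mul D)),
      fun n => Eventually.of_forall fun x => ?_⟩
    have h1 := hD (f n x) (k x)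
    have h2 := hD (g x) (k x)
    linarith [abs_sub (inner ℝ (powMap r (f n x)) (k x)) (inner ℝ (powMap r (g x)) (k x))]

end Limits

/-- A **Banach–Saks** argument: a closed subspace containing `f + h n` for all `n` contains `f`
if `‖s + h n‖ ^ r ≤ ‖s‖ ^ r + M` up to a small error for each fixed `s` and some large `n`. -/
lemma mem_of_forall_exists_norm_add_rpow_le {X : Type*} [NormedAddCommGroup X] [NormedSpace ℝ X]
    {V : Submodule ℝ X} (hV : IsClosed (V : Set X)) {f : X} {h : ℕ → X} {r M : ℝ} (hr : 1 < r)
    (hM : 0 ≤ M) (hfh : ∀ n, f + h n ∈ V) (H : ∀ s : X, ∃ n, ‖h n + s‖ ^ r ≤ ‖s‖ ^ r + M) :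
    f ∈ V := by
  -- The vector s is a sum of K terms of `h`, each chosen by applying `H` to the previous partial
  -- sum. The norm then grows only like K ^ (1 / r), so s / K tends to 0 while f + s / K stays in V.
  have key : ∀ K : ℕ, ∃ s : X, (K : ℝ) • f + s ∈ V ∧ ‖s‖ ^ r ≤ K * M := by
    intro K
    induction K with
    | zero => exact ⟨0, by simp, by simp [Real.zero_rpow (by linarith : r ≠ 0)]⟩
    | succ K ih =>
      obtain ⟨s, hs, hsM⟩ := ih
      obtain ⟨n, hn⟩ := H s
      refine ⟨h n + s, ?_, ?_⟩
      · have : ((K + 1 : ℕ) : ℝ) • f + (h n + s) = ((K : ℝ) • f + s) + (f + h n) := by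
          push_cast
          rw [add_smul, one_smul]
          abel
        rw [this]
        exact V.add_mem hs (hfh n)
      · push_cast
        linarith
  choose s hsV hsM using key
  have hlim : Tendsto (fun K : ℕ => f + ((K : ℝ))⁻¹ • s K) atTop (𝓝 f) := by
    have h1 : Tendsto (fun K : ℕ => ((K : ℝ))⁻¹ • s K) atTop (𝓝 0) := by
      rw [tendsto_zero_iff_norm_tendsto_zero]
      have h2 : Tendsto (fun K : ℕ => M ^ (1 / r) * (K : ℝ) ^ (-(1 - 1 / r))) atTop (𝓝 0) := by
        have : Tendsto (fun K : ℕ => (K : ℝ) ^ (-(1 - 1 / r))) atTop (𝓝 0) :=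
          (tendsto_rpow_neg_atTop (by
            rw [sub_pos, div_lt_one (by linarith)]; exact hr)).comp tendsto_natCast_atTop_atTop
        simpa using this.const_mul (M ^ (1 / r))
      refine squeeze_zero' (Eventually.of_forall fun K => norm_nonneg _) ?_ h2
      filter_upwards [eventually_gt_atTop 0] with K hK
      have hK' : (0 : ℝ) < K := by exact_mod_cast hK
      rw [norm_smul, norm_inv, Real.norm_of_nonneg hK'.le]
      have h3 : ‖s K‖ ≤ (K * M) ^ (1 / r) := by
        rw [one_div, Real.le_rpow_inv_iff_of_pos (norm_nonneg _) (by positivity) (by linarith)]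
        exact hsM K
      calc (K : ℝ)⁻¹ * ‖s K‖ ≤ (K : ℝ)⁻¹ * (K * M) ^ (1 / r) := by gcongr
        _ = _ := by
          rw [Real.mul_rpow hK'.le hM, show -(1 - 1 / r) = 1 / r - 1 by ring,
            Real.rpow_sub_one hK'.ne']
          field_simp
    simpa using h1.const_add f
  refine hV.mem_of_tendsto hlim ?_
  filter_upwards [eventually_gt_atTop 0] with K hK
  have hK' : (K : ℝ) ≠ 0 := by exact_mod_cast hK.ne'
  have := V.smul_mem ((K : ℝ)⁻¹) (hsV K)
  rwa [smul_add, smul_smul, inv_mul_cancel₀ hK', one_smul] at this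

/-! ### Integral functionals of class `C^1` -/

/-- A functional with a continuous Gateaux derivative is Fréchet differentiable. -/
lemma hasFDerivAt_of_hasDerivAt_line {X : Type*} [NormedAddCommGroup X] [NormedSpace ℝ X]
    {Φ : X → ℝ} {Φ' : X → X →L[ℝ] ℝ} (hc : Continuous Φ')
    (hg : ∀ w h, HasDerivAt (fun t : ℝ => Φ (w + t • h)) (Φ' w h) 0) (w : X) :
    HasFDerivAt Φ (Φ' w) w := by
  rw [hasFDerivAt_iff_isLittleO_nhds_zero, Asymptotics.isLittleO_iff]
  intro ε hε
  obtain ⟨δ, hδ, hδ'⟩ := Metric.continuousAt_iff.1 hc.continuousAt ε hε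
  filter_upwards [Metric.ball_mem_nhds (0 : X) hδ] with h hh
  rw [mem_ball_zero_iff] at hh
  -- Mean value inequality on [0, 1] for the remainder along the segment, whose derivative Φ' (w + t
  -- • h) h - Φ' w h is at most ε‖h‖ by continuity of Φ'.
  have hd : ∀ t : ℝ, HasDerivAt (fun t : ℝ => Φ (w + t • h) - t * Φ' w h)
      (Φ' (w + t • h) h - Φ' w h) t := by
    intro t
    have h1 : HasDerivAt (fun s : ℝ => Φ (w + t • h + (s - t) • h)) (Φ' (w + t • h) h) t := by
      have := hg (w + t • h) h
      rw [← sub_self t] at this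
      exact this.comp_sub_const t t
    have h2 : (fun s : ℝ => Φ (w + t • h + (s - t) • h)) = fun s : ℝ => Φ (w + s • h) := by
      funext s
      rw [sub_smul]
      congr 1
      abel
    rw [h2] at h1
    have h3 := h1.sub ((hasDerivAt_id t).mul_const (Φ' w h))
    rw [one_mul] at h3
    exact h3
  have hb : ∀ t ∈ Set.Icc (0 : ℝ) 1, ‖Φ' (w + t • h) h - Φ' w h‖ ≤ ε * ‖h‖ := by
    intro t ht
    have h1 : dist (w + t • h) w < δ := by
      rw [dist_eq_norm, add_sub_cancel_left, norm_smul, Real.norm_of_nonneg ht.1]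
      exact (mul_le_of_le_one_left (norm_nonneg _) ht.2).trans_lt hh
    have h2 := (hδ' h1).le
    rw [dist_eq_norm] at h2
    calc _ = ‖(Φ' (w + t • h) - Φ' w) h‖ := by simp
      _ ≤ ‖Φ' (w + t • h) - Φ' w‖ * ‖h‖ := ContinuousLinearMap.le_opNorm _ _
      _ ≤ _ := by gcongr
  have := Convex.norm_image_sub_le_of_norm_hasDerivWithin_le
    (fun t _ => (hd t).hasDerivWithinAt) hb (convex_Icc (0 : ℝ) 1)
    (Set.left_mem_Icc.2 zero_le_one) (Set.right_mem_Icc.2 zero_le_one)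
  simp only [one_smul, one_mul, zero_smul, add_zero, zero_mul, sub_zero, norm_one, mul_one] at this
  rwa [sub_right_comm] at this

section Functionals

variable {α : Type*} [MeasurableSpace α] {μ : Measure α}
variable {E : Type*} [NormedAddCommGroup E]

lemma hasDerivAt_integral_line [NormedSpace ℝ E] {f : E → ℝ} {f' : E → E →L[ℝ] ℝ}
    (hf : ∀ z, HasFDerivAt f (f' z) z) {z h : α → E} (hz : AEStronglyMeasurable z μ)
    (hh : AEStronglyMeasurable h μ) (hint : Integrable (fun x => f (z x)) μ)
    (hm : AEStronglyMeasurable (fun x => f' (z x) (h x)) μ) {B : α → ℝ} (hB : Integrable B μ)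
    (hle : ∀ᵐ x ∂μ, ∀ t : ℝ, |t| ≤ 1 → |f' (z x + t • h x) (h x)| ≤ B x) :
    HasDerivAt (fun t : ℝ => ∫ x, f (z x + t • h x) ∂μ) (∫ x, f' (z x) (h x) ∂μ) 0 := by
  have hfc : Continuous f := continuous_iff_continuousAt.2 fun z => (hf z).continuousAt
  have := (hasDerivAt_integral_of_dominated_loc_of_deriv_le (μ := μ)
    (F := fun t x => f (z x + t • h x)) (F' := fun t x => f' (z x + t • h x) (h x)) (x₀ := (0 : ℝ))
    (bound := B) (Metric.ball_mem_nhds 0 one_pos)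
    (Eventually.of_forall fun t => hfc.comp_aestronglyMeasurable (hz.add (hh.const_smul t)))
    (by simpa using hint) (by simpa using hm) ?_ hB ?_).2
  · simpa using this
  · filter_upwards [hle] with x hx t ht
    exact hx t (by simpa using (mem_ball_zero_iff.1 ht).le)
  · refine Eventually.of_forall fun x t _ => ?_
    have h1 : HasDerivAt (fun t : ℝ => z x + t • h x) (h x) t := by
      simpa using ((hasDerivAt_id t).smul_const (h x)).const_add (z x)
    exact (hf _).comp_hasDerivAt t h1

lemma Lp_norm_rpow_eq {r : ℝ} (hr : 0 < r) (u : Lp E (ENNReal.ofReal r) μ) :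
    ‖u‖ ^ r = ∫ x, ‖u x‖ ^ r ∂μ := by
  rw [Lp.norm_def, eLpNorm_ofReal_eq hr (Lp.memLp u), ENNReal.toReal_ofReal (by positivity),
    ← Real.rpow_mul (integral_nonneg fun x => by positivity), inv_mul_cancel₀ hr.ne', Real.rpow_one]

lemma integral_norm_sub_rpow_eq {r : ℝ} (hr : 0 < r) (u v : Lp E (ENNReal.ofReal r) μ) :
    ∫ x, ‖u x - v x‖ ^ r ∂μ = ‖u - v‖ ^ r := by
  rw [Lp_norm_rpow_eq hr]
  refine integral_congr_ae ?_
  filter_upwards [Lp.coeFn_sub u v] with x hx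
  rw [hx, Pi.sub_apply]

variable {F G : Type*} [NormedAddCommGroup F] [NormedAddCommGroup G]

lemma memLp_comp₂ {φ : E → F → G} {r₁ r₂ s C : ℝ} (hr₁ : 0 < r₁) (hr₂ : 0 < r₂) (hs : 0 < s)
    (hφ : Continuous (Function.uncurry φ))
    (hφC : ∀ x y, ‖φ x y‖ ^ s ≤ C * (‖x‖ ^ r₁ + ‖y‖ ^ r₂))
    {u : α → E} {v : α → F} (hu : MemLp u (ENNReal.ofReal r₁) μ)
    (hv : MemLp v (ENNReal.ofReal r₂) μ) :
    MemLp (fun x => φ (u x) (v x)) (ENNReal.ofReal s) μ := by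
  have hm : AEStronglyMeasurable (fun x => φ (u x) (v x)) μ :=
    hφ.comp_aestronglyMeasurable (hu.1.prodMk hv.1)
  rw [memLp_ofReal_iff hs hm]
  refine Integrable.mono' (((integrable_norm_rpow_of_memLp hr₁ hu).add
    (integrable_norm_rpow_of_memLp hr₂ hv)).const_mul C)
    (hm.norm.aemeasurable.pow_const s).aestronglyMeasurable (Eventually.of_forall fun x => ?_)
  rw [Real.norm_of_nonneg (by positivity)]
  exact hφC _ _

/-- The Nemytskii operator `(u, v) ↦ φ(u, v)` is continuous between Lebesgue spaces under the
natural growth condition. -/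
lemma continuous_nemytskii {φ : E → F → G} {r₁ r₂ s C : ℝ} [Fact (1 ≤ ENNReal.ofReal r₁)]
    [Fact (1 ≤ ENNReal.ofReal r₂)] [Fact (1 ≤ ENNReal.ofReal s)]
    (hr₁ : 0 < r₁) (hr₂ : 0 < r₂) (hs : 0 < s)
    (hφ : Continuous (Function.uncurry φ)) (hC : 0 ≤ C)
    (hφC : ∀ x y, ‖φ x y‖ ^ s ≤ C * (‖x‖ ^ r₁ + ‖y‖ ^ r₂)) :
    Continuous fun w : Lp E (ENNReal.ofReal r₁) μ × Lp F (ENNReal.ofReal r₂) μ =>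
      ((memLp_comp₂ hr₁ hr₂ hs hφ hφC (Lp.memLp w.1) (Lp.memLp w.2)).toLp _ :
        Lp G (ENNReal.ofReal s) μ) := by
  rw [← continuousOn_univ]
  refine (continuousOn_univ.2 (continuous_iff_continuousAt.2 fun w => ?_))
  refine tendsto_of_seq_tendsto fun w' hw' => ?_
  -- It suffices that each subsequence has a convergent further subsequence, which allows both
  -- arguments to be taken almost everywhere convergent.
  refine tendsto_of_subseq_tendsto fun ns hns => ?_
  have hw1 : Tendsto (fun n => (w' (ns n)).1) atTop (𝓝 w.1) :=
    ((continuous_fst.tendsto w).comp hw').comp hns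
  have hw2 : Tendsto (fun n => (w' (ns n)).2) atTop (𝓝 w.2) :=
    ((continuous_snd.tendsto w).comp hw').comp hns
  obtain ⟨k, hk, hka⟩ := (tendstoInMeasure_of_tendsto_Lp hw1).exists_seq_tendsto_ae
  obtain ⟨l, hl, hla⟩ := (tendstoInMeasure_of_tendsto_Lp
    (hw2.comp hk.tendsto_atTop)).exists_seq_tendsto_ae
  refine ⟨k ∘ l, ?_⟩
  set u : ℕ → Lp E (ENNReal.ofReal r₁) μ := fun n => (w' (ns (k (l n)))).1 with hu
  set v : ℕ → Lp F (ENNReal.ofReal r₂) μ := fun n => (w' (ns (k (l n)))).2 with hv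
  have hut : Tendsto u atTop (𝓝 w.1) := (hw1.comp hk.tendsto_atTop).comp hl.tendsto_atTop
  have hvt : Tendsto v atTop (𝓝 w.2) := (hw2.comp hk.tendsto_atTop).comp hl.tendsto_atTop
  have hua : ∀ᵐ x ∂μ, Tendsto (fun n => u n x) atTop (𝓝 (w.1 x)) := by
    filter_upwards [hka] with x hx
    exact hx.comp hl.tendsto_atTop
  have hva : ∀ᵐ x ∂μ, Tendsto (fun n => v n x) atTop (𝓝 (w.2 x)) := hla
  set P : ℕ → Lp G (ENNReal.ofReal s) μ := fun n =>
    (memLp_comp₂ hr₁ hr₂ hs hφ hφC (Lp.memLp (u n)) (Lp.memLp (v n))).toLp _ with hP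
  set Q : Lp G (ENNReal.ofReal s) μ :=
    (memLp_comp₂ hr₁ hr₂ hs hφ hφC (Lp.memLp w.1) (Lp.memLp w.2)).toLp _ with hQ
  change Tendsto P atTop (𝓝 Q)
  have hPc : ∀ n, P n =ᵐ[μ] fun x => φ (u n x) (v n x) := fun n => MemLp.coeFn_toLp _
  have hQc : Q =ᵐ[μ] fun x => φ (w.1 x) (w.2 x) := MemLp.coeFn_toLp _
  have hmain : Tendsto (fun n => ∫ x, ‖P n x - Q x‖ ^ s ∂μ) atTop (𝓝 0) := by
    have hPm := fun n => (Lp.memLp (P n)).1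
    have hQm := (Lp.memLp Q).1
    have hu1 : ∀ n, Integrable (fun x => ‖u n x - w.1 x‖ ^ r₁) μ := fun n =>
      integrable_norm_rpow_of_memLp hr₁ ((Lp.memLp (u n)).sub (Lp.memLp w.1))
    have hv1 : ∀ n, Integrable (fun x => ‖v n x - w.2 x‖ ^ r₂) μ := fun n =>
      integrable_norm_rpow_of_memLp hr₂ ((Lp.memLp (v n)).sub (Lp.memLp w.2))
    have hu2 := integrable_norm_rpow_of_memLp hr₁ (Lp.memLp w.1)
    have hv2 := integrable_norm_rpow_of_memLp hr₂ (Lp.memLp w.2)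
    refine tendsto_integral_zero_of_le_add (fun n => Eventually.of_forall fun x => by positivity)
      (fun n => (((hPm n).sub hQm).norm.aemeasurable.pow_const s).aestronglyMeasurable) ?_
      fun ε hε => ?_
    · filter_upwards [hua, hva, ae_all_iff.2 hPc, hQc] with x h1 h2 h3 h4
      have := (((hφ.tendsto (w.1 x, w.2 x)).comp (h1.prodMk_nhds h2)).sub_const
        (φ (w.1 x) (w.2 x))).norm.rpow_const (p := s) (Or.inr hs.le)
      simpa [h3, h4, Real.zero_rpow hs.ne'] using this
    -- The growth bound is centred at the limit: the differences go into `G`, whose integrals tend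
    -- to 0, and the limit functions into the fixed majorant `H`.
    · refine ⟨fun n x => 2 ^ s * C * (2 ^ r₁ * ‖u n x - w.1 x‖ ^ r₁ + 2 ^ r₂ * ‖v n x - w.2 x‖ ^ r₂),
        fun x => 2 ^ s * C * ((2 ^ r₁ + 1) * ‖w.1 x‖ ^ r₁ + (2 ^ r₂ + 1) * ‖w.2 x‖ ^ r₂),
        ((hu2.const_mul _).add (hv2.const_mul _)).const_mul _,
        fun n => (((hu1 n).const_mul _).add ((hv1 n).const_mul _)).const_mul _, ?_, fun n => ?_⟩
      · have h1 : ∀ n, ∫ x, 2 ^ s * C * (2 ^ r₁ * ‖u n x - w.1 x‖ ^ r₁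
            + 2 ^ r₂ * ‖v n x - w.2 x‖ ^ r₂) ∂μ
            = 2 ^ s * C * (2 ^ r₁ * ‖u n - w.1‖ ^ r₁ + 2 ^ r₂ * ‖v n - w.2‖ ^ r₂) := by
          intro n
          rw [integral_const_mul, integral_add ((hu1 n).const_mul _) ((hv1 n).const_mul _),
            integral_const_mul, integral_const_mul]
          congr 3
          · rw [← integral_norm_sub_rpow_eq hr₁]
          · rw [← integral_norm_sub_rpow_eq hr₂]
        simp_rw [h1]
        have h2 : Tendsto (fun n => 2 ^ s * C * (2 ^ r₁ * ‖u n - w.1‖ ^ r₁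
            + 2 ^ r₂ * ‖v n - w.2‖ ^ r₂)) atTop (𝓝 0) := by
          have a1 := ((tendsto_iff_norm_sub_tendsto_zero.1 hut).rpow_const (p := r₁)
            (Or.inr hr₁.le)).const_mul (2 ^ r₁)
          have a2 := ((tendsto_iff_norm_sub_tendsto_zero.1 hvt).rpow_const (p := r₂)
            (Or.inr hr₂.le)).const_mul (2 ^ r₂)
          simpa [Real.zero_rpow hr₁.ne', Real.zero_rpow hr₂.ne'] using
            (a1.add a2).const_mul (2 ^ s * C)
        exact h2.eventually (ge_mem_nhds hε)
      · filter_upwards [hPc n, hQc] with x h3 h4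
        refine ⟨by positivity, ?_⟩
        rw [h3, h4]
        have b1 : ‖φ (u n x) (v n x) - φ (w.1 x) (w.2 x)‖ ^ s
            ≤ 2 ^ s * (‖φ (u n x) (v n x)‖ ^ s + ‖φ (w.1 x) (w.2 x)‖ ^ s) :=
          (Real.rpow_le_rpow (norm_nonneg _) (norm_sub_le _ _) hs.le).trans
            (add_rpow_le_two_rpow (norm_nonneg _) (norm_nonneg _) hs.le)
        have b2 : ‖u n x‖ ^ r₁ ≤ 2 ^ r₁ * (‖u n x - w.1 x‖ ^ r₁ + ‖w.1 x‖ ^ r₁) :=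
          (Real.rpow_le_rpow (norm_nonneg _) (by
            simpa using norm_add_le (u n x - w.1 x) (w.1 x)) hr₁.le).trans
            (add_rpow_le_two_rpow (norm_nonneg _) (norm_nonneg _) hr₁.le)
        have b3 : ‖v n x‖ ^ r₂ ≤ 2 ^ r₂ * (‖v n x - w.2 x‖ ^ r₂ + ‖w.2 x‖ ^ r₂) :=
          (Real.rpow_le_rpow (norm_nonneg _) (by
            simpa using norm_add_le (v n x - w.2 x) (w.2 x)) hr₂.le).trans
            (add_rpow_le_two_rpow (norm_nonneg _) (norm_nonneg _) hr₂.le)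
        calc _ ≤ 2 ^ s * (C * (‖u n x‖ ^ r₁ + ‖v n x‖ ^ r₂) + C * (‖w.1 x‖ ^ r₁ + ‖w.2 x‖ ^ r₂)) :=
              b1.trans (by gcongr <;> exact hφC _ _)
          _ ≤ 2 ^ s * (C * (2 ^ r₁ * (‖u n x - w.1 x‖ ^ r₁ + ‖w.1 x‖ ^ r₁)
              + 2 ^ r₂ * (‖v n x - w.2 x‖ ^ r₂ + ‖w.2 x‖ ^ r₂))
              + C * (‖w.1 x‖ ^ r₁ + ‖w.2 x‖ ^ r₂)) := by gcongr
          _ = _ := by ring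
  rw [tendsto_iff_norm_sub_tendsto_zero]
  have h5 := hmain.rpow_const (p := 1 / s) (Or.inr (by positivity))
  rw [Real.zero_rpow (by positivity)] at h5
  refine h5.congr fun n => ?_
  rw [integral_norm_sub_rpow_eq hs, ← Real.rpow_mul (norm_nonneg _), mul_one_div_cancel hs.ne',
    Real.rpow_one]

/-- `u ↦ ∫ ‖u‖^r` is of class `C^1` on `L^r`. -/
lemma exists_hasFDerivAt_integral_norm_rpow [InnerProductSpace ℝ E] {r : ℝ} (hr : 1 < r)
    [Fact (1 ≤ ENNReal.ofReal r)] :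
    ∃ Φ' : Lp E (ENNReal.ofReal r) μ → Lp E (ENNReal.ofReal r) μ →L[ℝ] ℝ, Continuous Φ' ∧
      (∀ u, HasFDerivAt (fun u : Lp E (ENNReal.ofReal r) μ => ∫ x, ‖u x‖ ^ r ∂μ) (Φ' u) u) ∧
      ∀ u h, Φ' u h = r * ∫ x, inner ℝ (powMap r (u x)) (h x) ∂μ := by
  have hr0 : 0 < r := by linarith
  have hconj := Real.HolderConjugate.conjExponent hr
  set r' := r.conjExponent with hr'
  have hr'0 : 0 < r' := hconj.symm.pos
  have : Fact (1 ≤ ENNReal.ofReal r') := ⟨by simpa using hconj.symm.lt.le⟩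
  have := hconj.symm.ennrealOfReal
  -- A dummy second variable brings the map into the two-variable form of `continuous_nemytskii`;
  -- its target exponent is the conjugate r', for which ‖powMap r x‖ ^ r' = ‖x‖ ^ r.
  have hφ : Continuous (Function.uncurry fun x _ : E => powMap r x) :=
    (continuous_powMap hr).comp continuous_fst
  have hφC : ∀ x y : E, ‖powMap r x‖ ^ r' ≤ 1 * (‖x‖ ^ r + ‖y‖ ^ r) := by
    intro x y
    rw [norm_powMap hr, ← Real.rpow_mul (norm_nonneg x), one_mul, hconj.sub_one_mul_conj]
    linarith [Real.rpow_nonneg (norm_nonneg y) r]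
  set Φ' : Lp E (ENNReal.ofReal r) μ → Lp E (ENNReal.ofReal r) μ →L[ℝ] ℝ := fun u =>
    r • (innerSL ℝ (E := E)).lpPairing μ (ENNReal.ofReal r') (ENNReal.ofReal r)
      ((memLp_comp₂ hr0 hr0 hr'0 hφ hφC (Lp.memLp u) (Lp.memLp u)).toLp _) with hΦ'
  have hc : Continuous Φ' :=
    (((innerSL ℝ (E := E)).lpPairing μ (ENNReal.ofReal r') (ENNReal.ofReal r)).continuous.comp
      ((continuous_nemytskii hr0 hr0 hr'0 hφ zero_le_one hφC).comp
        (continuous_id.prodMk continuous_id))).const_smul r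
  have hval : ∀ u h, Φ' u h = r * ∫ x, inner ℝ (powMap r (u x)) (h x) ∂μ := by
    intro u h
    simp only [hΦ', smul_apply, smul_eq_mul]
    rw [ContinuousLinearMap.lpPairing_eq_integral]
    congr 1
    refine integral_congr_ae ?_
    filter_upwards [MemLp.coeFn_toLp
      (memLp_comp₂ hr0 hr0 hr'0 hφ hφC (Lp.memLp u) (Lp.memLp u))] with x hx
    rw [hx, innerSL_apply_apply]
  refine ⟨Φ', hc, fun u => hasFDerivAt_of_hasDerivAt_line hc (fun w h => ?_) u, hval⟩
  have hw := Lp.memLp w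
  have hh := Lp.memLp h
  have hwi := integrable_norm_rpow_of_memLp hr0 hw
  have hhi := integrable_norm_rpow_of_memLp hr0 hh
  have hfd : ∀ z : E, HasFDerivAt (fun z : E => ‖z‖ ^ r) (r • innerSL ℝ (powMap r z)) z := by
    intro z
    convert hasFDerivAt_norm_rpow z hr using 1
    rw [powMap, map_smul, smul_smul]
  have hm : AEStronglyMeasurable (fun x => (r • innerSL ℝ (powMap r (w x))) (h x)) μ := by
    simp only [smul_apply, innerSL_apply_apply]
    exact (((continuous_powMap hr).comp_aestronglyMeasurable hw.1).inner hh.1).const_smul r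
  have := hasDerivAt_integral_line hfd hw.1 hh.1 hwi hm
    (B := fun x => r * (2 ^ r * (‖w x‖ ^ r + ‖h x‖ ^ r))) (((hwi.add hhi).const_mul _).const_mul _)
    (Eventually.of_forall fun x t ht => ?_)
  · rw [hval]
    convert! this using 1
    · funext t
      refine integral_congr_ae ?_
      filter_upwards [Lp.coeFn_add w (t • h), Lp.coeFn_smul t h] with x h1 h2
      rw [h1, Pi.add_apply, h2, Pi.smul_apply]
    · simp only [smul_apply, innerSL_apply_apply, smul_eq_mul]
      rw [integral_const_mul]
  · simp only [smul_apply, innerSL_apply_apply, smul_eq_mul, abs_mul,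
      abs_of_pos hr0]
    have h1 : ‖w x + t • h x‖ ≤ ‖w x‖ + ‖h x‖ := by
      refine (norm_add_le _ _).trans ?_
      rw [norm_smul, Real.norm_eq_abs]
      gcongr
      exact mul_le_of_le_one_left (norm_nonneg _) ht
    gcongr
    calc _ ≤ ‖powMap r (w x + t • h x)‖ * ‖h x‖ := abs_real_inner_le_norm _ _
      _ ≤ (‖w x‖ + ‖h x‖) ^ (r - 1) * (‖w x‖ + ‖h x‖) := by
          rw [norm_powMap hr]
          gcongr
          linarith [norm_nonneg (w x)]
      _ = (‖w x‖ + ‖h x‖) ^ r := rpow_sub_one_mul (by positivity) hr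
      _ ≤ _ := add_rpow_le_two_rpow (norm_nonneg _) (norm_nonneg _) hr0.le

lemma rpow_mul_rpow_le_add {x y a b s t : ℝ} (hx : 0 ≤ x) (hy : 0 ≤ y) (ha : 0 ≤ a) (hb : 0 ≤ b)
    (hs : 0 < s) (ht : 0 < t) : x ^ a * y ^ b ≤ (x ^ s + y ^ t) ^ (a / s + b / t) := by
  have hxs : 0 ≤ x ^ s := by positivity
  have hyt : 0 ≤ y ^ t := by positivity
  rw [Real.rpow_add_of_nonneg (by positivity) (by positivity) (by positivity)]
  gcongr
  · calc x ^ a = (x ^ s) ^ (a / s) := by rw [← Real.rpow_mul hx, mul_div_cancel₀ _ hs.ne']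
      _ ≤ _ := Real.rpow_le_rpow hxs (by linarith) (by positivity)
  · calc y ^ b = (y ^ t) ^ (b / t) := by rw [← Real.rpow_mul hy, mul_div_cancel₀ _ ht.ne']
      _ ≤ _ := Real.rpow_le_rpow hyt (by linarith) (by positivity)

/-- `(u, v) ↦ ∫ |u|^a |v|^b` is of class `C^1` on `L^s × L^t` if `a / s + b / t = 1`. -/
lemma exists_hasFDerivAt_integral_rpow_mul_rpow {a b s t : ℝ} (ha : 1 < a) (hb : 1 < b)
    (hs : 1 < s) (ht : 1 < t) (hst : a / s + b / t = 1)
    [Fact (1 ≤ ENNReal.ofReal s)] [Fact (1 ≤ ENNReal.ofReal t)] :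
    ∃ Ψ' : Lp ℝ (ENNReal.ofReal s) μ × Lp ℝ (ENNReal.ofReal t) μ →
        Lp ℝ (ENNReal.ofReal s) μ × Lp ℝ (ENNReal.ofReal t) μ →L[ℝ] ℝ, Continuous Ψ' ∧
      (∀ w, HasFDerivAt (fun w : Lp ℝ (ENNReal.ofReal s) μ × Lp ℝ (ENNReal.ofReal t) μ =>
        ∫ x, |w.1 x| ^ a * |w.2 x| ^ b ∂μ) (Ψ' w) w) ∧
      ∀ w h, Ψ' w h = a * (∫ x, powMap a (w.1 x) * |w.2 x| ^ b * h.1 x ∂μ)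
        + b * ∫ x, |w.1 x| ^ a * powMap b (w.2 x) * h.2 x ∂μ := by
  have hs0 : 0 < s := by linarith
  have ht0 : 0 < t := by linarith
  have hcs := Real.HolderConjugate.conjExponent hs
  have hct := Real.HolderConjugate.conjExponent ht
  set s' := s.conjExponent with hs'
  set t' := t.conjExponent with ht'
  have hs'0 : 0 < s' := hcs.symm.pos
  have ht'0 : 0 < t' := hct.symm.pos
  have : Fact (1 ≤ ENNReal.ofReal s') := ⟨by simpa using hcs.symm.lt.le⟩
  have : Fact (1 ≤ ENNReal.ofReal t') := ⟨by simpa using hct.symm.lt.le⟩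
  have := hcs.symm.ennrealOfReal
  have := hct.symm.ennrealOfReal
  have hpa : Continuous fun x : ℝ => |x| ^ a := continuous_abs.rpow_const fun _ => Or.inr (by linarith)
  have hpb : Continuous fun x : ℝ => |x| ^ b := continuous_abs.rpow_const fun _ => Or.inr (by linarith)
  have hφ₁ : Continuous (Function.uncurry fun x y : ℝ => powMap a x * |y| ^ b) :=
    ((continuous_powMap ha).comp continuous_fst).mul (hpb.comp continuous_snd)
  have hφ₂ : Continuous (Function.uncurry fun x y : ℝ => |x| ^ a * powMap b y) :=
    (hpa.comp continuous_fst).mul ((continuous_powMap hb).comp continuous_snd)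
  have hn : ∀ x y : ℝ, ‖powMap a x * |y| ^ b‖ = ‖x‖ ^ (a - 1) * ‖y‖ ^ b := fun x y => by
    rw [norm_mul, norm_powMap ha, Real.norm_of_nonneg (by positivity : 0 ≤ |y| ^ b),
      Real.norm_eq_abs y]
  have hn' : ∀ x y : ℝ, ‖|x| ^ a * powMap b y‖ = ‖x‖ ^ a * ‖y‖ ^ (b - 1) := fun x y => by
    rw [norm_mul, norm_powMap hb, Real.norm_of_nonneg (by positivity : 0 ≤ |x| ^ a),
      Real.norm_eq_abs x]
  have hφ₁C : ∀ x y : ℝ, ‖powMap a x * |y| ^ b‖ ^ s' ≤ 1 * (‖x‖ ^ s + ‖y‖ ^ t) := by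
    intro x y
    rw [hn, one_mul]
    have h1 := rpow_mul_rpow_le_add (norm_nonneg x) (norm_nonneg y) (a := a - 1) (b := b)
      (by linarith) (by linarith) hs0 ht0
    -- Removing one factor of u from a term of homogeneity a/s + b/t = 1 leaves 1 - 1/s, so this
    -- partial derivative lands in the dual exponent s'.
    have h2 : (a - 1) / s + b / t = s'⁻¹ := by
      have := hcs.inv_add_inv_eq_one
      rw [sub_div, one_div]; linarith
    rw [h2, Real.le_rpow_inv_iff_of_pos (by positivity) (by positivity) hs'0] at h1
    exact h1
  have hφ₂C : ∀ x y : ℝ, ‖|x| ^ a * powMap b y‖ ^ t' ≤ 1 * (‖x‖ ^ s + ‖y‖ ^ t) := by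
    intro x y
    rw [hn', one_mul]
    have h1 := rpow_mul_rpow_le_add (norm_nonneg x) (norm_nonneg y) (a := a) (b := b - 1)
      (by linarith) (by linarith) hs0 ht0
    have h2 : a / s + (b - 1) / t = t'⁻¹ := by
      have := hct.inv_add_inv_eq_one
      rw [sub_div, one_div]; linarith
    rw [h2, Real.le_rpow_inv_iff_of_pos (by positivity) (by positivity) ht'0] at h1
    exact h1
  set Ψ' : Lp ℝ (ENNReal.ofReal s) μ × Lp ℝ (ENNReal.ofReal t) μ →
      Lp ℝ (ENNReal.ofReal s) μ × Lp ℝ (ENNReal.ofReal t) μ →L[ℝ] ℝ := fun w =>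
    a • ((ContinuousLinearMap.mul ℝ ℝ).lpPairing μ (ENNReal.ofReal s') (ENNReal.ofReal s)
      ((memLp_comp₂ hs0 ht0 hs'0 hφ₁ hφ₁C (Lp.memLp w.1) (Lp.memLp w.2)).toLp _)).comp
        (ContinuousLinearMap.fst ℝ _ _)
    + b • ((ContinuousLinearMap.mul ℝ ℝ).lpPairing μ (ENNReal.ofReal t') (ENNReal.ofReal t)
      ((memLp_comp₂ hs0 ht0 ht'0 hφ₂ hφ₂C (Lp.memLp w.1) (Lp.memLp w.2)).toLp _)).comp
        (ContinuousLinearMap.snd ℝ _ _) with hΨ'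
  have hc : Continuous Ψ' := by
    refine Continuous.add ?_ ?_
    · exact ((((ContinuousLinearMap.mul ℝ ℝ).lpPairing μ _ _).continuous.comp
        (continuous_nemytskii hs0 ht0 hs'0 hφ₁ zero_le_one hφ₁C)).clm_comp
          continuous_const).const_smul a
    · exact ((((ContinuousLinearMap.mul ℝ ℝ).lpPairing μ _ _).continuous.comp
        (continuous_nemytskii hs0 ht0 ht'0 hφ₂ zero_le_one hφ₂C)).clm_comp
          continuous_const).const_smul b
  have hval : ∀ w h, Ψ' w h = a * (∫ x, powMap a (w.1 x) * |w.2 x| ^ b * h.1 x ∂μ)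
        + b * ∫ x, |w.1 x| ^ a * powMap b (w.2 x) * h.2 x ∂μ := by
    intro w h
    simp only [hΨ', add_apply, smul_apply, smul_eq_mul,
      ContinuousLinearMap.comp_apply, ContinuousLinearMap.coe_fst', ContinuousLinearMap.coe_snd']
    rw [ContinuousLinearMap.lpPairing_eq_integral, ContinuousLinearMap.lpPairing_eq_integral]
    congr 2
    · refine integral_congr_ae ?_
      filter_upwards [MemLp.coeFn_toLp
        (memLp_comp₂ hs0 ht0 hs'0 hφ₁ hφ₁C (Lp.memLp w.1) (Lp.memLp w.2))] with x hx
      rw [hx, ContinuousLinearMap.mul_apply']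
    · refine integral_congr_ae ?_
      filter_upwards [MemLp.coeFn_toLp
        (memLp_comp₂ hs0 ht0 ht'0 hφ₂ hφ₂C (Lp.memLp w.1) (Lp.memLp w.2))] with x hx
      rw [hx, ContinuousLinearMap.mul_apply']
  refine ⟨Ψ', hc, fun w => hasFDerivAt_of_hasDerivAt_line hc (fun w h => ?_) w, hval⟩
  have hw1 := Lp.memLp w.1
  have hw2 := Lp.memLp w.2
  have hh1 := Lp.memLp h.1
  have hh2 := Lp.memLp h.2
  have hw1i := integrable_norm_rpow_of_memLp hs0 hw1
  have hw2i := integrable_norm_rpow_of_memLp ht0 hw2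
  have hh1i := integrable_norm_rpow_of_memLp hs0 hh1
  have hh2i := integrable_norm_rpow_of_memLp ht0 hh2
  have hfd : ∀ z : ℝ × ℝ, HasFDerivAt (fun z : ℝ × ℝ => |z.1| ^ a * |z.2| ^ b)
      ((a * (powMap a z.1 * |z.2| ^ b)) • ContinuousLinearMap.fst ℝ ℝ ℝ
        + (b * (|z.1| ^ a * powMap b z.2)) • ContinuousLinearMap.snd ℝ ℝ ℝ) z := by
    intro z
    have h1 : HasFDerivAt (fun z : ℝ × ℝ => |z.1| ^ a) ((a * powMap a z.1) •
        ContinuousLinearMap.fst ℝ ℝ ℝ) z := by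
      have := (hasDerivAt_abs_rpow z.1 ha).comp_hasFDerivAt z
        (ContinuousLinearMap.fst ℝ ℝ ℝ).hasFDerivAt
      refine this.congr_fderiv ?_
      simp [powMap, mul_assoc]
    have h2 : HasFDerivAt (fun z : ℝ × ℝ => |z.2| ^ b) ((b * powMap b z.2) •
        ContinuousLinearMap.snd ℝ ℝ ℝ) z := by
      have := (hasDerivAt_abs_rpow z.2 hb).comp_hasFDerivAt z
        (ContinuousLinearMap.snd ℝ ℝ ℝ).hasFDerivAt
      refine this.congr_fderiv ?_
      simp [powMap, mul_assoc]
    refine (h1.mul h2).congr_fderiv ?_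
    rw [smul_smul, smul_smul, add_comm]
    congr 2 <;> ring
  have hyoung : ∀ x y : ℝ, 0 ≤ x → 0 ≤ y → x ^ a * y ^ b ≤ x ^ s + y ^ t := by
    intro x y hx hy
    have := rpow_mul_rpow_le_add hx hy (a := a) (b := b) (by linarith) (by linarith) hs0 ht0
    rwa [hst, Real.rpow_one] at this
  have hint : Integrable (fun x => |w.1 x| ^ a * |w.2 x| ^ b) μ := by
    refine Integrable.mono' (hw1i.add hw2i)
      ((hpa.comp_aestronglyMeasurable hw1.1).mul (hpb.comp_aestronglyMeasurable hw2.1))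
      (Eventually.of_forall fun x => ?_)
    rw [Real.norm_of_nonneg (by positivity)]
    exact hyoung _ _ (abs_nonneg _) (abs_nonneg _)
  have hm1 : AEStronglyMeasurable (fun x => powMap a (w.1 x) * |w.2 x| ^ b * h.1 x) μ :=
    (((continuous_powMap ha).comp_aestronglyMeasurable hw1.1).mul
      (hpb.comp_aestronglyMeasurable hw2.1)).mul hh1.1
  have hm2 : AEStronglyMeasurable (fun x => |w.1 x| ^ a * powMap b (w.2 x) * h.2 x) μ :=
    ((hpa.comp_aestronglyMeasurable hw1.1).mul
      ((continuous_powMap hb).comp_aestronglyMeasurable hw2.1)).mul hh2.1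
  have hle : ∀ x (τ : ℝ), |τ| ≤ 1 →
      ‖powMap a (w.1 x + τ * h.1 x) * |w.2 x + τ * h.2 x| ^ b * h.1 x‖
        ≤ 2 ^ s * (‖w.1 x‖ ^ s + ‖h.1 x‖ ^ s) + 2 ^ t * (‖w.2 x‖ ^ t + ‖h.2 x‖ ^ t) ∧
      ‖|w.1 x + τ * h.1 x| ^ a * powMap b (w.2 x + τ * h.2 x) * h.2 x‖
        ≤ 2 ^ s * (‖w.1 x‖ ^ s + ‖h.1 x‖ ^ s) + 2 ^ t * (‖w.2 x‖ ^ t + ‖h.2 x‖ ^ t) := by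
    intro x τ hτ
    have hadd : ∀ y z : ℝ, ‖y + τ * z‖ ≤ ‖y‖ + ‖z‖ := fun y z => by
      refine (norm_add_le _ _).trans ?_
      rw [norm_mul, Real.norm_eq_abs τ]
      gcongr
      exact mul_le_of_le_one_left (norm_nonneg _) hτ
    have e1 := hadd (w.1 x) (h.1 x)
    have e2 := hadd (w.2 x) (h.2 x)
    have e3 := hyoung (‖w.1 x‖ + ‖h.1 x‖) (‖w.2 x‖ + ‖h.2 x‖) (by positivity) (by positivity)
    have e4 := add_rpow_le_two_rpow (norm_nonneg (w.1 x)) (norm_nonneg (h.1 x)) hs0.le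
    have e5 := add_rpow_le_two_rpow (norm_nonneg (w.2 x)) (norm_nonneg (h.2 x)) ht0.le
    constructor
    · rw [norm_mul, hn]
      calc _ ≤ (‖w.1 x‖ + ‖h.1 x‖) ^ (a - 1) * (‖w.2 x‖ + ‖h.2 x‖) ^ b * (‖w.1 x‖ + ‖h.1 x‖) := by
            gcongr
            linarith [norm_nonneg (w.1 x)]
        _ = (‖w.1 x‖ + ‖h.1 x‖) ^ a * (‖w.2 x‖ + ‖h.2 x‖) ^ b := by
            rw [mul_right_comm, rpow_sub_one_mul (by positivity) ha]
        _ ≤ _ := by linarith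
    · rw [norm_mul, hn']
      calc _ ≤ (‖w.1 x‖ + ‖h.1 x‖) ^ a * (‖w.2 x‖ + ‖h.2 x‖) ^ (b - 1) * (‖w.2 x‖ + ‖h.2 x‖) := by
            gcongr
            linarith [norm_nonneg (w.2 x)]
        _ = (‖w.1 x‖ + ‖h.1 x‖) ^ a * (‖w.2 x‖ + ‖h.2 x‖) ^ b := by
            rw [mul_assoc, rpow_sub_one_mul (by positivity) hb]
        _ ≤ _ := by linarith
  have hBi : Integrable (fun x => 2 ^ s * (‖w.1 x‖ ^ s + ‖h.1 x‖ ^ s)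
      + 2 ^ t * (‖w.2 x‖ ^ t + ‖h.2 x‖ ^ t)) μ :=
    ((hw1i.add hh1i).const_mul _).add ((hw2i.add hh2i).const_mul _)
  have hi1 := Integrable.mono' hBi hm1 (Eventually.of_forall fun x => by
    simpa using (hle x 0 (by simp)).1)
  have hi2 := Integrable.mono' hBi hm2 (Eventually.of_forall fun x => by
    simpa using (hle x 0 (by simp)).2)
  have := hasDerivAt_integral_line (μ := μ) hfd (z := fun x => (w.1 x, w.2 x))
    (h := fun x => (h.1 x, h.2 x)) (hw1.1.prodMk hw2.1) (hh1.1.prodMk hh2.1) hint ?_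
    (hBi.const_mul (a + b)) (Eventually.of_forall fun x τ hτ => ?_)
  · rw [hval]
    convert! this using 1
    · funext τ
      refine integral_congr_ae ?_
      filter_upwards [Lp.coeFn_add w.1 (τ • h.1), Lp.coeFn_smul τ h.1,
        Lp.coeFn_add w.2 (τ • h.2), Lp.coeFn_smul τ h.2] with x h1 h2 h3 h4
      simp only [Prod.fst_add, Prod.smul_fst, Prod.snd_add, Prod.smul_snd, h1, h3, Pi.add_apply, h2,
        h4, Pi.smul_apply]
    · rw [← integral_const_mul, ← integral_const_mul, ← integral_add (hi1.const_mul a)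
        (hi2.const_mul b)]
      refine integral_congr_ae (Eventually.of_forall fun x => ?_)
      simp only [add_apply, smul_apply, smul_eq_mul,
        ContinuousLinearMap.coe_fst', ContinuousLinearMap.coe_snd']
      ring
  · refine ((hm1.const_smul a).add (hm2.const_smul b)).congr (Eventually.of_forall fun x => ?_)
    simp only [add_apply, smul_apply, smul_eq_mul,
        ContinuousLinearMap.coe_fst', ContinuousLinearMap.coe_snd', Pi.add_apply, Pi.smul_apply]
    ring
  · simp only [add_apply, smul_apply, smul_eq_mul,
      ContinuousLinearMap.coe_fst', ContinuousLinearMap.coe_snd', Prod.fst_add, Prod.smul_fst,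
      Prod.snd_add, Prod.smul_snd]
    obtain ⟨e1, e2⟩ := hle x τ hτ
    rw [mul_assoc a, mul_assoc b, add_mul]
    refine (abs_add_le _ _).trans (add_le_add ?_ ?_)
    · rw [abs_mul, abs_of_pos (by linarith : 0 < a)]
      exact mul_le_mul_of_nonneg_left e1 (by linarith)
    · rw [abs_mul, abs_of_pos (by linarith : 0 < b)]
      exact mul_le_mul_of_nonneg_left e2 (by linarith)

end Functionals

/-! ### The Sobolev space `W^{1,p}_0` -/

section Sobolev

variable {N : ℕ} {Ω : Set (RN N)} {p : ℝ}

lemma norm_gradient (φ : RN N → ℝ) (x : RN N) : ‖gradient φ x‖ = ‖fderiv ℝ φ x‖ := by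
  rw [gradient, LinearIsometryEquiv.norm_map]

lemma continuous_gradient {φ : RN N → ℝ} (h : ContDiff ℝ ∞ φ) : Continuous (gradient φ) :=
  (InnerProductSpace.toDual ℝ (RN N)).symm.continuous.comp (h.continuous_fderiv (by simp))

lemma support_gradient_subset (φ : RN N → ℝ) : Function.support (gradient φ) ⊆ tsupport φ := by
  intro x hx
  refine support_fderiv_subset ℝ ?_
  rw [Function.mem_support, ← norm_ne_zero_iff, norm_gradient] at hx
  exact norm_ne_zero_iff.1 hx

namespace IsTestFunction

lemma contDiff_one {φ : RN N → ℝ} (h : IsTestFunction Ω φ) : ContDiff ℝ 1 φ :=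
  h.smooth.of_le (by exact_mod_cast le_top)

lemma hasCompactSupport_gradient {φ : RN N → ℝ} (h : IsTestFunction Ω φ) :
    HasCompactSupport (gradient φ) :=
  h.compact.mono' (support_gradient_subset φ)

lemma memLp {φ : RN N → ℝ} (h : IsTestFunction Ω φ) (r : ℝ≥0∞) (μ : Measure (RN N))
    [IsFiniteMeasureOnCompacts μ] : MemLp φ r μ :=
  h.smooth.continuous.memLp_of_hasCompactSupport h.compact

lemma memLp_gradient {φ : RN N → ℝ} (h : IsTestFunction Ω φ) (r : ℝ≥0∞) (μ : Measure (RN N))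
    [IsFiniteMeasureOnCompacts μ] : MemLp (gradient φ) r μ :=
  (continuous_gradient h.smooth).memLp_of_hasCompactSupport h.hasCompactSupport_gradient

lemma eLpNorm_restrict {φ : RN N → ℝ} (h : IsTestFunction Ω φ) (r : ℝ≥0∞) :
    eLpNorm φ r (volume.restrict Ω) = eLpNorm φ r volume :=
  eLpNorm_restrict_eq_of_support_subset ((subset_tsupport φ).trans h.support)

lemma eLpNorm_gradient_restrict {φ : RN N → ℝ} (h : IsTestFunction Ω φ) (r : ℝ≥0∞) :
    eLpNorm (gradient φ) r (volume.restrict Ω) = eLpNorm (fderiv ℝ φ) r volume := by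
  rw [eLpNorm_restrict_eq_of_support_subset ((support_gradient_subset φ).trans h.support)]
  exact eLpNorm_congr_norm_ae (Eventually.of_forall fun x => norm_gradient φ x)

lemma univ {φ : RN N → ℝ} (h : IsTestFunction Ω φ) : IsTestFunction Set.univ φ :=
  ⟨h.smooth, h.compact, Set.subset_univ _⟩

end IsTestFunction

variable [hp : Fact (1 < p)]

namespace W0

lemma memLp_fn (u : W0 Ω p) : MemLp u.fn (ENNReal.ofReal p) (volume.restrict Ω) := Lp.memLp _

lemma memLp_grad (u : W0 Ω p) : MemLp u.grad (ENNReal.ofReal p) (volume.restrict Ω) := Lp.memLp _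

lemma fn_add (u v : W0 Ω p) : (u + v).fn =ᵐ[volume.restrict Ω] u.fn + v.fn := Lp.coeFn_add _ _

lemma fn_sub (u v : W0 Ω p) : (u - v).fn =ᵐ[volume.restrict Ω] u.fn - v.fn := Lp.coeFn_sub _ _

lemma grad_sub (u v : W0 Ω p) : (u - v).grad =ᵐ[volume.restrict Ω] u.grad - v.grad :=
  Lp.coeFn_sub _ _

lemma fn_smul (c : ℝ) (u : W0 Ω p) : (c • u).fn =ᵐ[volume.restrict Ω] c • u.fn :=
  Lp.coeFn_smul _ _

lemma grad_smul (c : ℝ) (u : W0 Ω p) : (c • u).grad =ᵐ[volume.restrict Ω] c • u.grad :=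
  Lp.coeFn_smul _ _

lemma fn_zero : (0 : W0 Ω p).fn =ᵐ[volume.restrict Ω] 0 := Lp.coeFn_zero _ _ _

lemma grad_zero : (0 : W0 Ω p).grad =ᵐ[volume.restrict Ω] 0 := Lp.coeFn_zero _ _ _

end W0

lemma pairSpace_norm_rpow (w : PairSpace Ω p) : ‖w‖ ^ p =
    (∫ x in Ω, ‖w.fst x‖ ^ p) + ∫ x in Ω, ‖w.snd x‖ ^ p := by
  have hp0 : 0 < p := by linarith [hp.out]
  rw [WithLp.prod_norm_eq_add (by rw [ENNReal.toReal_ofReal hp0.le]; exact hp0),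
    ENNReal.toReal_ofReal hp0.le, ← Real.rpow_mul (by positivity), one_div_mul_cancel hp0.ne',
    Real.rpow_one, Lp_norm_rpow_eq hp0, Lp_norm_rpow_eq hp0]

lemma W0.norm_rpow (u : W0 Ω p) : ‖u‖ ^ p =
    (∫ x in Ω, ‖u.fn x‖ ^ p) + ∫ x in Ω, ‖u.grad x‖ ^ p := pairSpace_norm_rpow u.1

/-- The gradient as a bounded operator. -/
def W0.gradL (Ω : Set (RN N)) (p : ℝ) [Fact (1 < p)] :
    W0 Ω p →L[ℝ] Lp (RN N) (ENNReal.ofReal p) (volume.restrict Ω) :=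
  (WithLp.sndL _ ℝ _ _).comp (testPairs Ω p).topologicalClosure.subtypeL

lemma W0.exists_seq (u : W0 Ω p) : ∃ (U : ℕ → W0 Ω p) (φ : ℕ → RN N → ℝ),
    Tendsto U atTop (𝓝 u) ∧ ∀ n, IsTestFunction Ω (φ n) ∧ (U n).fn =ᵐ[volume.restrict Ω] φ n ∧
      (U n).grad =ᵐ[volume.restrict Ω] gradient (φ n) := by
  have hu : (u : PairSpace Ω p) ∈ closure (testPairs Ω p : Set (PairSpace Ω p)) := by
    rw [← Submodule.topologicalClosure_coe]; exact u.2
  obtain ⟨x, hx, hlim⟩ := mem_closure_iff_seq_limit.1 hu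
  have hx' := hx
  choose φ hφ using hx'
  exact ⟨fun n => ⟨x n, (testPairs Ω p).le_topologicalClosure (hx n)⟩, φ,
    tendsto_subtype_rng.2 hlim, hφ⟩

lemma W0.tendsto_eLpNorm_grad {U : ℕ → W0 Ω p} {u : W0 Ω p} (h : Tendsto U atTop (𝓝 u)) :
    Tendsto (fun n => eLpNorm (U n).grad (ENNReal.ofReal p) (volume.restrict Ω)) atTop
      (𝓝 (eLpNorm u.grad (ENNReal.ofReal p) (volume.restrict Ω))) := by
  have h1 : Tendsto (fun n => ‖W0.gradL Ω p (U n)‖ₑ) atTop (𝓝 ‖W0.gradL Ω p u‖ₑ) :=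
    (continuous_enorm.tendsto _).comp (((W0.gradL Ω p).continuous.tendsto u).comp h)
  have e : ∀ v : W0 Ω p, ‖W0.gradL Ω p v‖ₑ =
      eLpNorm v.grad (ENNReal.ofReal p) (volume.restrict Ω) := fun v => Lp.enorm_def _
  simpa only [e] using h1

lemma W0.exists_subseq_ae {U : ℕ → W0 Ω p} {u : W0 Ω p} (h : Tendsto U atTop (𝓝 u)) :
    ∃ k : ℕ → ℕ, StrictMono k ∧
      ∀ᵐ x ∂volume.restrict Ω, Tendsto (fun n => (U (k n)).fn x) atTop (𝓝 (u.fn x)) := by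
  have h1 : Tendsto (fun n => (U n).1.fst) atTop (𝓝 u.1.fst) :=
    ((WithLp.fstL (ENNReal.ofReal p) ℝ (Lp ℝ (ENNReal.ofReal p) (volume.restrict Ω))
      (Lp (RN N) (ENNReal.ofReal p) (volume.restrict Ω))).continuous.tendsto u.1).comp
      ((continuous_subtype_val.tendsto u).comp h)
  exact (tendstoInMeasure_of_tendsto_Lp h1).exists_seq_tendsto_ae

/-- **Sobolev's inequality** on `W^{1,p}_0(Ω)`. -/
lemma W0.exists_eLpNorm_fn_le (hΩb : Bornology.IsBounded Ω) (hpN : p < N) {r : ℝ}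
    (hr : 0 < r) (hpr : p⁻¹ - (N : ℝ)⁻¹ ≤ r⁻¹) :
    ∃ C : NNReal, ∀ u : W0 Ω p, eLpNorm u.fn (ENNReal.ofReal r) (volume.restrict Ω)
      ≤ C * eLpNorm u.grad (ENNReal.ofReal p) (volume.restrict Ω) := by
  have hp1 : 1 < p := hp.out
  refine ⟨eLpNormLESNormFDerivOfLeConst ℝ (volume : Measure (RN N)) Ω p.toNNReal r.toNNReal,
    fun u => ?_⟩
  set C := eLpNormLESNormFDerivOfLeConst ℝ (volume : Measure (RN N)) Ω p.toNNReal r.toNNReal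
  have htest : ∀ φ : RN N → ℝ, IsTestFunction Ω φ →
      eLpNorm φ (ENNReal.ofReal r) (volume.restrict Ω)
        ≤ C * eLpNorm (gradient φ) (ENNReal.ofReal p) (volume.restrict Ω) := by
    intro φ hφ
    rw [hφ.eLpNorm_restrict, hφ.eLpNorm_gradient_restrict]
    refine eLpNorm_le_eLpNorm_fderiv_of_le volume hφ.contDiff_one
      ((subset_tsupport φ).trans hφ.support) ?_ ?_ ?_ hΩb
    · rw [Real.one_le_toNNReal]; exact hp1.le
    · rw [finrank_euclideanSpace_fin, Real.toNNReal_lt_natCast']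
      refine ⟨hpN, ?_⟩
      rintro rfl
      norm_num at hpN
      linarith
    · rw [finrank_euclideanSpace_fin, NNReal.coe_inv, Real.coe_toNNReal _ hr.le,
        Real.coe_toNNReal _ (by linarith)]
      exact hpr
  obtain ⟨U, φ, hU, hφ⟩ := u.exists_seq
  obtain ⟨k, hk, hka⟩ := W0.exists_subseq_ae hU
  have hlim := ENNReal.Tendsto.const_mul (a := (C : ℝ≥0∞))
    ((W0.tendsto_eLpNorm_grad hU).comp hk.tendsto_atTop) (Or.inr ENNReal.coe_ne_top)
  -- Lower semicontinuity under almost everywhere convergence carries the inequality from test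
  -- functions to their closure; no convergence in L^r is needed.
  calc eLpNorm u.fn (ENNReal.ofReal r) (volume.restrict Ω)
      ≤ liminf (fun n => eLpNorm (U (k n)).fn (ENNReal.ofReal r) (volume.restrict Ω)) atTop :=
        Lp.eLpNorm_lim_le_liminf_eLpNorm (fun n => (U (k n)).memLp_fn.1) _ hka
    _ ≤ liminf (fun n => C * eLpNorm (U (k n)).grad (ENNReal.ofReal p) (volume.restrict Ω))
          atTop := by
        refine liminf_le_liminf (Eventually.of_forall fun n => ?_)
        rw [eLpNorm_congr_ae (hφ (k n)).2.1, eLpNorm_congr_ae (hφ (k n)).2.2]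
        exact htest _ (hφ (k n)).1
    _ = _ := hlim.liminf_eq

/-- The Sobolev embedding as a bounded operator. -/
lemma W0.exists_embedding (hΩb : Bornology.IsBounded Ω) (hpN : p < N) {r : ℝ}
    [Fact (1 ≤ ENNReal.ofReal r)] (hr : 0 < r) (hpr : p⁻¹ - (N : ℝ)⁻¹ ≤ r⁻¹) :
    ∃ L : W0 Ω p →L[ℝ] Lp ℝ (ENNReal.ofReal r) (volume.restrict Ω),
      ∀ u, L u =ᵐ[volume.restrict Ω] u.fn := by
  obtain ⟨C, hC⟩ := W0.exists_eLpNorm_fn_le (Ω := Ω) hΩb hpN hr hpr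
  have hmem : ∀ u : W0 Ω p, MemLp u.fn (ENNReal.ofReal r) (volume.restrict Ω) := fun u =>
    ⟨u.memLp_fn.1, (hC u).trans_lt (ENNReal.mul_lt_top ENNReal.coe_lt_top u.memLp_grad.2)⟩
  refine ⟨LinearMap.mkContinuous
    { toFun := fun u => (hmem u).toLp _
      map_add' := fun u v => ?_
      map_smul' := fun c u => ?_ } C fun u => ?_, fun u => (hmem u).coeFn_toLp⟩
  · rw [← MemLp.toLp_add]
    exact MemLp.toLp_congr _ _ (W0.fn_add u v)
  · rw [RingHom.id_apply, ← MemLp.toLp_const_smul]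
    exact MemLp.toLp_congr _ _ (W0.fn_smul c u)
  · change ‖(hmem u).toLp _‖ ≤ C * ‖u‖
    have h1 : ‖u.1.snd‖ ≤ ‖u.1‖ := WithLp.norm_snd_le _ _
    rw [Lp.norm_toLp]
    calc _ ≤ (C * eLpNorm u.grad (ENNReal.ofReal p) (volume.restrict Ω)).toReal :=
          ENNReal.toReal_mono (ENNReal.mul_ne_top ENNReal.coe_ne_top u.memLp_grad.2.ne) (hC u)
      _ = C * ‖u.1.snd‖ := by rw [ENNReal.toReal_mul, ENNReal.coe_toReal, Lp.norm_def]; rfl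
      _ ≤ _ := by gcongr; exact h1

/-- **Poincaré's inequality**: the gradient controls the norm of `W^{1,p}_0(Ω)`. -/
lemma W0.exists_norm_rpow_le (hΩb : Bornology.IsBounded Ω) (hpN : p < N) :
    ∃ C, 0 ≤ C ∧ ∀ u : W0 Ω p, ‖u‖ ^ p ≤ C * ∫ x in Ω, ‖u.grad x‖ ^ p := by
  have hp0 : 0 < p := by linarith [hp.out]
  -- Poincaré is the Sobolev inequality with target exponent r = p, which is subcritical.
  obtain ⟨C, hC⟩ := W0.exists_eLpNorm_fn_le (Ω := Ω) hΩb hpN hp0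
    (sub_le_self _ (by positivity))
  refine ⟨C ^ p + 1, by positivity, fun u => ?_⟩
  have h1 := hC u
  set A := ∫ x in Ω, ‖u.fn x‖ ^ p with hA
  set B := ∫ x in Ω, ‖u.grad x‖ ^ p with hB
  have hA0 : 0 ≤ A := integral_nonneg fun x => by positivity
  have hB0 : 0 ≤ B := integral_nonneg fun x => by positivity
  rw [eLpNorm_ofReal_eq hp0 u.memLp_fn, eLpNorm_ofReal_eq hp0 u.memLp_grad,
    ← ENNReal.ofReal_coe_nnreal, ← ENNReal.ofReal_mul (by positivity),
    ENNReal.ofReal_le_ofReal_iff (by positivity)] at h1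
  have h2 := Real.rpow_le_rpow (by positivity) h1 hp0.le
  rw [Real.mul_rpow (by positivity) (by positivity), ← Real.rpow_mul hA0, ← Real.rpow_mul hB0,
    inv_mul_cancel₀ hp0.ne', Real.rpow_one, Real.rpow_one] at h2
  rw [W0.norm_rpow]
  linarith

/-! ### Truncations -/

/-- A smooth bounded increasing function, close to the identity near `0`. -/
def trunc (δ t : ℝ) : ℝ := δ * Real.arctan (t / δ)

/-- The derivative of `trunc`. -/
def truncDeriv (δ t : ℝ) : ℝ := 1 / (1 + (t / δ) ^ 2)

lemma hasDerivAt_trunc {δ : ℝ} (hδ : 0 < δ) (t : ℝ) :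
    HasDerivAt (trunc δ) (truncDeriv δ t) t := by
  have h := ((Real.hasDerivAt_arctan (t / δ)).comp t ((hasDerivAt_id t).div_const δ)).const_mul δ
  refine h.congr_deriv ?_
  rw [truncDeriv]
  field_simp

lemma contDiff_trunc (δ : ℝ) : ContDiff ℝ ∞ (trunc δ) :=
  contDiff_const.mul (Real.contDiff_arctan.comp (contDiff_id.div_const δ))

lemma truncDeriv_nonneg (δ t : ℝ) : 0 ≤ truncDeriv δ t := by unfold truncDeriv; positivity

lemma truncDeriv_le_one (δ t : ℝ) : truncDeriv δ t ≤ 1 := by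
  unfold truncDeriv
  rw [div_le_one (by positivity)]
  linarith [sq_nonneg (t / δ)]

lemma continuous_truncDeriv (δ : ℝ) : Continuous (truncDeriv δ) := by
  unfold truncDeriv
  exact continuous_const.div (by fun_prop) fun t => by positivity

/-- Quantifies how little is lost where the argument is small against δ: the loss is controlled by
|u_i - u_j| / δ, whose integral tends to 0 by Rellich's theorem for fixed δ. -/
lemma one_sub_truncDeriv_le {δ : ℝ} (hδ : 0 < δ) (t : ℝ) : 1 - truncDeriv δ t ≤ |t| / δ := by
  unfold truncDeriv
  have e : |t| / δ = |t / δ| := by rw [abs_div, abs_of_pos hδ]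
  rw [e, ← sq_abs (t / δ)]
  have h0 := abs_nonneg (t / δ)
  rw [sub_le_iff_le_add, ← sub_le_iff_le_add', le_div_iff₀ (by positivity)]
  nlinarith [sq_nonneg (|t / δ| - 1), mul_nonneg h0 (sq_nonneg (|t / δ|))]

lemma abs_trunc_le {δ : ℝ} (hδ : 0 < δ) (t : ℝ) : |trunc δ t| ≤ 2 * δ := by
  rw [trunc, abs_mul, abs_of_pos hδ, mul_comm]
  gcongr
  rw [abs_le]
  constructor
  · linarith [Real.neg_pi_div_two_lt_arctan (t / δ), Real.pi_le_four]
  · linarith [Real.arctan_lt_pi_div_two (t / δ), Real.pi_le_four]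

lemma abs_trunc_le_abs {δ : ℝ} (hδ : 0 < δ) (t : ℝ) : |trunc δ t| ≤ |t| := by
  have := Convex.norm_image_sub_le_of_norm_hasDerivWithin_le (f := trunc δ) (C := 1)
    (s := Set.univ) (x := 0) (y := t)
    (fun s _ => (hasDerivAt_trunc hδ s).hasDerivWithinAt)
    (fun s _ => by
      rw [Real.norm_of_nonneg (truncDeriv_nonneg _ _)]; exact truncDeriv_le_one _ _)
    convex_univ (Set.mem_univ _) (Set.mem_univ _)
  simpa [trunc] using this

lemma IsTestFunction.trunc {φ : RN N → ℝ} (hφ : IsTestFunction Ω φ) (δ : ℝ) :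
    IsTestFunction Ω (fun x => trunc δ (φ x)) := by
  have h0 : CriticalSystem.trunc δ 0 = 0 := by simp [CriticalSystem.trunc]
  exact ⟨(contDiff_trunc δ).comp hφ.smooth, hφ.compact.comp_left h0,
    (tsupport_comp_subset h0 φ).trans hφ.support⟩

lemma gradient_trunc {φ : RN N → ℝ} (hφ : IsTestFunction Ω φ) {δ : ℝ} (hδ : 0 < δ) (x : RN N) :
    gradient (fun x => trunc δ (φ x)) x = truncDeriv δ (φ x) • gradient φ x := by
  have h := (hasDerivAt_trunc hδ (φ x)).comp_hasFDerivAt x (hφ.differentiable x).hasFDerivAt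
  rw [gradient, gradient]
  rw [show fderiv ℝ (fun x => trunc δ (φ x)) x = _ from h.fderiv, map_smulₛₗ]
  simp

/-- The chain rule for `trunc` in `W^{1,p}_0(Ω)`. -/
lemma W0.exists_trunc (u : W0 Ω p) {δ : ℝ} (hδ : 0 < δ) :
    ∃ h : W0 Ω p, (h.fn =ᵐ[volume.restrict Ω] fun x => trunc δ (u.fn x)) ∧
      (h.grad =ᵐ[volume.restrict Ω] fun x => truncDeriv δ (u.fn x) • u.grad x) ∧ ‖h‖ ≤ ‖u‖ := by
  have hp0 : 0 < p := by linarith [hp.out]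
  have hφ₁ : Continuous (Function.uncurry fun (x : ℝ) (_ : RN N) => trunc δ x) :=
    (contDiff_trunc δ).continuous.comp continuous_fst
  have hφ₁C : ∀ (x : ℝ) (y : RN N), ‖trunc δ x‖ ^ p ≤ 1 * (‖x‖ ^ p + ‖y‖ ^ p) := by
    intro x y
    have h1 := Real.rpow_le_rpow (abs_nonneg _) (abs_trunc_le_abs hδ x) hp0.le
    have h2 : 0 ≤ ‖y‖ ^ p := by positivity
    rw [one_mul, Real.norm_eq_abs, Real.norm_eq_abs]
    linarith
  have hφ₂ : Continuous (Function.uncurry fun (x : ℝ) (y : RN N) => truncDeriv δ x • y) :=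
    ((continuous_truncDeriv δ).comp continuous_fst).smul continuous_snd
  have hsm : ∀ (x : ℝ) (y : RN N), ‖truncDeriv δ x • y‖ ≤ ‖y‖ := by
    intro x y
    rw [norm_smul, Real.norm_of_nonneg (truncDeriv_nonneg _ _)]
    exact mul_le_of_le_one_left (norm_nonneg _) (truncDeriv_le_one _ _)
  have hφ₂C : ∀ (x : ℝ) (y : RN N), ‖truncDeriv δ x • y‖ ^ p ≤ 1 * (‖x‖ ^ p + ‖y‖ ^ p) := by
    intro x y
    have h1 := Real.rpow_le_rpow (norm_nonneg _) (hsm x y) hp0.le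
    have h2 : 0 ≤ ‖x‖ ^ p := by positivity
    linarith
  let T : PairSpace Ω p → PairSpace Ω p := fun w => WithLp.toLp _
    ((memLp_comp₂ hp0 hp0 hp0 hφ₁ hφ₁C (Lp.memLp w.fst) (Lp.memLp w.snd)).toLp _,
      (memLp_comp₂ hp0 hp0 hp0 hφ₂ hφ₂C (Lp.memLp w.fst) (Lp.memLp w.snd)).toLp _)
  have hT1 : ∀ w, (T w).fst =ᵐ[volume.restrict Ω] fun x => trunc δ (w.fst x) := fun w =>
    (memLp_comp₂ hp0 hp0 hp0 hφ₁ hφ₁C (Lp.memLp w.fst) (Lp.memLp w.snd)).coeFn_toLp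
  have hT2 : ∀ w, (T w).snd =ᵐ[volume.restrict Ω] fun x => truncDeriv δ (w.fst x) • w.snd x :=
    fun w => (memLp_comp₂ hp0 hp0 hp0 hφ₂ hφ₂C (Lp.memLp w.fst) (Lp.memLp w.snd)).coeFn_toLp
  have hTc : Continuous T := by
    have hof := WithLp.prod_continuous_ofLp (ENNReal.ofReal p)
      (Lp ℝ (ENNReal.ofReal p) (volume.restrict Ω)) (Lp (RN N) (ENNReal.ofReal p) (volume.restrict Ω))
    exact (WithLp.prod_continuous_toLp _ _ _).comp
      (((continuous_nemytskii hp0 hp0 hp0 hφ₁ zero_le_one hφ₁C).comp hof).prodMk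
        ((continuous_nemytskii hp0 hp0 hp0 hφ₂ zero_le_one hφ₂C).comp hof))
  -- The truncation is smooth and vanishes at 0, so it preserves test functions and the classical
  -- chain rule applies. Continuity of T extends this to the closure.
  have hmaps : Set.MapsTo T (testPairs Ω p) (testPairs Ω p) := by
    rintro w ⟨φ, hφ, h1, h2⟩
    refine ⟨fun x => trunc δ (φ x), hφ.trunc δ, ?_, ?_⟩
    · filter_upwards [hT1 w, h1] with x e1 e2
      rw [e1, e2]
    · filter_upwards [hT2 w, h1, h2] with x e1 e2 e3
      rw [e1, e2, e3, gradient_trunc hφ hδ]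
  have hu : (u : PairSpace Ω p) ∈ closure (testPairs Ω p : Set (PairSpace Ω p)) := by
    rw [← Submodule.topologicalClosure_coe]; exact u.2
  have hTu := map_mem_closure hTc hu hmaps
  rw [← Submodule.topologicalClosure_coe] at hTu
  have hf : W0.fn ⟨T u.1, hTu⟩ =ᵐ[volume.restrict Ω] fun x => trunc δ (u.fn x) := hT1 u.1
  have hg : W0.grad ⟨T u.1, hTu⟩ =ᵐ[volume.restrict Ω] fun x => truncDeriv δ (u.fn x) • u.grad x :=
    hT2 u.1
  refine ⟨⟨T u.1, hTu⟩, hf, hg, ?_⟩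
  rw [← Real.rpow_le_rpow_iff (norm_nonneg _) (norm_nonneg _) hp0, W0.norm_rpow, W0.norm_rpow]
  refine add_le_add ?_ ?_
  · refine integral_mono_of_nonneg (Eventually.of_forall fun x => by positivity)
      (integrable_norm_rpow_of_memLp hp0 u.memLp_fn) ?_
    filter_upwards [hf] with x hx
    rw [hx]
    exact Real.rpow_le_rpow (norm_nonneg _) (abs_trunc_le_abs hδ _) hp0.le
  · refine integral_mono_of_nonneg (Eventually.of_forall fun x => by positivity)
      (integrable_norm_rpow_of_memLp hp0 u.memLp_grad) ?_
    filter_upwards [hg] with x hx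
    rw [hx]
    exact Real.rpow_le_rpow (norm_nonneg _) (hsm _ _) hp0.le

/-! ### Extension by zero and the best Sobolev constant -/

lemma integral_smul_gradient {φ ψ : RN N → ℝ} (hφ : IsTestFunction Set.univ φ)
    (hψ : IsTestFunction Set.univ ψ) :
    ∫ x, φ x • gradient ψ x = -∫ x, ψ x • gradient φ x := by
  have hi : ∀ {f g : RN N → ℝ}, IsTestFunction Set.univ f → IsTestFunction Set.univ g →
      Integrable (fun x => f x • gradient g x) volume := fun hf hg =>
    (hf.smooth.continuous.smul (continuous_gradient hg.smooth)).integrable_of_hasCompactSupport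
      (hf.compact.smul_right)
  have hin : ∀ (f : RN N → ℝ) (v x : RN N), inner ℝ v (gradient f x) = fderiv ℝ f x v := by
    intro f v x
    rw [real_inner_comm, gradient, InnerProductSpace.toDual_symm_apply]
  have hfd : ∀ {f : RN N → ℝ} (v : RN N), IsTestFunction Set.univ f →
      Continuous fun x => fderiv ℝ f x v := fun v hf =>
    (hf.smooth.continuous_fderiv (by simp)).clm_apply continuous_const
  refine ext_inner_left ℝ fun v => ?_
  rw [inner_neg_right, ← integral_inner (hi hφ hψ), ← integral_inner (hi hψ hφ)]
  simp only [real_inner_smul_right, hin]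
  rw [integral_mul_fderiv_eq_neg_fderiv_mul_of_integrable]
  · simp only [mul_comm]
  · exact ((hfd v hφ).mul hψ.smooth.continuous).integrable_of_hasCompactSupport hψ.compact.mul_left
  · exact (hφ.smooth.continuous.mul (hfd v hψ)).integrable_of_hasCompactSupport
      hφ.compact.mul_right
  · exact (hφ.smooth.continuous.mul hψ.smooth.continuous).integrable_of_hasCompactSupport
      hφ.compact.mul_right
  · exact fun x _ => hφ.differentiable x
  · exact fun x _ => hψ.differentiable x

/-- For fixed ψ both sides are continuous in the pair (u, ∇u) by Hölder's inequality, so integration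
by parts for test functions passes to the closure. As ψ need not vanish on ∂Ω, this makes the
extension by zero weakly differentiable on the whole space. -/
lemma W0.integral_fn_smul_gradient (u : W0 Ω p) {ψ : RN N → ℝ} (hψ : IsTestFunction Set.univ ψ) :
    ∫ x in Ω, u.fn x • gradient ψ x = -∫ x in Ω, ψ x • u.grad x := by
  have hp1 : 1 < p := hp.out
  have hconj := Real.HolderConjugate.conjExponent hp1
  have : Fact (1 ≤ ENNReal.ofReal p.conjExponent) := ⟨by simpa using hconj.symm.lt.le⟩
  have := hconj.ennrealOfReal
  have := hconj.symm.ennrealOfReal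
  let B₁ := (ContinuousLinearMap.lsmul ℝ ℝ : ℝ →L[ℝ] RN N →L[ℝ] RN N).lpPairing
    (volume.restrict Ω) (ENNReal.ofReal p) (ENNReal.ofReal p.conjExponent)
  let B₂ := (ContinuousLinearMap.lsmul ℝ ℝ : ℝ →L[ℝ] RN N →L[ℝ] RN N).lpPairing
    (volume.restrict Ω) (ENNReal.ofReal p.conjExponent) (ENNReal.ofReal p)
  let T : PairSpace Ω p → RN N := fun w =>
    B₁ w.fst ((hψ.memLp_gradient _ _).toLp _) + B₂ ((hψ.memLp _ _).toLp _) w.snd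
  have hTc : Continuous T := by
    refine Continuous.add ?_ ?_
    · exact (B₁.continuous.comp (WithLp.fstL _ ℝ _ _).continuous).clm_apply continuous_const
    · exact (B₂ _).continuous.comp (WithLp.sndL _ ℝ _ _).continuous
  have hTv : ∀ w : PairSpace Ω p, T w = (∫ x in Ω, w.fst x • gradient ψ x)
      + ∫ x in Ω, ψ x • w.snd x := by
    intro w
    simp only [T, B₁, B₂]
    rw [ContinuousLinearMap.lpPairing_eq_integral, ContinuousLinearMap.lpPairing_eq_integral]
    congr 1
    · refine integral_congr_ae ?_
      filter_upwards [(hψ.memLp_gradient (ENNReal.ofReal p.conjExponent)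
        (volume.restrict Ω)).coeFn_toLp] with x hx
      rw [hx]; rfl
    · refine integral_congr_ae ?_
      filter_upwards [(hψ.memLp (ENNReal.ofReal p.conjExponent)
        (volume.restrict Ω)).coeFn_toLp] with x hx
      rw [hx]; rfl
  have hcl : closure (testPairs Ω p : Set (PairSpace Ω p)) ⊆ {w | T w = 0} := by
    refine closure_minimal ?_ (isClosed_eq hTc continuous_const)
    rintro w ⟨φ, hφ, h1, h2⟩
    change T w = 0
    rw [hTv]
    have e1 : ∫ x in Ω, w.fst x • gradient ψ x = ∫ x, φ x • gradient ψ x := by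
      rw [← setIntegral_eq_integral_of_forall_compl_eq_zero (s := Ω)
        (f := fun x => φ x • gradient ψ x)]
      · refine integral_congr_ae ?_
        filter_upwards [h1] with x hx
        rw [hx]
      · intro x hx
        rw [image_eq_zero_of_notMem_tsupport fun h => hx (hφ.support h), zero_smul]
    have e2 : ∫ x in Ω, ψ x • w.snd x = ∫ x, ψ x • gradient φ x := by
      rw [← setIntegral_eq_integral_of_forall_compl_eq_zero (s := Ω)
        (f := fun x => ψ x • gradient φ x)]
      · refine integral_congr_ae ?_
        filter_upwards [h2] with x hx
        rw [hx]
      · intro x hx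
        have : gradient φ x = 0 := by
          by_contra h
          exact hx (hφ.support (support_gradient_subset φ h))
        rw [this, smul_zero]
    rw [e1, e2, integral_smul_gradient hφ.univ hψ, neg_add_cancel]
  have hu : (u : PairSpace Ω p) ∈ closure (testPairs Ω p : Set (PairSpace Ω p)) := by
    rw [← Submodule.topologicalClosure_coe]; exact u.2
  have := hcl hu
  change T u.1 = 0 at this
  rw [hTv] at this
  exact eq_neg_of_add_eq_zero_left this

lemma inv_critExp (hpN : p < N) : (critExp N p)⁻¹ = p⁻¹ - (N : ℝ)⁻¹ := by
  have hp0 : 0 < p := by linarith [hp.out]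
  have hN : (0 : ℝ) < N := hp0.trans hpN
  have : (N : ℝ) - p ≠ 0 := by linarith
  rw [critExp]
  field_simp

lemma lt_critExp (hpN : p < N) : p < critExp N p := by
  have hp0 : 0 < p := by linarith [hp.out]
  rw [critExp, lt_div_iff₀ (by linarith)]
  nlinarith

lemma W0.memLp_fn_critExp (hΩb : Bornology.IsBounded Ω) (hpN : p < N) (u : W0 Ω p) :
    MemLp u.fn (ENNReal.ofReal (critExp N p)) (volume.restrict Ω) := by
  have hp0 : 0 < p := by linarith [hp.out]
  obtain ⟨C, hC⟩ := W0.exists_eLpNorm_fn_le (Ω := Ω) hΩb hpN (hp0.trans (lt_critExp hpN))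
    (inv_critExp hpN).symm.le
  exact ⟨u.memLp_fn.1, (hC u).trans_lt (ENNReal.mul_lt_top ENNReal.coe_lt_top u.memLp_grad.2)⟩

lemma W0.memD_indicator (hΩo : IsOpen Ω) (hΩb : Bornology.IsBounded Ω) (hpN : p < N)
    (u : W0 Ω p) : MemD p (Ω.indicator u.fn) (Ω.indicator u.grad) where
  memLp := (memLp_indicator_iff_restrict hΩo.measurableSet).2 (u.memLp_fn_critExp hΩb hpN)
  memLp_grad := (memLp_indicator_iff_restrict hΩo.measurableSet).2 u.memLp_grad
  weakGrad := fun ψ hψ => by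
    have e1 : (fun x => Ω.indicator u.fn x • gradient ψ x)
        = Ω.indicator fun x => u.fn x • gradient ψ x := by
      funext x; by_cases hx : x ∈ Ω <;> simp [hx]
    have e2 : (fun x => ψ x • Ω.indicator u.grad x) = Ω.indicator fun x => ψ x • u.grad x := by
      funext x; by_cases hx : x ∈ Ω <;> simp [hx]
    rw [e1, e2, integral_indicator hΩo.measurableSet, integral_indicator hΩo.measurableSet]
    exact u.integral_fn_smul_gradient hψ

/-- The Sobolev inequality with the best constant on `W^{1,p}_0(Ω)`. -/
lemma W0.sobolevConst_mul_le (hΩo : IsOpen Ω) (hΩb : Bornology.IsBounded Ω) (hpN : p < N)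
    (u : W0 Ω p) : sobolevConst N p * (∫ x in Ω, |u.fn x| ^ critExp N p) ^ (p / critExp N p)
      ≤ ∫ x in Ω, ‖u.grad x‖ ^ p := by
  have hp0 : 0 < p := by linarith [hp.out]
  have hc0 : 0 < critExp N p := hp0.trans (lt_critExp hpN)
  have e1 : ∫ x, |Ω.indicator u.fn x| ^ critExp N p = ∫ x in Ω, |u.fn x| ^ critExp N p := by
    rw [← integral_indicator hΩo.measurableSet]
    congr 1
    funext x
    by_cases hx : x ∈ Ω <;> simp [hx, Real.zero_rpow hc0.ne']
  have e2 : ∫ x, ‖Ω.indicator u.grad x‖ ^ p = ∫ x in Ω, ‖u.grad x‖ ^ p := by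
    rw [← integral_indicator hΩo.measurableSet]
    congr 1
    funext x
    by_cases hx : x ∈ Ω <;> simp [hx, Real.zero_rpow hp0.ne']
  have hA : 0 ≤ ∫ x in Ω, ‖u.grad x‖ ^ p := integral_nonneg fun x => by positivity
  have hB : 0 ≤ ∫ x in Ω, |u.fn x| ^ critExp N p := integral_nonneg fun x => by positivity
  rcases hB.eq_or_lt with h0 | hpos
  · rw [← h0, Real.zero_rpow (by positivity), mul_zero]
    exact hA
  · have hne : ¬ Ω.indicator u.fn =ᵐ[volume] 0 := by
      intro h
      rw [← e1] at hpos
      refine hpos.ne' ?_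
      rw [← integral_zero (RN N) ℝ]
      refine integral_congr_ae ?_
      filter_upwards [h] with x hx
      rw [hx]
      simp [Real.zero_rpow hc0.ne']
    have hle : sobolevConst N p ≤ (∫ x in Ω, ‖u.grad x‖ ^ p) /
        (∫ x in Ω, |u.fn x| ^ critExp N p) ^ (p / critExp N p) := by
      refine csInf_le ⟨0, ?_⟩ ⟨_, _, u.memD_indicator hΩo hΩb hpN, hne, by rw [e1, e2]⟩
      rintro r ⟨v, g, -, -, rfl⟩
      have h1 : 0 ≤ ∫ x, ‖g x‖ ^ p := integral_nonneg fun x => by positivity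
      have h2 : 0 ≤ ∫ x, |v x| ^ critExp N p := integral_nonneg fun x => by positivity
      positivity
    rwa [le_div_iff₀ (by positivity)] at hle

end Sobolev

/-! ### The Rellich–Kondrachov theorem -/

section Rellich

variable {N : ℕ} {Ω : Set (RN N)}

/-- Integrate the derivative along the segment from x to x + y and exchange the integrals;
translation invariance removes the shift. -/
lemma lintegral_enorm_add_sub_le {φ : RN N → ℝ} (hφ : ContDiff ℝ 1 φ) (y : RN N) :
    ∫⁻ x, ‖φ (x + y) - φ x‖ₑ ≤ ‖y‖ₑ * ∫⁻ x, ‖fderiv ℝ φ x‖ₑ := by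
  have hc : Continuous fun z : RN N × ℝ => fderiv ℝ φ (z.1 + z.2 • y) :=
    (hφ.continuous_fderiv (by simp)).comp
      (continuous_fst.add (continuous_snd.smul continuous_const))
  have hpt : ∀ x, ‖φ (x + y) - φ x‖ₑ ≤
      ∫⁻ t in Set.Ioc (0 : ℝ) 1, ‖fderiv ℝ φ (x + t • y)‖ₑ * ‖y‖ₑ := by
    intro x
    have hcx : Continuous fun t : ℝ => fderiv ℝ φ (x + t • y) y :=
      (hc.comp (continuous_const.prodMk continuous_id)).clm_apply continuous_const
    have hd : ∀ t ∈ Set.uIcc (0 : ℝ) 1, HasDerivAt (fun t : ℝ => φ (x + t • y))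
        (fderiv ℝ φ (x + t • y) y) t := by
      intro t _
      have h1 : HasDerivAt (fun t : ℝ => x + t • y) y t := by
        simpa using ((hasDerivAt_id t).smul_const y).const_add x
      exact ((hφ.differentiable (by simp)) _).hasFDerivAt.comp_hasDerivAt t h1
    have h2 := intervalIntegral.integral_eq_sub_of_hasDerivAt hd (hcx.intervalIntegrable 0 1)
    simp only [one_smul, zero_smul, add_zero] at h2
    rw [← h2, intervalIntegral.integral_of_le zero_le_one]
    refine (enorm_integral_le_lintegral_enorm _).trans (lintegral_mono fun t => ?_)
    exact ContinuousLinearMap.le_opENorm _ _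
  calc ∫⁻ x, ‖φ (x + y) - φ x‖ₑ
      ≤ ∫⁻ x, ∫⁻ t in Set.Ioc (0 : ℝ) 1, ‖fderiv ℝ φ (x + t • y)‖ₑ * ‖y‖ₑ := lintegral_mono hpt
    _ = ∫⁻ t in Set.Ioc (0 : ℝ) 1, ∫⁻ x, ‖fderiv ℝ φ (x + t • y)‖ₑ * ‖y‖ₑ :=
        lintegral_lintegral_swap (hc.enorm.measurable.mul_const _).aemeasurable
    _ = ∫⁻ _ in Set.Ioc (0 : ℝ) 1, ‖y‖ₑ * ∫⁻ x, ‖fderiv ℝ φ x‖ₑ := by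
        refine lintegral_congr fun t => ?_
        rw [lintegral_mul_const' _ _ enorm_ne_top, mul_comm,
          lintegral_add_right_eq_self (fun x => ‖fderiv ℝ φ x‖ₑ)]
    _ = _ := by simp

/-- The average of `φ` with weight `ρ`. -/
def mollify (ρ φ : RN N → ℝ) (x : RN N) : ℝ := ∫ y, ρ y * φ (x + y)

/-- A Lipschitz probability density concentrated near the origin. -/
structure IsKernel (ε : ℝ) (ρ : RN N → ℝ) : Prop where
  continuous : Continuous ρ
  compact : HasCompactSupport ρ
  integral_enorm : ∫⁻ y, ‖ρ y‖ₑ = 1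
  integral_eq : ∫ y, ρ y = 1
  norm_le : ∀ y, ρ y ≠ 0 → ‖y‖ ≤ ε
  lipschitz : ∃ K, LipschitzWith K ρ
  bounded : ∃ M, ∀ y, |ρ y| ≤ M

lemma exists_isKernel (N : ℕ) {ε : ℝ} (hε : 0 < ε) : ∃ ρ : RN N → ℝ, IsKernel ε ρ := by
  let f : ContDiffBump (0 : RN N) := ⟨ε / 2, ε, by positivity, by linarith⟩
  have hc : Continuous (f.normed volume) := (f.contDiff_normed (n := 1)).continuous
  refine ⟨f.normed volume, hc, f.hasCompactSupport_normed, ?_, f.integral_normed, ?_,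
    (f.contDiff_normed (n := 1)).lipschitzWith_of_hasCompactSupport
      f.hasCompactSupport_normed one_ne_zero, ?_⟩
  · have h1 : ∀ y, ‖f.normed volume y‖ₑ = ENNReal.ofReal (f.normed volume y) := fun y =>
      Real.enorm_of_nonneg (f.nonneg_normed y)
    simp_rw [h1]
    rw [← ofReal_integral_eq_lintegral_ofReal f.integrable_normed
      (Eventually.of_forall f.nonneg_normed), f.integral_normed, ENNReal.ofReal_one]
  · intro y hy
    have : y ∈ Function.support (f.normed volume) := hy
    rw [f.support_normed_eq, mem_ball_zero_iff] at this
    exact this.le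
  · exact hc.bounded_above_of_compact_support f.hasCompactSupport_normed

lemma mollify_eq (ρ φ : RN N → ℝ) (x : RN N) : mollify ρ φ x = ∫ z, ρ (z - x) * φ z := by
  rw [mollify, ← integral_add_left_eq_self (fun z => ρ (z - x) * φ z) x]
  simp

lemma abs_mollify_le {ρ φ : RN N → ℝ} {M : ℝ} (hM : ∀ y, |ρ y| ≤ M) (hφ : Integrable φ)
    (x : RN N) : |mollify ρ φ x| ≤ M * ∫ z, |φ z| := by
  rw [mollify_eq, ← integral_const_mul, ← Real.norm_eq_abs]
  refine norm_integral_le_of_norm_le (hφ.abs.const_mul M) (Eventually.of_forall fun z => ?_)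
  rw [norm_mul]
  exact mul_le_mul_of_nonneg_right (hM _) (abs_nonneg _)

/-- The Lipschitz constant depends on φ only through its L^1 norm, so mollifications at a fixed
scale of an L^1-bounded sequence are equicontinuous. -/
lemma abs_mollify_sub_le {ε : ℝ} {ρ φ : RN N → ℝ} {K : NNReal} (hρ : IsKernel ε ρ)
    (hK : LipschitzWith K ρ) (hφ : Integrable φ)
    (x y : RN N) : |mollify ρ φ x - mollify ρ φ y| ≤ K * ‖x - y‖ * ∫ z, |φ z| := by
  obtain ⟨M, hM⟩ := hρ.bounded
  have hi : ∀ x, Integrable (fun z => ρ (z - x) * φ z) := fun x =>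
    hφ.bdd_mul (hρ.continuous.comp (continuous_id.sub continuous_const)).aestronglyMeasurable
      (Eventually.of_forall fun z => hM _)
  rw [mollify_eq, mollify_eq, ← integral_sub (hi x) (hi y), ← integral_const_mul,
    ← Real.norm_eq_abs]
  refine norm_integral_le_of_norm_le (hφ.abs.const_mul _) (Eventually.of_forall fun z => ?_)
  rw [← sub_mul, norm_mul]
  refine mul_le_mul_of_nonneg_right ?_ (abs_nonneg _)
  have := hK.dist_le_mul (z - x) (z - y)
  rwa [dist_eq_norm, dist_eq_norm, sub_sub_sub_cancel_left, norm_sub_rev y x] at this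

lemma continuous_mollify {ε : ℝ} {ρ φ : RN N → ℝ} (hρ : IsKernel ε ρ) (hφ : Integrable φ) :
    Continuous (mollify ρ φ) := by
  obtain ⟨K, hK⟩ := hρ.lipschitz
  have hI : 0 ≤ ∫ z, |φ z| := integral_nonneg fun z => abs_nonneg _
  refine (LipschitzWith.of_dist_le_mul (K := K * (∫ z, |φ z|).toNNReal) fun x y => ?_).continuous
  rw [dist_eq_norm, dist_eq_norm]
  refine (abs_mollify_sub_le hρ hK hφ x y).trans (le_of_eq ?_)
  rw [NNReal.coe_mul, Real.coe_toNNReal _ hI]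
  ring

/-- The error is an average of translation errors by vectors of length at most ε, each bounded by ε
times the L^1 norm of the derivative. Hence it is uniform over sequences bounded in W^{1,1}. -/
lemma lintegral_enorm_mollify_sub_le {ε : ℝ} {ρ φ : RN N → ℝ} (hρ : IsKernel ε ρ)
    (hφ : ContDiff ℝ 1 φ) :
    ∫⁻ x, ‖φ x - mollify ρ φ x‖ₑ ≤ ENNReal.ofReal ε * ∫⁻ x, ‖fderiv ℝ φ x‖ₑ := by
  have hpt : ∀ x, ‖φ x - mollify ρ φ x‖ₑ ≤ ∫⁻ y, ‖ρ y‖ₑ * ‖φ (x + y) - φ x‖ₑ := by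
    intro x
    have h1 : mollify ρ φ x - φ x = ∫ y, ρ y * (φ (x + y) - φ x) := by
      simp_rw [mul_sub]
      rw [integral_sub, integral_mul_const, hρ.integral_eq, one_mul, mollify]
      · exact (hρ.continuous.mul (hφ.continuous.comp
          (continuous_const.add continuous_id))).integrable_of_hasCompactSupport
            hρ.compact.mul_right
      · exact (hρ.continuous.integrable_of_hasCompactSupport hρ.compact).mul_const _
    rw [← enorm_neg, neg_sub, h1]
    refine (enorm_integral_le_lintegral_enorm _).trans (le_of_eq (lintegral_congr fun y => ?_))
    rw [enorm_mul]
  have hc : Measurable fun z : RN N × RN N => ‖ρ z.2‖ₑ * ‖φ (z.1 + z.2) - φ z.1‖ₑ := by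
    have h1 := hρ.continuous
    have h2 := hφ.continuous
    have h3 : Continuous fun z : RN N × RN N => ρ z.2 := by fun_prop
    have h4 : Continuous fun z : RN N × RN N => φ (z.1 + z.2) - φ z.1 := by fun_prop
    exact h3.enorm.measurable.mul h4.enorm.measurable
  calc ∫⁻ x, ‖φ x - mollify ρ φ x‖ₑ ≤ ∫⁻ x, ∫⁻ y, ‖ρ y‖ₑ * ‖φ (x + y) - φ x‖ₑ :=
        lintegral_mono hpt
    _ = ∫⁻ y, ∫⁻ x, ‖ρ y‖ₑ * ‖φ (x + y) - φ x‖ₑ :=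
        lintegral_lintegral_swap hc.aemeasurable
    _ ≤ ∫⁻ y, ‖ρ y‖ₑ * (ENNReal.ofReal ε * ∫⁻ x, ‖fderiv ℝ φ x‖ₑ) := by
        refine lintegral_mono fun y => ?_
        dsimp only
        rw [lintegral_const_mul' _ _ enorm_ne_top]
        by_cases hy : ρ y = 0
        · simp [hy]
        · gcongr
          refine (lintegral_enorm_add_sub_le hφ y).trans ?_
          gcongr
          rw [← ofReal_norm]
          exact ENNReal.ofReal_le_ofReal (hρ.norm_le y hy)
    _ = _ := by
        rw [lintegral_mul_const _ hρ.continuous.enorm.measurable, hρ.integral_enorm, one_mul]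

/-- Test functions bounded in `W^{1,1}` have a subsequence which is Cauchy in `L^1(Ω)`. -/
lemma exists_subseq_cauchy_of_isTestFunction (hΩb : Bornology.IsBounded Ω) {φ : ℕ → RN N → ℝ}
    (hφ : ∀ j, IsTestFunction Ω (φ j)) {M : ℝ} (hM : ∀ j, ∫ x, |φ j x| ≤ M) {D : ℝ≥0∞}
    (hD : D ≠ ⊤) (hφD : ∀ j, ∫⁻ x, ‖fderiv ℝ (φ j) x‖ₑ ≤ D) :
    ∃ k : ℕ → ℕ, StrictMono k ∧ Tendsto (fun n : ℕ × ℕ =>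
      eLpNorm (φ (k n.1) - φ (k n.2)) 1 (volume.restrict Ω)) atTop (𝓝 0) := by
  have : IsFiniteMeasure (volume.restrict Ω) := ⟨by simpa using hΩb.measure_lt_top⟩
  have hint : ∀ j, Integrable (φ j) := fun j =>
    (hφ j).smooth.continuous.integrable_of_hasCompactSupport (hφ j).compact
  have hM0 : 0 ≤ M := (integral_nonneg fun x => abs_nonneg _).trans (hM 0)
  choose ρ hρ using fun n : ℕ => exists_isKernel N (ε := 1 / ((n : ℝ) + 1)) (by positivity)
  choose B hB using fun n => (hρ n).bounded
  choose K hK using fun n => (hρ n).lipschitz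
  have hB0 : ∀ n, 0 ≤ B n := fun n => (abs_nonneg _).trans (hB n 0)
  have hbd : ∀ n j x, |mollify (ρ n) (φ j) x| ≤ B n * M := fun n j x =>
    (abs_mollify_le (hB n) (hint j) x).trans (mul_le_mul_of_nonneg_left (hM j) (hB0 n))
  set d := TopologicalSpace.denseSeq (RN N) with hd
  -- Sequential compactness of this countable product replaces a diagonal argument: one subsequence
  -- converges at every scale n and every point of a dense sequence.
  have hcomp : IsCompact (Set.univ.pi fun i : ℕ × ℕ => Set.Icc (-(B i.1 * M)) (B i.1 * M)) :=
    isCompact_univ_pi fun i => isCompact_Icc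
  obtain ⟨L, -, k, hk, hkL⟩ := hcomp.isSeqCompact
    (x := fun j i => mollify (ρ i.1) (φ j) (d i.2))
    (fun j => fun i _ => abs_le.1 (hbd i.1 j (d i.2)))
  rw [tendsto_pi_nhds] at hkL
  -- For fixed n all the mollifications share the Lipschitz constant K n * M, so convergence spreads
  -- from the dense points to every x.
  have hconv : ∀ n x, ∃ l, Tendsto (fun j => mollify (ρ n) (φ (k j)) x) atTop (𝓝 l) := by
    intro n x
    refine cauchySeq_tendsto_of_complete (Metric.cauchySeq_iff'.2 fun ε hε => ?_)
    have hη : 0 < ε / (4 * (K n * M + 1)) := by positivity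
    obtain ⟨i, hi⟩ := (TopologicalSpace.denseRange_denseSeq (RN N)).exists_dist_lt x hη
    have hdi : ∀ j, |mollify (ρ n) (φ j) x - mollify (ρ n) (φ j) (d i)| ≤ ε / 4 := by
      intro j
      refine (abs_mollify_sub_le (hρ n) (hK n) (hint j) x (d i)).trans ?_
      rw [dist_eq_norm] at hi
      calc (K n : ℝ) * ‖x - d i‖ * ∫ z, |φ j z|
          ≤ K n * (ε / (4 * (K n * M + 1))) * M := by
            gcongr
            exact hM j
        _ = (K n * M) / (K n * M + 1) * (ε / 4) := by field_simp
        _ ≤ 1 * (ε / 4) := by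
            gcongr
            rw [div_le_one (by positivity)]
            linarith
        _ = ε / 4 := one_mul _
    obtain ⟨J, hJ⟩ := Metric.cauchySeq_iff'.1 (hkL (n, i)).cauchySeq (ε / 4) (by positivity)
    refine ⟨J, fun j hj => ?_⟩
    have h1 := hJ j hj
    have h2 := hdi (k j)
    have h3 := hdi (k J)
    simp only [Real.dist_eq, Function.comp_apply] at h1 ⊢
    rw [abs_lt] at h1 ⊢
    rw [abs_le] at h2 h3
    constructor <;> linarith [h1.1, h1.2, h2.1, h2.2, h3.1, h3.2]
  choose m hm using hconv
  have hLp : ∀ n, Tendsto (fun j => eLpNorm (mollify (ρ n) (φ (k j)) - m n) 1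
      (volume.restrict Ω)) atTop (𝓝 0) := by
    intro n
    have := tendsto_lintegral_norm_of_dominated_convergence (μ := volume.restrict Ω)
      (F := fun j => mollify (ρ n) (φ (k j))) (f := m n) (bound := fun _ => B n * M)
      (fun j => (continuous_mollify (hρ n) (hint _)).aestronglyMeasurable)
      (integrable_const _).2 (fun j => Eventually.of_forall fun x => hbd n _ x)
      (Eventually.of_forall fun x => hm n x)
    refine this.congr fun j => ?_
    rw [eLpNorm_one_eq_lintegral_enorm]
    simp only [Pi.sub_apply, ofReal_norm]
  have hmm : ∀ n, AEStronglyMeasurable (m n) (volume.restrict Ω) := fun n =>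
    aestronglyMeasurable_of_tendsto_ae atTop
      (fun j => (continuous_mollify (hρ n) (hint (k j))).aestronglyMeasurable)
      (Eventually.of_forall fun x => hm n x)
  refine ⟨k, hk, ENNReal.tendsto_nhds_zero.2 fun ε hε => ?_⟩
  have hε4 : 0 < ε / 4 := ENNReal.div_pos hε.ne' (by norm_num)
  obtain ⟨n, hn⟩ : ∃ n : ℕ, ENNReal.ofReal (1 / ((n : ℝ) + 1)) * D ≤ ε / 4 := by
    have h1 : Tendsto (fun n : ℕ => ENNReal.ofReal (1 / ((n : ℝ) + 1)) * D) atTop (𝓝 0) := by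
      have := ENNReal.Tendsto.mul_const (b := D)
        (ENNReal.tendsto_ofReal (tendsto_one_div_add_atTop_nhds_zero_nat (𝕜 := ℝ)))
        (Or.inr hD)
      simpa using this
    exact ((ENNReal.tendsto_nhds_zero.1 h1) _ hε4).exists
  have herr : ∀ j, eLpNorm (φ j - mollify (ρ n) (φ j)) 1 (volume.restrict Ω) ≤ ε / 4 := by
    intro j
    rw [eLpNorm_one_eq_lintegral_enorm]
    refine (setLIntegral_le_lintegral _ _).trans
      ((lintegral_enorm_mollify_sub_le (hρ n) (hφ j).contDiff_one).trans ?_)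
    exact (mul_le_mul_right (hφD j) _).trans hn
  have hev := (ENNReal.tendsto_nhds_zero.1 (hLp n)) _ hε4
  obtain ⟨J, hJ⟩ := eventually_atTop.1 hev
  refine eventually_atTop.2 ⟨(J, J), fun i hi => ?_⟩
  have hmeas : ∀ j, AEStronglyMeasurable (mollify (ρ n) (φ j)) (volume.restrict Ω) := fun j =>
    (continuous_mollify (hρ n) (hint j)).aestronglyMeasurable
  have hφm : ∀ j, AEStronglyMeasurable (φ j) (volume.restrict Ω) := fun j =>
    (hφ j).smooth.continuous.aestronglyMeasurable
  have hhalf : ∀ j ≥ J, eLpNorm (φ (k j) - m n) 1 (volume.restrict Ω) ≤ ε / 4 + ε / 4 := by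
    intro j hj
    calc eLpNorm (φ (k j) - m n) 1 (volume.restrict Ω)
        = eLpNorm ((φ (k j) - mollify (ρ n) (φ (k j))) + (mollify (ρ n) (φ (k j)) - m n)) 1
            (volume.restrict Ω) := by rw [sub_add_sub_cancel]
      _ ≤ _ := eLpNorm_add_le ((hφm _).sub (hmeas _)) ((hmeas _).sub (hmm n)) le_rfl
      _ ≤ _ := add_le_add (herr _) (hJ j hj)
  calc eLpNorm (φ (k i.1) - φ (k i.2)) 1 (volume.restrict Ω)
      = eLpNorm ((φ (k i.1) - m n) - (φ (k i.2) - m n)) 1 (volume.restrict Ω) := by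
        rw [sub_sub_sub_cancel_right]
    _ ≤ _ := eLpNorm_sub_le ((hφm _).sub (hmm n)) ((hφm _).sub (hmm n)) le_rfl
    _ ≤ (ε / 4 + ε / 4) + (ε / 4 + ε / 4) := add_le_add (hhalf _ hi.1) (hhalf _ hi.2)
    _ = ε := by
        rw [← two_mul, ← two_mul, ← mul_assoc]
        norm_num
        exact ENNReal.mul_div_cancel (by norm_num) (by norm_num)

lemma W0.exists_eLpNorm_one_le {p : ℝ} [hp : Fact (1 < p)] (hΩb : Bornology.IsBounded Ω) :
    ∃ V : ℝ≥0∞, V ≠ ⊤ ∧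
      (∀ v : W0 Ω p, eLpNorm v.fn 1 (volume.restrict Ω) ≤ ENNReal.ofReal ‖v‖ * V) ∧
      ∀ v : W0 Ω p, eLpNorm v.grad 1 (volume.restrict Ω) ≤ ENNReal.ofReal ‖v‖ * V := by
  have : IsFiniteMeasure (volume.restrict Ω) := ⟨by simpa using hΩb.measure_lt_top⟩
  have hp1 : 1 ≤ ENNReal.ofReal p := by simpa using hp.out.le
  refine ⟨(volume.restrict Ω) Set.univ ^ (1 / (1 : ℝ≥0∞).toReal - 1 / (ENNReal.ofReal p).toReal),
    ?_, fun v => ?_, fun v => ?_⟩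
  · refine ENNReal.rpow_ne_top_of_nonneg ?_ (measure_ne_top _ _)
    rw [ENNReal.toReal_one, ENNReal.toReal_ofReal (by linarith [hp.out]), sub_nonneg, div_one,
      div_le_one (by linarith [hp.out])]
    exact hp.out.le
  · refine (eLpNorm_le_eLpNorm_mul_rpow_measure_univ hp1 v.memLp_fn.1).trans ?_
    gcongr
    have h1 : ‖v.1.fst‖ₑ ≤ ‖v.1‖ₑ := WithLp.enorm_fst_le _ _
    rw [Lp.enorm_def, ← ofReal_norm] at h1
    exact h1
  · refine (eLpNorm_le_eLpNorm_mul_rpow_measure_univ hp1 v.memLp_grad.1).trans ?_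
    gcongr
    have h1 : ‖v.1.snd‖ₑ ≤ ‖v.1‖ₑ := WithLp.enorm_snd_le _ _
    rw [Lp.enorm_def, ← ofReal_norm] at h1
    exact h1

/-- **Rellich's theorem**: bounded sequences in `W^{1,p}_0(Ω)` have subsequences converging in
`L^1(Ω)`. -/
lemma W0.exists_subseq_tendsto_eLpNorm_one {p : ℝ} [hp : Fact (1 < p)]
    (hΩb : Bornology.IsBounded Ω)
    {u : ℕ → W0 Ω p} {M : ℝ} (hu : ∀ j, ‖u j‖ ≤ M) :
    ∃ (k : ℕ → ℕ) (f : RN N → ℝ), StrictMono k ∧ MemLp f 1 (volume.restrict Ω) ∧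
      Tendsto (fun j => eLpNorm ((u (k j)).fn - f) 1 (volume.restrict Ω)) atTop (𝓝 0) := by
  have : IsFiniteMeasure (volume.restrict Ω) := ⟨by simpa using hΩb.measure_lt_top⟩
  obtain ⟨V, hVt, hfst, hsnd⟩ := W0.exists_eLpNorm_one_le (p := p) hΩb
  -- Each u j is replaced by a test function with error 1/(j + 1), which vanishes in the limit; the
  -- compactness argument then only concerns smooth functions.
  have happrox : ∀ j : ℕ, ∃ (v : W0 Ω p) (φ : RN N → ℝ), ‖u j - v‖ ≤ 1 / ((j : ℝ) + 1) ∧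
      IsTestFunction Ω φ ∧ v.fn =ᵐ[volume.restrict Ω] φ ∧
      v.grad =ᵐ[volume.restrict Ω] gradient φ := by
    intro j
    obtain ⟨U, φ, hU, hφ⟩ := (u j).exists_seq
    have h0 : (0 : ℝ) < 1 / ((j : ℝ) + 1) := by positivity
    obtain ⟨n, hn⟩ := ((Metric.tendsto_nhds.1 hU) _ h0).exists
    rw [dist_comm, dist_eq_norm] at hn
    exact ⟨U n, φ n, hn.le, hφ n⟩
  choose v φ huv hφ hvφ hvg using happrox
  have hv : ∀ j, ‖v j‖ ≤ M + 1 := by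
    intro j
    have h1 : 1 / ((j : ℝ) + 1) ≤ 1 := by
      rw [div_le_one (by positivity)]
      linarith [(Nat.cast_nonneg j : (0 : ℝ) ≤ j)]
    calc ‖v j‖ = ‖u j - (u j - v j)‖ := by rw [sub_sub_cancel]
      _ ≤ ‖u j‖ + ‖u j - v j‖ := norm_sub_le _ _
      _ ≤ M + 1 := add_le_add (hu j) ((huv j).trans h1)
  set D := ENNReal.ofReal (M + 1) * V with hD
  have hDt : D ≠ ⊤ := ENNReal.mul_ne_top ENNReal.ofReal_ne_top hVt
  have hb1 : ∀ j, ∫ x, |φ j x| ≤ D.toReal := by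
    intro j
    have h1 : eLpNorm (φ j) 1 volume ≤ D := by
      rw [← (hφ j).eLpNorm_restrict, ← eLpNorm_congr_ae (hvφ j)]
      exact (hfst _).trans (mul_le_mul' (ENNReal.ofReal_le_ofReal (hv j)) le_rfl)
    rw [eLpNorm_one_eq_lintegral_enorm] at h1
    have h2 := integral_norm_eq_lintegral_enorm (μ := volume)
      (hφ j).smooth.continuous.aestronglyMeasurable
    simp only [Real.norm_eq_abs] at h2
    rw [h2]
    exact ENNReal.toReal_mono hDt h1
  have hb2 : ∀ j, ∫⁻ x, ‖fderiv ℝ (φ j) x‖ₑ ≤ D := by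
    intro j
    rw [← eLpNorm_one_eq_lintegral_enorm, ← (hφ j).eLpNorm_gradient_restrict,
      ← eLpNorm_congr_ae (hvg j)]
    exact (hsnd _).trans (mul_le_mul' (ENNReal.ofReal_le_ofReal (hv j)) le_rfl)
  obtain ⟨k, hk, hcau⟩ := exists_subseq_cauchy_of_isTestFunction hΩb hφ hb1 hDt hb2
  have hmem : ∀ j, MemLp (φ (k j)) 1 (volume.restrict Ω) := fun j => (hφ _).memLp _ _
  have hcs : CauchySeq fun j => (hmem j).toLp (φ (k j)) := by
    rw [Lp.cauchySeq_Lp_iff_cauchySeq_eLpNorm]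
    refine hcau.congr fun n => eLpNorm_congr_ae ?_
    filter_upwards [(hmem n.1).coeFn_toLp, (hmem n.2).coeFn_toLp] with x h1 h2
    simp only [Pi.sub_apply, h1, h2]
  obtain ⟨f, hf⟩ := cauchySeq_tendsto_of_complete hcs
  rw [Lp.tendsto_Lp_iff_tendsto_eLpNorm'] at hf
  refine ⟨k, f, hk, Lp.memLp f, ?_⟩
  have hsmall : Tendsto (fun j : ℕ => ENNReal.ofReal (1 / (((k j : ℕ) : ℝ) + 1)) * V) atTop
      (𝓝 0) := by
    have := ENNReal.Tendsto.mul_const (b := V)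
      (ENNReal.tendsto_ofReal (tendsto_one_div_add_atTop_nhds_zero_nat (𝕜 := ℝ)))
      (Or.inr hVt)
    simpa [Function.comp_def] using this.comp hk.tendsto_atTop
  refine tendsto_of_tendsto_of_tendsto_of_le_of_le tendsto_const_nhds
    (by simpa using hsmall.add hf) (fun _ => zero_le) fun j => ?_
  calc eLpNorm ((u (k j)).fn - ⇑f) 1 (volume.restrict Ω)
      = eLpNorm ((u (k j) - v (k j)).fn + (⇑((hmem j).toLp (φ (k j))) - ⇑f)) 1
          (volume.restrict Ω) := by
        refine eLpNorm_congr_ae ?_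
        filter_upwards [W0.fn_sub (u (k j)) (v (k j)), hvφ (k j), (hmem j).coeFn_toLp]
          with x h1 h2 h3
        simp only [Pi.add_apply, Pi.sub_apply, h1, h2, h3]
        ring
    _ ≤ _ := eLpNorm_add_le (W0.memLp_fn _).1 ((Lp.memLp _).1.sub (Lp.memLp f).1) le_rfl
    _ ≤ _ := by
        refine add_le_add ((hfst _).trans ?_) le_rfl
        exact mul_le_mul' (ENNReal.ofReal_le_ofReal ((huv _).trans_eq (one_div _))) le_rfl

end Rellich

/-! ### The energy functional is of class `C^1` -/

section Energy

lemma exists_hasFDerivAt_integral_norm_rpow_comp {α : Type*} [MeasurableSpace α] {μ : Measure α}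
    {E : Type*} [NormedAddCommGroup E] [InnerProductSpace ℝ E] {X : Type*} [NormedAddCommGroup X]
    [NormedSpace ℝ X] {r : ℝ} (hr : 1 < r) [Fact (1 ≤ ENNReal.ofReal r)]
    (A : X →L[ℝ] Lp E (ENNReal.ofReal r) μ) {f : X → α → E} (hf : ∀ w, A w =ᵐ[μ] f w) :
    ∃ F' : X → X →L[ℝ] ℝ, Continuous F' ∧
      (∀ w, HasFDerivAt (fun w => ∫ x, ‖f w x‖ ^ r ∂μ) (F' w) w) ∧
      ∀ w h, F' w h = r * ∫ x, inner ℝ (powMap r (f w x)) (f h x) ∂μ := by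
  obtain ⟨Φ', hc, hd, hv⟩ := exists_hasFDerivAt_integral_norm_rpow (μ := μ) (E := E) hr
  refine ⟨fun w => (Φ' (A w)).comp A, (hc.comp A.continuous).clm_comp continuous_const,
    fun w => ?_, fun w h => ?_⟩
  · have h1 := (hd (A w)).comp w A.hasFDerivAt
    convert! h1 using 1
    funext z
    refine integral_congr_ae ?_
    filter_upwards [hf z] with x hx
    rw [hx]
  · rw [ContinuousLinearMap.comp_apply, hv]
    congr 1
    refine integral_congr_ae ?_
    filter_upwards [hf w, hf h] with x h1 h2
    rw [h1, h2]

lemma exists_hasFDerivAt_integral_rpow_mul_rpow_comp {α : Type*} [MeasurableSpace α]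
    {μ : Measure α} {X : Type*} [NormedAddCommGroup X] [NormedSpace ℝ X] {a b s t : ℝ}
    (ha : 1 < a) (hb : 1 < b) (hs : 1 < s) (ht : 1 < t) (hst : a / s + b / t = 1)
    [Fact (1 ≤ ENNReal.ofReal s)] [Fact (1 ≤ ENNReal.ofReal t)]
    (A : X →L[ℝ] Lp ℝ (ENNReal.ofReal s) μ) (B : X →L[ℝ] Lp ℝ (ENNReal.ofReal t) μ)
    {f g : X → α → ℝ} (hf : ∀ w, A w =ᵐ[μ] f w) (hg : ∀ w, B w =ᵐ[μ] g w) :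
    ∃ F' : X → X →L[ℝ] ℝ, Continuous F' ∧
      (∀ w, HasFDerivAt (fun w => ∫ x, |f w x| ^ a * |g w x| ^ b ∂μ) (F' w) w) ∧
      ∀ w h, F' w h = a * (∫ x, powMap a (f w x) * |g w x| ^ b * f h x ∂μ)
        + b * ∫ x, |f w x| ^ a * powMap b (g w x) * g h x ∂μ := by
  obtain ⟨Ψ', hc, hd, hv⟩ := exists_hasFDerivAt_integral_rpow_mul_rpow (μ := μ) ha hb hs ht hst
  refine ⟨fun w => (Ψ' (A.prod B w)).comp (A.prod B),
    (hc.comp (A.prod B).continuous).clm_comp continuous_const, fun w => ?_, fun w h => ?_⟩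
  · have h1 := (hd (A.prod B w)).comp w (A.prod B).hasFDerivAt
    convert! h1 using 1
    funext z
    refine integral_congr_ae ?_
    filter_upwards [hf z, hg z] with x h1 h2
    simp only [ContinuousLinearMap.prod_apply, h1, h2]
  · rw [ContinuousLinearMap.comp_apply, hv]
    congr 2
    · refine integral_congr_ae ?_
      filter_upwards [hf w, hg w, hf h] with x h1 h2 h3
      simp only [ContinuousLinearMap.prod_apply, h1, h2, h3]
    · refine integral_congr_ae ?_
      filter_upwards [hf w, hg w, hg h] with x h1 h2 h3
      simp only [ContinuousLinearMap.prod_apply, h1, h2, h3]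

lemma exists_hasFDerivAt_add_mul {X : Type*} [NormedAddCommGroup X] [NormedSpace ℝ X]
    {f g : X → ℝ} {D G : X → X →L[ℝ] ℝ} (hD : Continuous D) (hG : Continuous G)
    (hf : ∀ w, HasFDerivAt f (D w) w) (hg : ∀ w, HasFDerivAt g (G w) w) (c : ℝ) :
    ∃ H : X → X →L[ℝ] ℝ, Continuous H ∧ (∀ w, HasFDerivAt (fun w => f w + c * g w) (H w) w) ∧
      ∀ w h, H w h = D w h + c * G w h := by
  have h1 : Continuous fun w => c • G w := hG.const_smul c
  refine ⟨fun w => D w + c • G w, hD.add h1, fun w => ?_, fun w h => rfl⟩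
  have h2 : HasFDerivAt (fun w => c * g w) (c • G w) w := (hg w).const_mul c
  exact (hf w).add h2

lemma exists_hasFDerivAt_combination {X : Type*} [NormedAddCommGroup X] [NormedSpace ℝ X]
    {f₁ f₂ f₃ f₄ f₅ : X → ℝ} {D₁ D₂ D₃ D₄ D₅ : X → X →L[ℝ] ℝ} (hc₁ : Continuous D₁)
    (hc₂ : Continuous D₂) (hc₃ : Continuous D₃) (hc₄ : Continuous D₄) (hc₅ : Continuous D₅)
    (h₁ : ∀ w, HasFDerivAt f₁ (D₁ w) w) (h₂ : ∀ w, HasFDerivAt f₂ (D₂ w) w)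
    (h₃ : ∀ w, HasFDerivAt f₃ (D₃ w) w) (h₄ : ∀ w, HasFDerivAt f₄ (D₄ w) w)
    (h₅ : ∀ w, HasFDerivAt f₅ (D₅ w) w) (c₁ c₂ c₃ c₄ c₅ : ℝ) :
    ∃ D : X → X →L[ℝ] ℝ, Continuous D ∧
      (∀ w, HasFDerivAt (fun w => c₁ * f₁ w + c₂ * f₂ w - c₃ * f₃ w - c₄ * f₄ w - c₅ * f₅ w)
        (D w) w) ∧
      ∀ w h, D w h = c₁ * D₁ w h + c₂ * D₂ w h - c₃ * D₃ w h - c₄ * D₄ w h - c₅ * D₅ w h := by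
  have h0 : ∀ w : X, HasFDerivAt (fun _ => (0 : ℝ)) (0 : X →L[ℝ] ℝ) w :=
    fun w => hasFDerivAt_const _ _
  obtain ⟨G₁, hG₁, g₁, e₁⟩ := exists_hasFDerivAt_add_mul continuous_const hc₁ h0 h₁ c₁
  obtain ⟨G₂, hG₂, g₂, e₂⟩ := exists_hasFDerivAt_add_mul hG₁ hc₂ g₁ h₂ c₂
  obtain ⟨G₃, hG₃, g₃, e₃⟩ := exists_hasFDerivAt_add_mul hG₂ hc₃ g₂ h₃ (-c₃)
  obtain ⟨G₄, hG₄, g₄, e₄⟩ := exists_hasFDerivAt_add_mul hG₃ hc₄ g₃ h₄ (-c₄)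
  obtain ⟨G₅, hG₅, g₅, e₅⟩ := exists_hasFDerivAt_add_mul hG₄ hc₅ g₄ h₅ (-c₅)
  have key : (fun w => c₁ * f₁ w + c₂ * f₂ w - c₃ * f₃ w - c₄ * f₄ w - c₅ * f₅ w) = fun w =>
      0 + c₁ * f₁ w + c₂ * f₂ w + -c₃ * f₃ w + -c₄ * f₄ w + -c₅ * f₅ w := by
    funext w
    ring
  rw [key]
  refine ⟨G₅, hG₅, g₅, fun w h => ?_⟩
  rw [e₅, e₄, e₃, e₂, e₁, zero_apply]
  ring

variable {N : ℕ} {Ω : Set (RN N)} {p q : ℝ} [hp : Fact (1 < p)] [hq : Fact (1 < q)]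

lemma energy_eq (hΩb : Bornology.IsBounded Ω) (hpN : p < N) (hqN : q < N) (a b lam : ℝ)
    (w : W Ω p q) :
    energy Ω p q a b lam w = 1 / p * (∫ x in Ω, ‖w.fst.grad x‖ ^ p)
      + 1 / q * (∫ x in Ω, ‖w.snd.grad x‖ ^ q)
      - lam / (a + b) * (∫ x in Ω, |w.fst.fn x| ^ a * |w.snd.fn x| ^ b)
      - 1 / critExp N p * (∫ x in Ω, ‖w.fst.fn x‖ ^ critExp N p)
      - 1 / critExp N q * (∫ x in Ω, ‖w.snd.fn x‖ ^ critExp N q) := by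
  have hp0 : 0 < p := by linarith [hp.out]
  have hq0 : 0 < q := by linarith [hq.out]
  have hpc : 0 < critExp N p := hp0.trans (lt_critExp hpN)
  have hqc : 0 < critExp N q := hq0.trans (lt_critExp hqN)
  have h1 := integrable_norm_rpow_of_memLp hp0 w.fst.memLp_grad
  have h2 := integrable_norm_rpow_of_memLp hq0 w.snd.memLp_grad
  have h3 := integrable_norm_rpow_of_memLp hpc (w.fst.memLp_fn_critExp hΩb hpN)
  have h4 := integrable_norm_rpow_of_memLp hqc (w.snd.memLp_fn_critExp hΩb hqN)
  simp only [Real.norm_eq_abs] at h3 h4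
  rw [energy, integral_add (h1.const_mul _) (h2.const_mul _),
    integral_add (h3.const_mul _) (h4.const_mul _), integral_const_mul, integral_const_mul,
    integral_const_mul, integral_const_mul]
  simp only [Real.norm_eq_abs]
  ring

/-- The derivative of the energy at `w` in the direction `h`. -/
def energyDeriv (a b lam : ℝ) (w h : W Ω p q) : ℝ :=
  (∫ x in Ω, inner ℝ (powMap p (w.fst.grad x)) (h.fst.grad x))
    + (∫ x in Ω, inner ℝ (powMap q (w.snd.grad x)) (h.snd.grad x))
    - lam / (a + b) * (a * (∫ x in Ω, powMap a (w.fst.fn x) * |w.snd.fn x| ^ b * h.fst.fn x)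
        + b * ∫ x in Ω, |w.fst.fn x| ^ a * powMap b (w.snd.fn x) * h.snd.fn x)
    - (∫ x in Ω, inner ℝ (powMap (critExp N p) (w.fst.fn x)) (h.fst.fn x))
    - ∫ x in Ω, inner ℝ (powMap (critExp N q) (w.snd.fn x)) (h.snd.fn x)

set_option maxHeartbeats 1600000 in
/-- The energy, pulled back along bounded operators into the two Sobolev spaces. -/
lemma exists_hasFDerivAt_energy_comp {X : Type*} [NormedAddCommGroup X] [NormedSpace ℝ X]
    (F : X →L[ℝ] W0 Ω p) (S : X →L[ℝ] W0 Ω q)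
    (hΩb : Bornology.IsBounded Ω) (hpN : p < N) (hqN : q < N) {a b : ℝ}
    (ha : 1 < a) (hb : 1 < b) {p₀ q₀ : ℝ} (hp₀ : 1 < p₀) (hp₀' : p₀ < critExp N p)
    (hq₀ : 1 < q₀) (hq₀' : q₀ < critExp N q) (hab : a / p₀ + b / q₀ = 1) (lam : ℝ) :
    ∃ D : X → X →L[ℝ] ℝ, Continuous D ∧
      (∀ w, HasFDerivAt (fun w => energy Ω p q a b lam (WithLp.toLp 1 (F w, S w))) (D w) w) ∧
      ∀ w h, D w h = energyDeriv a b lam (WithLp.toLp 1 (F w, S w))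
        (WithLp.toLp 1 (F h, S h)) := by
  have hp0 : 0 < p := by linarith [hp.out]
  have hq0 : 0 < q := by linarith [hq.out]
  have hpc : 1 < critExp N p := hp.out.trans (lt_critExp hpN)
  have hqc : 1 < critExp N q := hq.out.trans (lt_critExp hqN)
  have fact : ∀ {r : ℝ}, 1 < r → Fact (1 ≤ ENNReal.ofReal r) := fun hr => ⟨by simpa using hr.le⟩
  have := fact hpc
  have := fact hqc
  have := fact hp₀
  have := fact hq₀
  obtain ⟨Ap, hAp⟩ := W0.exists_embedding (Ω := Ω) hΩb hpN (r := critExp N p) (by linarith)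
    (inv_critExp hpN).symm.le
  obtain ⟨Aq, hAq⟩ := W0.exists_embedding (Ω := Ω) hΩb hqN (r := critExp N q) (by linarith)
    (inv_critExp hqN).symm.le
  -- Besides the critical embeddings, those into L^{p₀} and L^{q₀} are needed, because the coupling
  -- integral has exact homogeneity 1 on that pair.
  obtain ⟨Bp, hBp⟩ := W0.exists_embedding (Ω := Ω) hΩb hpN (r := p₀) (by linarith)
    (by rw [← inv_critExp hpN]; exact inv_anti₀ (by linarith) hp₀'.le)
  obtain ⟨Bq, hBq⟩ := W0.exists_embedding (Ω := Ω) hΩb hqN (r := q₀) (by linarith)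
    (by rw [← inv_critExp hqN]; exact inv_anti₀ (by linarith) hq₀'.le)
  obtain ⟨D1, hc1, hd1, hv1⟩ := exists_hasFDerivAt_integral_norm_rpow_comp hp.out
    ((W0.gradL Ω p).comp F) (f := fun w => (F w).grad) (fun w => EventuallyEq.rfl)
  obtain ⟨D2, hc2, hd2, hv2⟩ := exists_hasFDerivAt_integral_norm_rpow_comp hq.out
    ((W0.gradL Ω q).comp S) (f := fun w => (S w).grad) (fun w => EventuallyEq.rfl)
  obtain ⟨D3, hc3, hd3, hv3⟩ := exists_hasFDerivAt_integral_rpow_mul_rpow_comp ha hb hp₀ hq₀ hab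
    (Bp.comp F) (Bq.comp S) (f := fun w => (F w).fn) (g := fun w => (S w).fn)
    (fun w => hBp (F w)) (fun w => hBq (S w))
  obtain ⟨D4, hc4, hd4, hv4⟩ := exists_hasFDerivAt_integral_norm_rpow_comp hpc
    (Ap.comp F) (f := fun w => (F w).fn) (fun w => hAp (F w))
  obtain ⟨D5, hc5, hd5, hv5⟩ := exists_hasFDerivAt_integral_norm_rpow_comp hqc
    (Aq.comp S) (f := fun w => (S w).fn) (fun w => hAq (S w))
  obtain ⟨D, hc, hd, hv⟩ := exists_hasFDerivAt_combination hc1 hc2 hc3 hc4 hc5 hd1 hd2 hd3 hd4 hd5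
    (1 / p) (1 / q) (lam / (a + b)) (1 / critExp N p) (1 / critExp N q)
  have key : (fun w => energy Ω p q a b lam (WithLp.toLp 1 (F w, S w))) = fun w =>
      1 / p * (∫ x in Ω, ‖(F w).grad x‖ ^ p) + 1 / q * (∫ x in Ω, ‖(S w).grad x‖ ^ q)
      - lam / (a + b) * (∫ x in Ω, |(F w).fn x| ^ a * |(S w).fn x| ^ b)
      - 1 / critExp N p * (∫ x in Ω, ‖(F w).fn x‖ ^ critExp N p)
      - 1 / critExp N q * (∫ x in Ω, ‖(S w).fn x‖ ^ critExp N q) :=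
    funext fun w => energy_eq hΩb hpN hqN a b lam _
  rw [key]
  refine ⟨D, hc, hd, fun w h => ?_⟩
  rw [hv, hv1, hv2, hv3, hv4, hv5]
  have e : ∀ r I : ℝ, 0 < r → 1 / r * (r * I) = I := fun r I hr => by field_simp
  rw [e p _ hp0, e q _ hq0, e _ _ (by linarith : 0 < critExp N p),
    e _ _ (by linarith : 0 < critExp N q)]
  rfl

lemma contDiff_energy (hΩb : Bornology.IsBounded Ω) (hpN : p < N) (hqN : q < N) {a b : ℝ}
    (ha : 1 < a) (hb : 1 < b) {p₀ q₀ : ℝ} (hp₀ : 1 < p₀) (hp₀' : p₀ < critExp N p)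
    (hq₀ : 1 < q₀) (hq₀' : q₀ < critExp N q) (hab : a / p₀ + b / q₀ = 1) (lam : ℝ) :
    ContDiff ℝ 1 (energy Ω p q a b lam) ∧
      ∀ w h, fderiv ℝ (energy Ω p q a b lam) w h = energyDeriv a b lam w h := by
  obtain ⟨D, hc, hd, hv⟩ := exists_hasFDerivAt_energy_comp (X := W Ω p q)
    (WithLp.fstL 1 ℝ (W0 Ω p) (W0 Ω q)) (WithLp.sndL 1 ℝ (W0 Ω p) (W0 Ω q)) hΩb hpN hqN ha hb
    hp₀ hp₀' hq₀ hq₀' hab lam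
  have hd' : ∀ w, HasFDerivAt (energy Ω p q a b lam) (D w) w := hd
  refine ⟨contDiff_one_iff_hasFDerivAt.2 ⟨D, hc, hd'⟩, fun w h => ?_⟩
  rw [(hd' w).fderiv]
  exact hv w h

end Energy

/-! ### Almost everywhere convergence of gradients, and closedness of `W^{1,p}_0` -/

section Gradients

lemma integrable_inner_powMap {α : Type*} [MeasurableSpace α] {μ : Measure α} {E : Type*}
    [NormedAddCommGroup E] [InnerProductSpace ℝ E] {f g : α → E} {r : ℝ} (hr : 1 < r)
    (hf : MemLp f (ENNReal.ofReal r) μ) (hg : MemLp g (ENNReal.ofReal r) μ) :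
    Integrable (fun x => inner ℝ (powMap r (f x)) (g x)) μ := by
  obtain ⟨C, -, hC⟩ := exists_rpow_sub_one_mul_le hr one_pos
  have h0 : 0 < r := by linarith
  refine Integrable.mono' (((integrable_norm_rpow_of_memLp h0 hf).const_mul 1).add
    ((integrable_norm_rpow_of_memLp h0 hg).const_mul C))
    (((continuous_powMap hr).comp_aestronglyMeasurable hf.1).inner hg.1) ?_
  refine Eventually.of_forall fun x => ?_
  calc ‖inner ℝ (powMap r (f x)) (g x)‖ ≤ ‖powMap r (f x)‖ * ‖g x‖ := norm_inner_le_norm _ _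
    _ = ‖f x‖ ^ (r - 1) * ‖g x‖ := by rw [norm_powMap hr]
    _ ≤ _ := hC _ _ (norm_nonneg _) (norm_nonneg _)

lemma exists_le_mul_rpow_add {r : ℝ} (hr : 1 < r) {η : ℝ} (hη : 0 < η) :
    ∃ C, 0 ≤ C ∧ ∀ t : ℝ, 0 ≤ t → t ≤ η * t ^ r + C := by
  refine ⟨η⁻¹ ^ (r - 1)⁻¹, by positivity, fun t ht => ?_⟩
  rcases le_total t (η⁻¹ ^ (r - 1)⁻¹) with h | h
  · have : 0 ≤ η * t ^ r := by positivity
    linarith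
  · have h1 : η⁻¹ ≤ t ^ (r - 1) := by
      have := Real.rpow_le_rpow (by positivity) h (by linarith : 0 ≤ r - 1)
      rwa [← Real.rpow_mul (by positivity), inv_mul_cancel₀ (by linarith), Real.rpow_one] at this
    have h2 : 1 ≤ η * t ^ (r - 1) := by
      rw [inv_le_iff_one_le_mul₀ hη] at h1
      linarith
    have h3 : t ≤ η * t ^ r := by
      rw [← rpow_sub_one_mul ht hr, ← mul_assoc]
      exact le_mul_of_one_le_left ht h2
    have : 0 ≤ η⁻¹ ^ (r - 1)⁻¹ := by positivity
    linarith

variable {N : ℕ} {Ω : Set (RN N)} {p : ℝ} [hp : Fact (1 < p)]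

lemma W0.integral_norm_grad_rpow_le (u : W0 Ω p) : ∫ x in Ω, ‖u.grad x‖ ^ p ≤ ‖u‖ ^ p := by
  rw [W0.norm_rpow]
  have : 0 ≤ ∫ x in Ω, ‖u.fn x‖ ^ p := integral_nonneg fun x => by positivity
  linarith

/-- Testing the difference of two almost solutions with a truncation of `u - v`. -/
lemma W0.integral_truncDeriv_mul_le {u v : W0 Ω p} {K ε ε' δ : ℝ} (hδ : 0 < δ)
    (hε : 0 ≤ ε) (hε' : 0 ≤ ε')
    (hu : ∀ (h : W0 Ω p) (τ : ℝ), 0 ≤ τ → (∀ᵐ x ∂volume.restrict Ω, |h.fn x| ≤ τ) →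
      |∫ x in Ω, inner ℝ (powMap p (u.grad x)) (h.grad x)| ≤ K * τ + ε * ‖h‖)
    (hv : ∀ (h : W0 Ω p) (τ : ℝ), 0 ≤ τ → (∀ᵐ x ∂volume.restrict Ω, |h.fn x| ≤ τ) →
      |∫ x in Ω, inner ℝ (powMap p (v.grad x)) (h.grad x)| ≤ K * τ + ε' * ‖h‖) :
    Integrable (fun x => truncDeriv δ (u.fn x - v.fn x) *
      inner ℝ (powMap p (u.grad x) - powMap p (v.grad x)) (u.grad x - v.grad x))
      (volume.restrict Ω) ∧
    ∫ x in Ω, truncDeriv δ (u.fn x - v.fn x) *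
      inner ℝ (powMap p (u.grad x) - powMap p (v.grad x)) (u.grad x - v.grad x)
      ≤ 4 * K * δ + (ε + ε') * ‖u - v‖ := by
  -- The test function is bounded by 2 * δ and enters both almost equations, whence the total 4 * K
  -- * δ; its norm does not exceed ‖u - v‖.
  obtain ⟨h, h1, h2, h3⟩ := (u - v).exists_trunc hδ
  have hτ : ∀ᵐ x ∂volume.restrict Ω, |h.fn x| ≤ 2 * δ := by
    filter_upwards [h1] with x hx
    rw [hx]
    exact abs_trunc_le hδ _
  have iu := integrable_inner_powMap hp.out u.memLp_grad h.memLp_grad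
  have iv := integrable_inner_powMap hp.out v.memLp_grad h.memLp_grad
  have key : (fun x => truncDeriv δ (u.fn x - v.fn x) *
      inner ℝ (powMap p (u.grad x) - powMap p (v.grad x)) (u.grad x - v.grad x))
      =ᵐ[volume.restrict Ω] fun x => inner ℝ (powMap p (u.grad x)) (h.grad x)
        - inner ℝ (powMap p (v.grad x)) (h.grad x) := by
    filter_upwards [h2, W0.fn_sub u v, W0.grad_sub u v] with x e1 e2 e3
    rw [e1, e2, e3, ← inner_sub_left, inner_smul_right]
    rfl
  refine ⟨(iu.sub iv).congr key.symm, ?_⟩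
  rw [integral_congr_ae key, integral_sub iu iv]
  have a1 := (abs_le.1 (hu h (2 * δ) (by positivity) hτ)).2
  have a2 := (abs_le.1 (hv h (2 * δ) (by positivity) hτ)).1
  have a3 := mul_le_mul_of_nonneg_left h3 hε
  have a4 := mul_le_mul_of_nonneg_left h3 hε'
  linarith

/-- With weight ρ = `truncDeriv` of u_i - u_j, write the gradient difference as its ρ-part plus its
(1 - ρ)-part. Quantitative monotonicity bounds the first by the pairing tested with the truncation,
and 1 - ρ ≤ |u_i - u_j| / δ controls the second. The errors not multiplied by A are made smaller
than e by choosing η first and then δ. -/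
lemma W0.exists_integral_norm_grad_sub_le (hΩb : Bornology.IsBounded Ω) {u : ℕ → W0 Ω p}
    {ε : ℕ → ℝ} {K M : ℝ} (hε : ∀ j, 0 ≤ ε j) (hK : 0 ≤ K) (hM : ∀ j, ‖u j‖ ≤ M)
    (hu : ∀ j (h : W0 Ω p) (τ : ℝ), 0 ≤ τ → (∀ᵐ x ∂volume.restrict Ω, |h.fn x| ≤ τ) →
      |∫ x in Ω, inner ℝ (powMap p ((u j).grad x)) (h.grad x)| ≤ K * τ + ε j * ‖h‖)
    {e : ℝ} (he : 0 < e) : ∃ A, 0 ≤ A ∧ ∀ i j, ∫ x in Ω, ‖(u i).grad x - (u j).grad x‖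
      ≤ e + A * (ε i + ε j + ∫ x in Ω, ‖(u i).fn x - (u j).fn x‖) := by
  have : IsFiniteMeasure (volume.restrict Ω) := ⟨by simpa using hΩb.measure_lt_top⟩
  have hp0 : 0 < p := by linarith [hp.out]
  have hM0 : 0 ≤ M := (norm_nonneg _).trans (hM 0)
  set m := (volume.restrict Ω).real Set.univ with hm
  have hm0 : 0 ≤ m := measureReal_nonneg
  -- The total mass multiplying η after integration: m from the constant, and 2η from two estimates
  -- times the bound 2 * M ^ p for both gradients. The final 1 ensures Q > 0.
  set Q := m + 4 * M ^ p + 1 with hQ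
  have hQ0 : 0 < Q := by positivity
  obtain ⟨B, hB0, hB⟩ := exists_norm_sub_le_powMap (E := RN N) hp.out
    (by positivity : 0 < e / (2 * Q))
  obtain ⟨C, hC0, hC⟩ := exists_le_mul_rpow_add hp.out (by positivity : 0 < e / (2 * Q))
  set η := e / (2 * Q) with hη
  have hη0 : 0 < η := by positivity
  have hηQ : η * Q = e / 2 := by rw [hη]; field_simp
  -- Makes the truncation cost B * (4 * K * δ) at most e / 2.
  set δ := e / (2 * (B * (4 * K) + 1)) with hδ
  have hδ0 : 0 < δ := by positivity
  have hBδ : B * (4 * K * δ) ≤ e / 2 := by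
    have : δ * (B * (4 * K) + 1) = e / 2 := by rw [hδ]; field_simp
    nlinarith
  refine ⟨B * (2 * M) + 2 * C / δ, by positivity, fun i j => ?_⟩
  obtain ⟨iT, hT⟩ := W0.integral_truncDeriv_mul_le hδ0 (hε i) (hε j) (hu i) (hu j)
  have ifn : Integrable (fun x => ‖(u i).fn x - (u j).fn x‖) (volume.restrict Ω) :=
    (((u i).memLp_fn.sub (u j).memLp_fn).integrable Fact.out).norm
  have igrad : Integrable (fun x => ‖(u i).grad x - (u j).grad x‖) (volume.restrict Ω) :=
    (((u i).memLp_grad.sub (u j).memLp_grad).integrable Fact.out).norm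
  have ii := integrable_norm_rpow_of_memLp hp0 (u i).memLp_grad
  have ij := integrable_norm_rpow_of_memLp hp0 (u j).memLp_grad
  have pt : ∀ x, ‖(u i).grad x - (u j).grad x‖ ≤
      (η + (2 * η) * (‖(u i).grad x‖ ^ p + ‖(u j).grad x‖ ^ p))
      + (B * (truncDeriv δ ((u i).fn x - (u j).fn x) *
        inner ℝ (powMap p ((u i).grad x) - powMap p ((u j).grad x))
          ((u i).grad x - (u j).grad x)) + 2 * C / δ * ‖(u i).fn x - (u j).fn x‖) := by
    intro x
    have b1 := hB ((u i).grad x) ((u j).grad x)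
    have b2 := hC _ (norm_nonneg ((u i).grad x))
    have b3 := hC _ (norm_nonneg ((u j).grad x))
    have b4 := norm_sub_le ((u i).grad x) ((u j).grad x)
    have b5 := one_sub_truncDeriv_le hδ0 ((u i).fn x - (u j).fn x)
    have b6 := truncDeriv_nonneg δ ((u i).fn x - (u j).fn x)
    have b7 := truncDeriv_le_one δ ((u i).fn x - (u j).fn x)
    set ρ := truncDeriv δ ((u i).fn x - (u j).fn x)
    set D := inner ℝ (powMap p ((u i).grad x) - powMap p ((u j).grad x))
          ((u i).grad x - (u j).grad x)
    set S := ‖(u i).grad x‖ ^ p + ‖(u j).grad x‖ ^ p with hS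
    have hS0 : 0 ≤ S := by positivity
    set t := ‖(u i).grad x - (u j).grad x‖
    have c1 : ρ * t ≤ ρ * (η * (1 + S) + B * D) :=
      mul_le_mul_of_nonneg_left (by rw [hS]; linarith) b6
    have c2 : (1 - ρ) * t ≤ (1 - ρ) * (η * S + 2 * C) :=
      mul_le_mul_of_nonneg_left (by rw [hS]; linarith) (by linarith)
    have c3 : ρ * (η * (1 + S)) ≤ η * (1 + S) := mul_le_of_le_one_left (by positivity) b7
    have c4 : (1 - ρ) * (η * S) ≤ η * S := mul_le_of_le_one_left (by positivity) (by linarith)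
    have c5 : (1 - ρ) * (2 * C) ≤ 2 * C / δ * ‖(u i).fn x - (u j).fn x‖ := by
      rw [Real.norm_eq_abs]
      calc (1 - ρ) * (2 * C) ≤ |(u i).fn x - (u j).fn x| / δ * (2 * C) :=
            mul_le_mul_of_nonneg_right b5 (by positivity)
        _ = _ := by ring
    have : t = ρ * t + (1 - ρ) * t := by ring
    nlinarith
  have is : Integrable (fun x => ‖(u i).grad x‖ ^ p + ‖(u j).grad x‖ ^ p)
      (volume.restrict Ω) := ii.add ij
  have i1 : Integrable (fun x => (η + (2 * η) * (‖(u i).grad x‖ ^ p + ‖(u j).grad x‖ ^ p)))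
      (volume.restrict Ω) := (integrable_const _).add (is.const_mul _)
  have i2 : Integrable (fun x => B * (truncDeriv δ ((u i).fn x - (u j).fn x) *
        inner ℝ (powMap p ((u i).grad x) - powMap p ((u j).grad x))
          ((u i).grad x - (u j).grad x)) + 2 * C / δ * ‖(u i).fn x - (u j).fn x‖)
      (volume.restrict Ω) := (iT.const_mul _).add (ifn.const_mul _)
  have main := integral_mono igrad (i1.add i2) pt
  simp only [Pi.add_apply] at main
  rw [integral_add i1 i2, integral_add (integrable_const _) (is.const_mul _),
    integral_const_mul, integral_add ii ij, integral_add (iT.const_mul _) (ifn.const_mul _),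
    integral_const_mul, integral_const_mul, integral_const, smul_eq_mul] at main
  have hMp : ∀ l, ∫ x in Ω, ‖(u l).grad x‖ ^ p ≤ M ^ p := fun l =>
    (u l).integral_norm_grad_rpow_le.trans (Real.rpow_le_rpow (norm_nonneg _) (hM l) hp0.le)
  have hd : ‖u i - u j‖ ≤ 2 * M := (norm_sub_le _ _).trans (by linarith [hM i, hM j])
  have f1 : B * ((ε i + ε j) * ‖u i - u j‖) ≤ B * (2 * M) * (ε i + ε j) := by
    have := mul_le_mul_of_nonneg_left hd (add_nonneg (hε i) (hε j))
    nlinarith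
  have f2 := mul_le_mul_of_nonneg_left hT hB0
  have f3 : (2 * η) * ((∫ x in Ω, ‖(u i).grad x‖ ^ p) + ∫ x in Ω, ‖(u j).grad x‖ ^ p)
      ≤ (2 * η) * (2 * M ^ p) :=
    mul_le_mul_of_nonneg_left (by linarith [hMp i, hMp j]) (by positivity)
  have f4 : 0 ≤ ∫ x in Ω, ‖(u i).fn x - (u j).fn x‖ := integral_nonneg fun x => norm_nonneg _
  have f5 : 0 ≤ B * (2 * M) * ∫ x in Ω, ‖(u i).fn x - (u j).fn x‖ := by positivity
  have f6 : 0 ≤ 2 * C / δ * (ε i + ε j) := by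
    have := add_nonneg (hε i) (hε j)
    positivity
  have f7 : m * η + 2 * η * (2 * M ^ p) ≤ e / 2 := by
    rw [← hηQ, hQ]
    nlinarith
  linarith

lemma W0.exists_tendsto_eLpNorm_grad (hΩb : Bornology.IsBounded Ω) {u : ℕ → W0 Ω p}
    {ε : ℕ → ℝ} {K M : ℝ} (hε : ∀ j, 0 ≤ ε j) (hε0 : Tendsto ε atTop (𝓝 0)) (hK : 0 ≤ K)
    (hM : ∀ j, ‖u j‖ ≤ M)
    (hu : ∀ j (h : W0 Ω p) (τ : ℝ), 0 ≤ τ → (∀ᵐ x ∂volume.restrict Ω, |h.fn x| ≤ τ) →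
      |∫ x in Ω, inner ℝ (powMap p ((u j).grad x)) (h.grad x)| ≤ K * τ + ε j * ‖h‖)
    {f : RN N → ℝ} (hf : MemLp f 1 (volume.restrict Ω))
    (hlim : Tendsto (fun j => eLpNorm ((u j).fn - f) 1 (volume.restrict Ω)) atTop (𝓝 0)) :
    ∃ g : RN N → RN N, MemLp g 1 (volume.restrict Ω) ∧
      Tendsto (fun j => eLpNorm ((u j).grad - g) 1 (volume.restrict Ω)) atTop (𝓝 0) := by
  have : IsFiniteMeasure (volume.restrict Ω) := ⟨by simpa using hΩb.measure_lt_top⟩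
  have mfn : ∀ j, MemLp (u j).fn 1 (volume.restrict Ω) := fun j =>
    (u j).memLp_fn.mono_exponent Fact.out
  have mgrad : ∀ j, MemLp (u j).grad 1 (volume.restrict Ω) := fun j =>
    (u j).memLp_grad.mono_exponent Fact.out
  have cfn : CauchySeq fun j => (mfn j).toLp _ := by
    refine Tendsto.cauchySeq (x := hf.toLp f) ?_
    rwa [Lp.tendsto_Lp_iff_tendsto_eLpNorm'' _ mfn _ hf]
  have dfn : ∀ i j, dist ((mfn i).toLp _) ((mfn j).toLp _)
      = ∫ x in Ω, ‖(u i).fn x - (u j).fn x‖ := by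
    intro i j
    rw [dist_eq_norm, L1.norm_eq_integral_norm, ← MemLp.toLp_sub]
    refine integral_congr_ae ?_
    filter_upwards [((mfn i).sub (mfn j)).coeFn_toLp] with x hx
    rw [hx, Pi.sub_apply]
  have dgrad : ∀ i j, dist ((mgrad i).toLp _) ((mgrad j).toLp _)
      = ∫ x in Ω, ‖(u i).grad x - (u j).grad x‖ := by
    intro i j
    rw [dist_eq_norm, L1.norm_eq_integral_norm, ← MemLp.toLp_sub]
    refine integral_congr_ae ?_
    filter_upwards [((mgrad i).sub (mgrad j)).coeFn_toLp] with x hx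
    rw [hx, Pi.sub_apply]
  have cgrad : CauchySeq fun j => (mgrad j).toLp _ := by
    rw [Metric.cauchySeq_iff]
    intro e he
    obtain ⟨A, hA0, hA⟩ := W0.exists_integral_norm_grad_sub_le hΩb hε hK hM hu
      (by positivity : 0 < e / 2)
    have hκ : 0 < e / (8 * (A + 1)) := by positivity
    obtain ⟨n₁, hn₁⟩ := Metric.cauchySeq_iff.1 cfn _ hκ
    obtain ⟨n₂, hn₂⟩ := eventually_atTop.1 (hε0.eventually_lt_const hκ)
    refine ⟨max n₁ n₂, fun i hi j hj => ?_⟩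
    have a1 := hn₁ i ((le_max_left _ _).trans hi) j ((le_max_left _ _).trans hj)
    have a2 := hn₂ i ((le_max_right _ _).trans hi)
    have a3 := hn₂ j ((le_max_right _ _).trans hj)
    rw [dfn] at a1
    rw [dgrad]
    refine (hA i j).trans_lt ?_
    have a4 : A * (ε i + ε j + ∫ x in Ω, ‖(u i).fn x - (u j).fn x‖)
        ≤ A * (3 * (e / (8 * (A + 1)))) := mul_le_mul_of_nonneg_left (by linarith) hA0
    have a5 : (A + 1) * (e / (8 * (A + 1))) = e / 8 := by field_simp
    nlinarith
  obtain ⟨g, hg⟩ := cauchySeq_tendsto_of_complete cgrad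
  refine ⟨g, Lp.memLp g, ?_⟩
  have h1 := (Lp.tendsto_Lp_iff_tendsto_eLpNorm' _ _).1 hg
  refine h1.congr fun j => eLpNorm_congr_ae ?_
  filter_upwards [(mgrad j).coeFn_toLp] with x hx
  simp only [Pi.sub_apply, hx]

/-- `W^{1,p}_0` is closed under bounded almost everywhere convergence of pairs `(u, ∇u)`. -/
lemma W0.exists_of_tendsto_ae {u : ℕ → W0 Ω p} {M : ℝ} (hM : ∀ j, ‖u j‖ ≤ M)
    {f : RN N → ℝ} {g : RN N → RN N}
    (hf : ∀ᵐ x ∂volume.restrict Ω, Tendsto (fun j => (u j).fn x) atTop (𝓝 (f x)))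
    (hg : ∀ᵐ x ∂volume.restrict Ω, Tendsto (fun j => (u j).grad x) atTop (𝓝 (g x))) :
    ∃ v : W0 Ω p, v.fn =ᵐ[volume.restrict Ω] f ∧ v.grad =ᵐ[volume.restrict Ω] g := by
  have hp0 : 0 < p := by linarith [hp.out]
  have hMp : ∀ j, ‖u j‖ ^ p ≤ M ^ p := fun j =>
    Real.rpow_le_rpow (norm_nonneg _) (hM j) hp0.le
  have nn1 : ∀ w : PairSpace Ω p, 0 ≤ ∫ x in Ω, ‖w.fst x‖ ^ p := fun w =>
    integral_nonneg fun x => by positivity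
  have nn2 : ∀ w : PairSpace Ω p, 0 ≤ ∫ x in Ω, ‖w.snd x‖ ^ p := fun w =>
    integral_nonneg fun x => by positivity
  have mf := (memLp_of_tendsto_ae hp0 (fun j => (u j).memLp_fn) hf (C := M ^ p) fun j => by
    have := hMp j
    rw [(u j).norm_rpow] at this
    exact (le_add_of_nonneg_right (nn2 (u j).1)).trans this).1
  have mg := (memLp_of_tendsto_ae hp0 (fun j => (u j).memLp_grad) hg (C := M ^ p) fun j =>
    (u j).integral_norm_grad_rpow_le.trans (hMp j)).1
  let F : PairSpace Ω p := WithLp.toLp _ (mf.toLp f, mg.toLp g)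
  have eF1 : F.fst =ᵐ[volume.restrict Ω] f := mf.coeFn_toLp
  have eF2 : F.snd =ᵐ[volume.restrict Ω] g := mg.coeFn_toLp
  let h : ℕ → PairSpace Ω p := fun j => (u j).1 - F
  have hhM : ∀ j, ‖h j‖ ^ p ≤ (M + ‖F‖) ^ p := fun j =>
    Real.rpow_le_rpow (norm_nonneg _) ((norm_sub_le _ _).trans (add_le_add_left (hM j) _)) hp0.le
  have l1 : ∀ᵐ x ∂volume.restrict Ω, Tendsto (fun j => (h j).fst x) atTop (𝓝 0) := by
    have e : ∀ᵐ x ∂volume.restrict Ω, ∀ j, (h j).fst x = (u j).fn x - F.fst x :=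
      ae_all_iff.2 fun j => Lp.coeFn_sub _ _
    filter_upwards [hf, eF1, e] with x a1 a2 a3
    simp only [a3, a2]
    simpa using a1.sub_const (f x)
  have l2 : ∀ᵐ x ∂volume.restrict Ω, Tendsto (fun j => (h j).snd x) atTop (𝓝 0) := by
    have e : ∀ᵐ x ∂volume.restrict Ω, ∀ j, (h j).snd x = (u j).grad x - F.snd x :=
      ae_all_iff.2 fun j => Lp.coeFn_sub _ _
    filter_upwards [hg, eF2, e] with x a1 a2 a3
    simp only [a3, a2]
    simpa using a1.sub_const (g x)
  -- The Brezis–Lieb lemma, applied to both components, says ‖h n + s‖ ^ p - ‖h n‖ ^ p tends to ‖s‖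
  -- ^ p for every fixed s. This is the hypothesis of the Banach–Saks argument, with the extra 1 in
  -- M absorbing the error.
  have memF : F ∈ (testPairs Ω p).topologicalClosure := by
    refine mem_of_forall_exists_norm_add_rpow_le (h := h) (M := (M + ‖F‖) ^ p + 1)
      (testPairs Ω p).isClosed_topologicalClosure hp.out ?_ (fun n => ?_) fun s => ?_
    · have : 0 ≤ M := (norm_nonneg _).trans (hM 0)
      positivity
    · have : F + h n = (u n).1 := by simp [h]
      rw [this]
      exact (u n).2
    · have b1 := tendsto_integral_norm_add_rpow_sub hp.out (fun j => Lp.memLp (h j).fst)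
        (Lp.memLp s.fst) l1 (C := (M + ‖F‖) ^ p) fun j => by
          have := hhM j
          rw [pairSpace_norm_rpow] at this
          exact (le_add_of_nonneg_right (nn2 _)).trans this
      have b2 := tendsto_integral_norm_add_rpow_sub hp.out (fun j => Lp.memLp (h j).snd)
        (Lp.memLp s.snd) l2 (C := (M + ‖F‖) ^ p) fun j => by
          have := hhM j
          rw [pairSpace_norm_rpow] at this
          exact (le_add_of_nonneg_left (nn1 _)).trans this
      have b3 := b1.add b2
      rw [← pairSpace_norm_rpow] at b3
      obtain ⟨n, hn⟩ := (b3.eventually_lt_const (lt_add_one _)).exists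
      refine ⟨n, ?_⟩
      have e1 : ∫ x in Ω, ‖(h n + s).fst x‖ ^ p = ∫ x in Ω, ‖(h n).fst x + s.fst x‖ ^ p := by
        refine integral_congr_ae ?_
        filter_upwards [Lp.coeFn_add (h n).fst s.fst] with x hx
        rw [WithLp.add_fst, hx, Pi.add_apply]
      have e2 : ∫ x in Ω, ‖(h n + s).snd x‖ ^ p = ∫ x in Ω, ‖(h n).snd x + s.snd x‖ ^ p := by
        refine integral_congr_ae ?_
        filter_upwards [Lp.coeFn_add (h n).snd s.snd] with x hx
        rw [WithLp.add_snd, hx, Pi.add_apply]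
      have e3 := hhM n
      rw [pairSpace_norm_rpow] at e3
      rw [pairSpace_norm_rpow (h n + s), e1, e2]
      linarith
  exact ⟨⟨F, memF⟩, eF1, eF2⟩

end Gradients

/-! ### One equation of the system -/

section Component

variable {N : ℕ} {Ω : Set (RN N)} {p : ℝ} [hp : Fact (1 < p)]

/-- A bounded sequence of almost solutions has a subsequence that converges, with its gradients,
almost everywhere to an element of `W^{1,p}_0`. -/
lemma W0.exists_subseq_tendsto_ae (hΩb : Bornology.IsBounded Ω) {u : ℕ → W0 Ω p}
    {ε : ℕ → ℝ} {K M : ℝ} (hε : ∀ j, 0 ≤ ε j) (hε0 : Tendsto ε atTop (𝓝 0)) (hK : 0 ≤ K)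
    (hM : ∀ j, ‖u j‖ ≤ M)
    (hu : ∀ j (h : W0 Ω p) (τ : ℝ), 0 ≤ τ → (∀ᵐ x ∂volume.restrict Ω, |h.fn x| ≤ τ) →
      |∫ x in Ω, inner ℝ (powMap p ((u j).grad x)) (h.grad x)| ≤ K * τ + ε j * ‖h‖) :
    ∃ (k : ℕ → ℕ) (v : W0 Ω p), StrictMono k ∧
      (∀ᵐ x ∂volume.restrict Ω, Tendsto (fun j => (u (k j)).fn x) atTop (𝓝 (v.fn x))) ∧
      ∀ᵐ x ∂volume.restrict Ω, Tendsto (fun j => (u (k j)).grad x) atTop (𝓝 (v.grad x)) := by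
  obtain ⟨k₁, f, hk₁, hf, hlim⟩ := W0.exists_subseq_tendsto_eLpNorm_one hΩb hM
  obtain ⟨g, hg, hglim⟩ := W0.exists_tendsto_eLpNorm_grad hΩb (u := fun j => u (k₁ j))
    (fun j => hε (k₁ j)) (hε0.comp hk₁.tendsto_atTop) hK (fun j => hM (k₁ j))
    (fun j => hu (k₁ j)) hf hlim
  obtain ⟨k₂, hk₂, h2⟩ := (tendstoInMeasure_of_tendsto_eLpNorm one_ne_zero
    (fun j => (u (k₁ j)).memLp_fn.1) hf.1 hlim).exists_seq_tendsto_ae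
  obtain ⟨k₃, hk₃, h3⟩ := (tendstoInMeasure_of_tendsto_eLpNorm one_ne_zero
    (fun j => (u (k₁ (k₂ j))).memLp_grad.1) hg.1
    (hglim.comp hk₂.tendsto_atTop)).exists_seq_tendsto_ae
  have h2' : ∀ᵐ x ∂volume.restrict Ω,
      Tendsto (fun j => (u (k₁ (k₂ (k₃ j)))).fn x) atTop (𝓝 (f x)) := by
    filter_upwards [h2] with x hx using hx.comp hk₃.tendsto_atTop
  obtain ⟨v, hv1, hv2⟩ := W0.exists_of_tendsto_ae (fun j => hM (k₁ (k₂ (k₃ j)))) h2' h3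
  refine ⟨fun j => k₁ (k₂ (k₃ j)), v, hk₁.comp (hk₂.comp hk₃), ?_, ?_⟩
  · filter_upwards [h2', hv1] with x a1 a2
    rwa [a2]
  · filter_upwards [h3, hv2] with x a1 a2
    rwa [a2]

/-- The weak form of `-Δ_p u = c |u|^(a-2) |v|^b u + |u|^(p^*-2) u`, tested with `h`. -/
def W0.residual (a b c : ℝ) (u : W0 Ω p) (v : RN N → ℝ) (h : W0 Ω p) : ℝ :=
  (∫ x in Ω, inner ℝ (powMap p (u.grad x)) (h.grad x))
    - c * (∫ x in Ω, powMap a (u.fn x) * |v x| ^ b * h.fn x)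
    - ∫ x in Ω, inner ℝ (powMap (critExp N p) (u.fn x)) (h.fn x)

lemma W0.residual_zero (a b c : ℝ) (u : W0 Ω p) (v : RN N → ℝ) : W0.residual a b c u v 0 = 0 := by
  have e1 : ∫ x in Ω, inner ℝ (powMap p (u.grad x)) ((0 : W0 Ω p).grad x) = 0 := by
    refine integral_eq_zero_of_ae ?_
    filter_upwards [W0.grad_zero (Ω := Ω) (p := p)] with x hx
    simp [hx]
  have e2 : ∫ x in Ω, powMap a (u.fn x) * |v x| ^ b * (0 : W0 Ω p).fn x = 0 := by
    refine integral_eq_zero_of_ae ?_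
    filter_upwards [W0.fn_zero (Ω := Ω) (p := p)] with x hx
    simp [hx]
  have e3 : ∫ x in Ω, inner ℝ (powMap (critExp N p) (u.fn x)) ((0 : W0 Ω p).fn x) = 0 := by
    refine integral_eq_zero_of_ae ?_
    filter_upwards [W0.fn_zero (Ω := Ω) (p := p)] with x hx
    simp [hx]
  rw [W0.residual, e1, e2, e3]
  simp

lemma powMap_mul_self {s : ℝ} (hs : 1 < s) (x : ℝ) : powMap s x * x = |x| ^ s := by
  rw [← Real.norm_eq_abs, ← inner_powMap_self hs x]
  simp [mul_comm]

/-- Testing an equation with its own unknown produces the Nehari functional. -/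
lemma W0.residual_smul_self (hpN : p < N) {a : ℝ} (ha : 1 < a) (b c : ℝ) (u : W0 Ω p)
    (v : RN N → ℝ) (r : ℝ) : W0.residual a b c u v (r • u) = r * ((∫ x in Ω, ‖u.grad x‖ ^ p)
      - c * (∫ x in Ω, |u.fn x| ^ a * |v x| ^ b) - ∫ x in Ω, ‖u.fn x‖ ^ critExp N p) := by
  have hpc : 1 < critExp N p := hp.out.trans (lt_critExp hpN)
  have e1 : ∫ x in Ω, inner ℝ (powMap p (u.grad x)) ((r • u).grad x)
      = r * ∫ x in Ω, ‖u.grad x‖ ^ p := by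
    rw [← integral_const_mul]
    refine integral_congr_ae ?_
    filter_upwards [W0.grad_smul r u] with x hx
    rw [hx, Pi.smul_apply, inner_smul_right, inner_powMap_self hp.out]
  have e2 : ∫ x in Ω, powMap a (u.fn x) * |v x| ^ b * (r • u).fn x
      = r * ∫ x in Ω, |u.fn x| ^ a * |v x| ^ b := by
    rw [← integral_const_mul]
    refine integral_congr_ae ?_
    filter_upwards [W0.fn_smul r u] with x hx
    rw [hx, Pi.smul_apply, smul_eq_mul, ← powMap_mul_self ha]
    ring
  have e3 : ∫ x in Ω, inner ℝ (powMap (critExp N p) (u.fn x)) ((r • u).fn x)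
      = r * ∫ x in Ω, ‖u.fn x‖ ^ critExp N p := by
    rw [← integral_const_mul]
    refine integral_congr_ae ?_
    filter_upwards [W0.fn_smul r u] with x hx
    rw [hx, Pi.smul_apply, inner_smul_right, inner_powMap_self hpc]
  rw [W0.residual, e1, e2, e3]
  ring

lemma abs_powMap {s : ℝ} (hs : 1 < s) (x : ℝ) : |powMap s x| = |x| ^ (s - 1) :=
  norm_powMap hs x

/-- The zero order terms have growth at most that of |u|^{p*} + |v|^t + 1, so they are bounded in
L^1 and pair with a test function bounded by τ at a cost proportional to τ. This is the form
required by the truncation argument, and it asks only for bounds on v. -/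
lemma W0.exists_abs_integral_inner_le (hΩb : Bornology.IsBounded Ω) (hpN : p < N) {a b t : ℝ}
    (ha : 1 < a) (hb : 1 < b) (ht : 0 < t) (hab : a / critExp N p + b / t < 1) (c : ℝ) :
    ∃ κ, 0 ≤ κ ∧ ∀ (u : W0 Ω p) (v : RN N → ℝ), MemLp v (ENNReal.ofReal t) (volume.restrict Ω) →
      ∀ (h : W0 Ω p) (τ : ℝ), 0 ≤ τ → (∀ᵐ x ∂volume.restrict Ω, |h.fn x| ≤ τ) →
      |∫ x in Ω, inner ℝ (powMap p (u.grad x)) (h.grad x)| ≤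
        κ * (1 + (∫ x in Ω, ‖u.fn x‖ ^ critExp N p) + ∫ x in Ω, ‖v x‖ ^ t) * τ
          + |W0.residual a b c u v h| := by
  have : IsFiniteMeasure (volume.restrict Ω) := ⟨by simpa using hΩb.measure_lt_top⟩
  have hpc : 1 < critExp N p := hp.out.trans (lt_critExp hpN)
  have hpc0 : 0 < critExp N p := by linarith
  have hab' : (a - 1) / critExp N p + b / t < 1 := by
    have : (a - 1) / critExp N p ≤ a / critExp N p := by gcongr; linarith
    linarith
  obtain ⟨C₁, hC₁, h₁⟩ := exists_rpow_mul_rpow_le (by linarith : 0 < a - 1) (by linarith : 0 < b)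
    hpc0 ht hab' one_pos
  obtain ⟨C₂, hC₂, h₂⟩ := exists_rpow_sub_one_mul_le hpc one_pos
  set m := (volume.restrict Ω).real Set.univ with hm
  have hm0 : 0 ≤ m := measureReal_nonneg
  refine ⟨|c| * (1 + C₁ * m) + (1 + C₂ * m), by positivity, fun u v hv h τ hτ hhτ => ?_⟩
  have iu := integrable_norm_rpow_of_memLp hpc0 (u.memLp_fn_critExp hΩb hpN)
  have iv := integrable_norm_rpow_of_memLp ht hv
  have iuv : Integrable (fun x => ‖u.fn x‖ ^ critExp N p + ‖v x‖ ^ t) (volume.restrict Ω) :=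
    iu.add iv
  set U := ∫ x in Ω, ‖u.fn x‖ ^ critExp N p with hU
  set V := ∫ x in Ω, ‖v x‖ ^ t with hV
  have hU0 : 0 ≤ U := integral_nonneg fun x => by positivity
  have hV0 : 0 ≤ V := integral_nonneg fun x => by positivity
  have b1 : |∫ x in Ω, powMap a (u.fn x) * |v x| ^ b * h.fn x| ≤ (U + V + C₁ * m) * τ := by
    have := norm_integral_le_of_norm_le (μ := volume.restrict Ω)
      (f := fun x => powMap a (u.fn x) * |v x| ^ b * h.fn x)
      (g := fun x => ((‖u.fn x‖ ^ critExp N p + ‖v x‖ ^ t) + C₁) * τ)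
      ((iuv.add (integrable_const C₁)).mul_const τ) (by
        filter_upwards [hhτ] with x hx
        have d := h₁ ‖u.fn x‖ ‖v x‖ (norm_nonneg _) (norm_nonneg _)
        rw [one_mul] at d
        rw [norm_mul, norm_mul, norm_powMap ha, Real.norm_eq_abs (|v x| ^ b),
          abs_of_nonneg (by positivity : 0 ≤ |v x| ^ b)]
        exact mul_le_mul d hx (abs_nonneg _) (by positivity))
    rw [integral_mul_const, integral_add iuv (integrable_const _), integral_add iu iv,
      integral_const, smul_eq_mul, ← hm, mul_comm m] at this
    exact this
  have b2 : |∫ x in Ω, inner ℝ (powMap (critExp N p) (u.fn x)) (h.fn x)| ≤ (U + C₂ * m) * τ := by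
    have := norm_integral_le_of_norm_le (μ := volume.restrict Ω)
      (f := fun x => inner ℝ (powMap (critExp N p) (u.fn x)) (h.fn x))
      (g := fun x => (‖u.fn x‖ ^ critExp N p + C₂) * τ)
      ((iu.add (integrable_const C₂)).mul_const τ) (by
        filter_upwards [hhτ] with x hx
        have d := h₂ ‖u.fn x‖ 1 (norm_nonneg _) zero_le_one
        rw [one_mul, mul_one, Real.one_rpow, mul_one] at d
        refine (norm_inner_le_norm _ _).trans ?_
        rw [norm_powMap hpc]
        exact mul_le_mul d hx (abs_nonneg _) (by positivity))
    rw [integral_mul_const, integral_add iu (integrable_const _),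
      integral_const, smul_eq_mul, ← hm, mul_comm m] at this
    exact this
  have b3 : |∫ x in Ω, inner ℝ (powMap p (u.grad x)) (h.grad x)| ≤
      |W0.residual a b c u v h| + |c| * |∫ x in Ω, powMap a (u.fn x) * |v x| ^ b * h.fn x|
        + |∫ x in Ω, inner ℝ (powMap (critExp N p) (u.fn x)) (h.fn x)| := by
    rw [← abs_mul]
    have : ∫ x in Ω, inner ℝ (powMap p (u.grad x)) (h.grad x) = W0.residual a b c u v h
        + c * (∫ x in Ω, powMap a (u.fn x) * |v x| ^ b * h.fn x)
        + ∫ x in Ω, inner ℝ (powMap (critExp N p) (u.fn x)) (h.fn x) := by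
      rw [W0.residual]
      ring
    rw [this]
    exact abs_add_three _ _ _
  have b4 := mul_le_mul_of_nonneg_left b1 (abs_nonneg c)
  have b5 : U + V + C₁ * m ≤ (1 + C₁ * m) * (1 + U + V) := by
    have : 0 ≤ C₁ * m * (U + V) := by positivity
    nlinarith
  have b6 : U + C₂ * m ≤ (1 + C₂ * m) * (1 + U + V) := by
    have : 0 ≤ C₂ * m * (U + V) := by positivity
    nlinarith
  have b7 := mul_le_mul_of_nonneg_left (mul_le_mul_of_nonneg_right b5 hτ) (abs_nonneg c)
  have b8 := mul_le_mul_of_nonneg_right b6 hτ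
  linarith

/-- Packs u_j and a fixed test function h into one vector-valued function, so that |u|^{a-1}|v|^b|h|
is covered by the growth condition with exponents a and b. -/
lemma integral_norm_prodMk_rpow_le {α : Type*} [MeasurableSpace α] {μ : Measure α} {f g : α → ℝ}
    {r : ℝ} (hr : 0 < r) (hf : MemLp f (ENNReal.ofReal r) μ) (hg : MemLp g (ENNReal.ofReal r) μ) :
    MemLp (fun x => (f x, g x)) (ENNReal.ofReal r) μ ∧
      ∫ x, ‖(f x, g x)‖ ^ r ∂μ ≤ (∫ x, ‖f x‖ ^ r ∂μ) + ∫ x, ‖g x‖ ^ r ∂μ := by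
  have i1 := integrable_norm_rpow_of_memLp hr hf
  have i2 := integrable_norm_rpow_of_memLp hr hg
  have pt : ∀ x, ‖(f x, g x)‖ ^ r ≤ ‖f x‖ ^ r + ‖g x‖ ^ r := fun x => by
    rw [Prod.norm_mk]
    rcases max_choice ‖f x‖ ‖g x‖ with h | h <;> rw [h]
    · exact le_add_of_nonneg_right (by positivity)
    · exact le_add_of_nonneg_left (by positivity)
  have hm : AEStronglyMeasurable (fun x => (f x, g x)) μ := hf.1.prodMk hg.1
  have i3 : Integrable (fun x => ‖(f x, g x)‖ ^ r) μ :=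
    (i1.add i2).mono' (hm.norm.aemeasurable.pow_const r).aestronglyMeasurable
      (Eventually.of_forall fun x => by
        rw [Real.norm_of_nonneg (by positivity)]
        exact pt x)
  refine ⟨(memLp_ofReal_iff hr hm).2 i3, ?_⟩
  rw [← integral_add i1 i2]
  exact integral_mono i3 (i1.add i2) pt

/-- Weak continuity of the residual along bounded, almost everywhere convergent sequences. -/
lemma W0.tendsto_residual (hΩb : Bornology.IsBounded Ω) (hpN : p < N) {a b t : ℝ}
    (ha : 1 < a) (hb : 1 < b) (ht : 0 < t) (hab : a / critExp N p + b / t < 1) (c : ℝ)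
    {u : ℕ → W0 Ω p} {v : ℕ → RN N → ℝ} {u₀ : W0 Ω p} {v₀ : RN N → ℝ} {M : ℝ}
    (hv : ∀ j, MemLp (v j) (ENNReal.ofReal t) (volume.restrict Ω))
    (hgM : ∀ j, ∫ x in Ω, ‖(u j).grad x‖ ^ p ≤ M)
    (huM : ∀ j, ∫ x in Ω, ‖(u j).fn x‖ ^ critExp N p ≤ M)
    (hvM : ∀ j, ∫ x in Ω, ‖v j x‖ ^ t ≤ M)
    (hulim : ∀ᵐ x ∂volume.restrict Ω, Tendsto (fun j => (u j).fn x) atTop (𝓝 (u₀.fn x)))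
    (hglim : ∀ᵐ x ∂volume.restrict Ω, Tendsto (fun j => (u j).grad x) atTop (𝓝 (u₀.grad x)))
    (hvlim : ∀ᵐ x ∂volume.restrict Ω, Tendsto (fun j => v j x) atTop (𝓝 (v₀ x)))
    (h : W0 Ω p) :
    Tendsto (fun j => W0.residual a b c (u j) (v j) h) atTop
      (𝓝 (W0.residual a b c u₀ v₀ h)) := by
  have : IsFiniteMeasure (volume.restrict Ω) := ⟨by simpa using hΩb.measure_lt_top⟩
  have hpc : 1 < critExp N p := hp.out.trans (lt_critExp hpN)
  have hpc0 : 0 < critExp N p := by linarith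
  have hh := h.memLp_fn_critExp hΩb hpN
  have l1 := tendsto_integral_inner_powMap hp.out (fun j => (u j).memLp_grad) h.memLp_grad
    hglim hgM
  have l3 := tendsto_integral_inner_powMap hpc (fun j => (u j).memLp_fn_critExp hΩb hpN) hh
    hulim huM
  have hprod := fun j => integral_norm_prodMk_rpow_le hpc0 ((u j).memLp_fn_critExp hΩb hpN) hh
  set H := ∫ x in Ω, ‖h.fn x‖ ^ critExp N p with hH
  have hH0 : 0 ≤ H := integral_nonneg fun x => by positivity
  have l2 := tendsto_integral_rpow_mul_rpow (μ := volume.restrict Ω) (E := ℝ × ℝ) (F := ℝ)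
    (u := fun j x => ((u j).fn x, h.fn x)) (v := v) (u₀ := fun x => (u₀.fn x, h.fn x)) (v₀ := v₀)
    (φ := fun x y => powMap a x.1 * |y| ^ b * x.2) (a := a) (b := b) (K := 1) (C := M + H)
    (by linarith) (by linarith) hpc0 ht hab (fun j => (hprod j).1) hv
    (by filter_upwards [hulim] with x hx using hx.prodMk_nhds tendsto_const_nhds) hvlim
    (fun j => (hprod j).2.trans (add_le_add_left (huM j) _))
    (fun j => (hvM j).trans (le_add_of_nonneg_right hH0))
    (by
      have c1 : Continuous (powMap a : ℝ → ℝ) := continuous_powMap ha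
      have c2 : Continuous fun z : (ℝ × ℝ) × ℝ => |z.2| ^ b :=
        (continuous_snd.abs).rpow_const fun _ => Or.inr (by linarith)
      exact ((c1.comp (continuous_fst.comp continuous_fst)).mul c2).mul
        (continuous_snd.comp continuous_fst))
    (fun x y => by
      have e1 : |x.1| ^ (a - 1) * |x.2| ≤ ‖x‖ ^ a := by
        rw [← rpow_sub_one_mul (norm_nonneg x) ha]
        exact mul_le_mul (Real.rpow_le_rpow (abs_nonneg _) (norm_fst_le x) (by linarith))
          (norm_snd_le x) (abs_nonneg _) (by positivity)
      have e2 : 0 ≤ |y| ^ b := by positivity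
      rw [abs_mul, abs_mul, abs_powMap ha, abs_of_nonneg e2, one_mul, Real.norm_eq_abs y]
      calc |x.1| ^ (a - 1) * |y| ^ b * |x.2| = |x.1| ^ (a - 1) * |x.2| * |y| ^ b := by ring
        _ ≤ ‖x‖ ^ a * |y| ^ b := mul_le_mul_of_nonneg_right e1 e2)
  exact (l1.sub (l2.const_mul c)).sub l3

/-- The Brezis-Lieb splitting for a sequence of almost solutions. -/
lemma W0.tendsto_integral_grad_sub (hΩb : Bornology.IsBounded Ω) (hpN : p < N)
    {u : ℕ → W0 Ω p} {u₀ : W0 Ω p} {M : ℝ} (hM : ∀ j, ‖u j‖ ≤ M)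
    (huM : ∀ j, ∫ x in Ω, ‖(u j).fn x‖ ^ critExp N p ≤ M)
    (hulim : ∀ᵐ x ∂volume.restrict Ω, Tendsto (fun j => (u j).fn x) atTop (𝓝 (u₀.fn x)))
    (hglim : ∀ᵐ x ∂volume.restrict Ω, Tendsto (fun j => (u j).grad x) atTop (𝓝 (u₀.grad x))) :
    Tendsto (fun j => (∫ x in Ω, ‖(u j).grad x‖ ^ p) - ∫ x in Ω, ‖(u j - u₀).grad x‖ ^ p) atTop
      (𝓝 (∫ x in Ω, ‖u₀.grad x‖ ^ p)) ∧
    Tendsto (fun j => (∫ x in Ω, ‖(u j).fn x‖ ^ critExp N p)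
      - ∫ x in Ω, ‖(u j - u₀).fn x‖ ^ critExp N p) atTop
      (𝓝 (∫ x in Ω, ‖u₀.fn x‖ ^ critExp N p)) := by
  have hp0 : 0 < p := by linarith [hp.out]
  have hpc : 1 < critExp N p := hp.out.trans (lt_critExp hpN)
  have hpc0 : 0 < critExp N p := by linarith
  have ef : ∀ᵐ x ∂volume.restrict Ω, ∀ j, (u j - u₀).fn x = (u j).fn x - u₀.fn x :=
    ae_all_iff.2 fun j => W0.fn_sub _ _
  have eg : ∀ᵐ x ∂volume.restrict Ω, ∀ j, (u j - u₀).grad x = (u j).grad x - u₀.grad x :=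
    ae_all_iff.2 fun j => W0.grad_sub _ _
  have lf : ∀ᵐ x ∂volume.restrict Ω, Tendsto (fun j => (u j - u₀).fn x) atTop (𝓝 0) := by
    filter_upwards [hulim, ef] with x a1 a2
    simp only [a2]
    simpa using a1.sub_const (u₀.fn x)
  have lg : ∀ᵐ x ∂volume.restrict Ω, Tendsto (fun j => (u j - u₀).grad x) atTop (𝓝 0) := by
    filter_upwards [hglim, eg] with x a1 a2
    simp only [a2]
    simpa using a1.sub_const (u₀.grad x)
  constructor
  · have := tendsto_integral_norm_add_rpow_sub hp.out (fun j => (u j - u₀).memLp_grad)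
      u₀.memLp_grad lg (C := (M + ‖u₀‖) ^ p) fun j =>
        (u j - u₀).integral_norm_grad_rpow_le.trans (Real.rpow_le_rpow (norm_nonneg _)
          ((norm_sub_le _ _).trans (add_le_add_left (hM j) _)) hp0.le)
    refine this.congr fun j => ?_
    congr 1
    refine integral_congr_ae ?_
    filter_upwards [eg] with x hx
    rw [hx, sub_add_cancel]
  · have hC : ∀ j, ∫ x in Ω, ‖(u j - u₀).fn x‖ ^ critExp N p
        ≤ 2 ^ critExp N p * (M + ∫ x in Ω, ‖u₀.fn x‖ ^ critExp N p) := fun j => by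
      have i1 := integrable_norm_rpow_of_memLp hpc0 ((u j).memLp_fn_critExp hΩb hpN)
      have i2 := integrable_norm_rpow_of_memLp hpc0 (u₀.memLp_fn_critExp hΩb hpN)
      have i3 := integrable_norm_rpow_of_memLp hpc0 ((u j - u₀).memLp_fn_critExp hΩb hpN)
      have := integral_mono_ae i3 ((i1.add i2).const_mul (2 ^ critExp N p)) (by
        filter_upwards [ef] with x hx
        rw [hx]
        exact (Real.rpow_le_rpow (norm_nonneg _) (norm_sub_le _ _) hpc0.le).trans
          (add_rpow_le_two_rpow (norm_nonneg _) (norm_nonneg _) hpc0.le))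
      rw [integral_const_mul, integral_add' i1 i2] at this
      refine this.trans (mul_le_mul_of_nonneg_left (add_le_add_left (huM j) _) (by positivity))
    have := tendsto_integral_norm_add_rpow_sub hpc
      (fun j => (u j - u₀).memLp_fn_critExp hΩb hpN) (u₀.memLp_fn_critExp hΩb hpN) lf hC
    refine this.congr fun j => ?_
    congr 1
    refine integral_congr_ae ?_
    filter_upwards [ef] with x hx
    rw [hx, sub_add_cancel]

lemma sobolevConst_nonneg (N : ℕ) (p : ℝ) : 0 ≤ sobolevConst N p := by
  refine Real.sInf_nonneg ?_
  rintro r ⟨u, g, -, -, rfl⟩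
  have h1 : 0 ≤ ∫ x, ‖g x‖ ^ p := integral_nonneg fun x => by positivity
  have h2 : 0 ≤ ∫ x, |u x| ^ critExp N p := integral_nonneg fun x => by positivity
  positivity

/-- The concentration alternative: since p/p* = 1 - p/N, a positive A would satisfy S ≤ A^{p/N},
that is A ≥ S^{N/p}. -/
lemma eq_zero_of_lt_sobolevConst_rpow (hpN : p < N) {A : ℝ} (hA : 0 ≤ A)
    (h : sobolevConst N p * A ^ (p / critExp N p) ≤ A) (hlt : A < sobolevConst N p ^ (N / p)) :
    A = 0 := by
  by_contra hne
  have hA0 : 0 < A := lt_of_le_of_ne hA (Ne.symm hne)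
  have hp0 : 0 < p := by linarith [hp.out]
  have hN0 : (0 : ℝ) < N := hp0.trans hpN
  have e : p / critExp N p = 1 - p / N := by
    rw [div_eq_mul_inv p (critExp N p), inv_critExp hpN]
    field_simp
  rw [e, Real.rpow_sub hA0, Real.rpow_one, ← mul_div_assoc, div_le_iff₀ (by positivity)] at h
  have h1 : sobolevConst N p ≤ A ^ (p / N) := by
    have : A * sobolevConst N p ≤ A * A ^ (p / N) := by linarith
    exact le_of_mul_le_mul_left this hA0
  have h2 := Real.rpow_le_rpow (sobolevConst_nonneg N p) h1 (by positivity : 0 ≤ N / p)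
  rw [← Real.rpow_mul hA, div_mul_div_cancel₀ hN0.ne', div_self hp0.ne', Real.rpow_one] at h2
  linarith

lemma W0.tendsto_of_tendsto_integral_grad (hΩb : Bornology.IsBounded Ω) (hpN : p < N)
    {u : ℕ → W0 Ω p} {u₀ : W0 Ω p}
    (h : Tendsto (fun j => ∫ x in Ω, ‖(u j - u₀).grad x‖ ^ p) atTop (𝓝 0)) :
    Tendsto u atTop (𝓝 u₀) := by
  have hp0 : 0 < p := by linarith [hp.out]
  obtain ⟨C, hC, hP⟩ := W0.exists_norm_rpow_le (Ω := Ω) hΩb hpN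
  have h1 : Tendsto (fun j => ‖u j - u₀‖ ^ p) atTop (𝓝 0) :=
    squeeze_zero (fun j => by positivity) (fun j => hP (u j - u₀)) (by simpa using h.const_mul C)
  have h2 := h1.rpow_const (p := p⁻¹) (Or.inr (by positivity))
  rw [Real.zero_rpow (by positivity)] at h2
  rw [tendsto_iff_norm_sub_tendsto_zero]
  refine h2.congr fun j => ?_
  rw [← Real.rpow_mul (norm_nonneg _), mul_inv_cancel₀ hp0.ne', Real.rpow_one]

end Component

/-! ### The Palais-Smale condition -/

section System

variable {N : ℕ} {Ω : Set (RN N)} {p q : ℝ} [hp : Fact (1 < p)] [hq : Fact (1 < q)]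

lemma energyDeriv_eq (a b lam : ℝ) (w h : W Ω p q) : energyDeriv a b lam w h =
    W0.residual a b (lam * a / (a + b)) w.fst w.snd.fn h.fst
      + W0.residual b a (lam * b / (a + b)) w.snd w.fst.fn h.snd := by
  have e : ∫ x in Ω, powMap b (w.snd.fn x) * |w.fst.fn x| ^ a * h.snd.fn x
      = ∫ x in Ω, |w.fst.fn x| ^ a * powMap b (w.snd.fn x) * h.snd.fn x := by
    refine integral_congr_ae (Eventually.of_forall fun x => ?_)
    simp only
    ring
  rw [energyDeriv, W0.residual, W0.residual, e]
  ring

lemma one_div_sub_one_div_critExp (hpN : p < N) : 1 / p - 1 / critExp N p = 1 / N := by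
  rw [one_div, one_div, one_div, inv_critExp hpN]
  ring

/-- The energy in terms of the two Nehari functionals. -/
lemma energy_identity (hpN : p < N) (hqN : q < N) {a b : ℝ} (hab : a + b ≠ 0)
    (lam X Y I U V : ℝ) :
    1 / p * X + 1 / q * Y - lam / (a + b) * I - 1 / critExp N p * U - 1 / critExp N q * V =
      1 / p * (X - lam * a / (a + b) * I - U) + 1 / q * (Y - lam * b / (a + b) * I - V)
        + lam / (a + b) * (a / p + b / q - 1) * I + 1 / N * (U + V) := by
  have hp0 : p ≠ 0 := by linarith [hp.out]
  have hq0 : q ≠ 0 := by linarith [hq.out]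
  have e1 := one_div_sub_one_div_critExp hpN
  have e2 := one_div_sub_one_div_critExp hqN
  have e3 : 1 / critExp N p = 1 / p - 1 / N := by linarith
  have e4 : 1 / critExp N q = 1 / q - 1 / N := by linarith
  rw [e3, e4]
  field_simp
  ring

set_option maxHeartbeats 1000000 in
/-- Almost critical points with bounded energy are bounded. -/
lemma exists_bound_of_energy (hΩb : Bornology.IsBounded Ω) (hpN : p < N) (hqN : q < N) {a b : ℝ}
    (ha : 1 < a) (hb : 1 < b) (hab : a / critExp N p + b / critExp N q < 1) {lam : ℝ}
    (hlam : 0 < lam) (hγ : 1 ≤ a / p + b / q) {C₀ : ℝ} (hC₀ : 0 ≤ C₀) :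
    ∃ M, ∀ w : W Ω p q, |energy Ω p q a b lam w| ≤ C₀ →
      (∀ h, |W0.residual a b (lam * a / (a + b)) w.fst w.snd.fn h| ≤ C₀ * ‖h‖) →
      (∀ h, |W0.residual b a (lam * b / (a + b)) w.snd w.fst.fn h| ≤ C₀ * ‖h‖) →
      ‖w.fst‖ ≤ M ∧ ‖w.snd‖ ≤ M ∧ (∫ x in Ω, ‖w.fst.fn x‖ ^ critExp N p) ≤ M ∧
        ∫ x in Ω, ‖w.snd.fn x‖ ^ critExp N q ≤ M := by
  have : IsFiniteMeasure (volume.restrict Ω) := ⟨by simpa using hΩb.measure_lt_top⟩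
  have hp1 := hp.out
  have hq1 := hq.out
  have hN : (1 : ℝ) < N := hp1.trans hpN
  have hpc : 1 < critExp N p := hp1.trans (lt_critExp hpN)
  have hqc : 1 < critExp N q := hq1.trans (lt_critExp hqN)
  obtain ⟨P, hP0, hP⟩ := W0.exists_norm_rpow_le (Ω := Ω) hΩb hpN
  obtain ⟨Q, hQ0, hQ⟩ := W0.exists_norm_rpow_le (Ω := Ω) hΩb hqN
  obtain ⟨C₁, hC₁, h₁⟩ := exists_rpow_mul_rpow_le (by linarith : 0 < a) (by linarith : 0 < b)
    (by linarith : 0 < critExp N p) (by linarith : 0 < critExp N q) hab one_pos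
  set m := (volume.restrict Ω).real Set.univ with hm
  have hm0 : 0 ≤ m := measureReal_nonneg
  set L := lam / (a + b) with hL
  have hL0 : 0 ≤ L := by positivity
  -- Collects the bound for the weighted gradient integrals: energy, the constant from the coupling,
  -- and L + 1 times the bound N * C₀ for the critical integrals, all relative to 1 + s + t.
  set R := C₀ + L * (C₁ * m) + (L + 1) * (N * C₀) with hR
  have hR0 : 0 ≤ R := by positivity
  set T := P * (p * R) + Q * (q * R) with hT
  have hT0 : 0 ≤ T := by positivity
  -- The norms satisfy s ^ p + t ^ q ≤ T * (1 + s + t) below; the small constant leaves a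
  -- coefficient of at most 1/4, which is absorbed on the left.
  obtain ⟨D₁, hD₁, d₁⟩ := exists_le_mul_rpow_add hp1 (by positivity : 0 < 1 / (4 * (T + 1)))
  obtain ⟨D₂, hD₂, d₂⟩ := exists_le_mul_rpow_add hq1 (by positivity : 0 < 1 / (4 * (T + 1)))
  set η := 1 / (4 * (T + 1)) with hη
  have hη0 : 0 < η := by positivity
  have hηT : η * T ≤ 1 / 4 := by
    have : η * (T + 1) = 1 / 4 := by rw [hη]; field_simp
    nlinarith
  set M₀ := 1 + 2 * (D₁ + D₂) with hM₀
  have hM₀0 : 0 ≤ M₀ := by positivity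
  have hNC : 0 ≤ N * C₀ := by positivity
  refine ⟨M₀ + N * C₀ * (1 + M₀), fun w hE hr1 hr2 => ?_⟩
  have k1 := hr1 ((1 : ℝ) • w.fst)
  have k2 := hr2 ((1 : ℝ) • w.snd)
  rw [W0.residual_smul_self hpN ha, one_mul, one_smul] at k1
  rw [W0.residual_smul_self hqN hb, one_mul, one_smul] at k2
  simp only [mul_comm (|w.snd.fn _| ^ b)] at k2
  rw [energy_eq hΩb hpN hqN, energy_identity hpN hqN (by linarith)] at hE
  -- The energy bound is kept in two forms: the Nehari form bounds the critical integrals, and the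
  -- original form then bounds the gradients.
  have kE := hE
  rw [← energy_identity hpN hqN (by linarith)] at kE
  have iu := integrable_norm_rpow_of_memLp (by linarith) (w.fst.memLp_fn_critExp hΩb hpN)
  have iv := integrable_norm_rpow_of_memLp (by linarith) (w.snd.memLp_fn_critExp hΩb hqN)
  have hI : ∫ x in Ω, |w.fst.fn x| ^ a * |w.snd.fn x| ^ b ≤
      (∫ x in Ω, ‖w.fst.fn x‖ ^ critExp N p) + (∫ x in Ω, ‖w.snd.fn x‖ ^ critExp N q)
        + C₁ * m := by
    have iuv : Integrable (fun x => ‖w.fst.fn x‖ ^ critExp N p + ‖w.snd.fn x‖ ^ critExp N q)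
      (volume.restrict Ω) := iu.add iv
    have := norm_integral_le_of_norm_le (μ := volume.restrict Ω)
      (f := fun x => |w.fst.fn x| ^ a * |w.snd.fn x| ^ b)
      (g := fun x => (‖w.fst.fn x‖ ^ critExp N p + ‖w.snd.fn x‖ ^ critExp N q) + C₁)
      (iuv.add (integrable_const C₁)) (Eventually.of_forall fun x => by
        have d := h₁ ‖w.fst.fn x‖ ‖w.snd.fn x‖ (norm_nonneg _) (norm_nonneg _)
        rw [one_mul] at d
        rw [Real.norm_of_nonneg (by positivity)]
        exact d)
    rw [integral_add iuv (integrable_const _), integral_add iu iv, integral_const, smul_eq_mul,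
      ← hm, mul_comm m] at this
    exact (le_abs_self _).trans this
  have hI0 : 0 ≤ ∫ x in Ω, |w.fst.fn x| ^ a * |w.snd.fn x| ^ b :=
    integral_nonneg fun x => by positivity
  have hU0 : 0 ≤ ∫ x in Ω, ‖w.fst.fn x‖ ^ critExp N p := integral_nonneg fun x => by positivity
  have hV0 : 0 ≤ ∫ x in Ω, ‖w.snd.fn x‖ ^ critExp N q := integral_nonneg fun x => by positivity
  have hX0 : 0 ≤ ∫ x in Ω, ‖w.fst.grad x‖ ^ p := integral_nonneg fun x => by positivity
  have hY0 : 0 ≤ ∫ x in Ω, ‖w.snd.grad x‖ ^ q := integral_nonneg fun x => by positivity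
  have hPu := hP w.fst
  have hQv := hQ w.snd
  have es := d₁ ‖w.fst‖ (norm_nonneg _)
  have et := d₂ ‖w.snd‖ (norm_nonneg _)
  have hs0 := norm_nonneg w.fst
  have ht0 := norm_nonneg w.snd
  generalize (∫ x in Ω, ‖w.fst.grad x‖ ^ p) = X at *
  generalize (∫ x in Ω, ‖w.snd.grad x‖ ^ q) = Y at *
  generalize (∫ x in Ω, |w.fst.fn x| ^ a * |w.snd.fn x| ^ b) = I at *
  generalize (∫ x in Ω, ‖w.fst.fn x‖ ^ critExp N p) = U at *
  generalize (∫ x in Ω, ‖w.snd.fn x‖ ^ critExp N q) = V at *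
  generalize ‖w.fst‖ = s at *
  generalize ‖w.snd‖ = t at *
  have one_div_mul_le : ∀ {r z : ℝ}, 1 < r → 0 ≤ z → 1 / r * z ≤ z := fun {r z} hr hz =>
    mul_le_of_le_one_left hz (by rw [div_le_one (by linarith)]; linarith)
  have j1 : -(C₀ * s) ≤ 1 / p * (X - lam * a / (a + b) * I - U) := by
    have e1 : 1 / p * -(C₀ * s) ≤ 1 / p * (X - lam * a / (a + b) * I - U) :=
      mul_le_mul_of_nonneg_left (abs_le.1 k1).1 (by positivity)
    have e2 := one_div_mul_le hp1 (mul_nonneg hC₀ hs0)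
    linarith
  have j2 : -(C₀ * t) ≤ 1 / q * (Y - lam * b / (a + b) * I - V) := by
    have e1 : 1 / q * -(C₀ * t) ≤ 1 / q * (Y - lam * b / (a + b) * I - V) :=
      mul_le_mul_of_nonneg_left (abs_le.1 k2).1 (by positivity)
    have e2 := one_div_mul_le hq1 (mul_nonneg hC₀ ht0)
    linarith
  -- The coupling contribution has a favourable sign precisely because γ ≥ 1, so it can be dropped.
  have j3 : 0 ≤ L * (a / p + b / q - 1) * I :=
    mul_nonneg (mul_nonneg hL0 (by linarith)) hI0
  have j4 : 1 / N * (U + V) ≤ C₀ * (1 + s + t) := by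
    have := (abs_le.1 hE).2
    linarith
  have j5 : U + V ≤ N * C₀ * (1 + s + t) := by
    have e1 := mul_le_mul_of_nonneg_left j4 (by linarith : (0 : ℝ) ≤ N)
    rw [← mul_assoc, mul_one_div_cancel (by linarith), one_mul] at e1
    linarith
  have j6 : 1 / p * X + 1 / q * Y ≤ R * (1 + s + t) := by
    have e1 := (abs_le.1 kE).2
    have e2 := one_div_mul_le hpc hU0
    have e3 := one_div_mul_le hqc hV0
    have e4 : L * I ≤ L * (U + V + C₁ * m) := mul_le_mul_of_nonneg_left hI hL0
    have e5 : (L + 1) * (U + V) ≤ (L + 1) * (N * C₀ * (1 + s + t)) :=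
      mul_le_mul_of_nonneg_left j5 (by positivity)
    have e6 : 0 ≤ (C₀ + L * (C₁ * m)) * (s + t) := by positivity
    rw [hR]
    nlinarith
  have j7 : X ≤ p * R * (1 + s + t) := by
    have e1 : 1 / p * X ≤ R * (1 + s + t) := by
      have : 0 ≤ 1 / q * Y := by positivity
      linarith
    have e2 := mul_le_mul_of_nonneg_left e1 (by linarith : 0 ≤ p)
    rw [← mul_assoc, mul_one_div_cancel (by linarith), one_mul] at e2
    linarith
  have j8 : Y ≤ q * R * (1 + s + t) := by
    have e1 : 1 / q * Y ≤ R * (1 + s + t) := by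
      have : 0 ≤ 1 / p * X := by positivity
      linarith
    have e2 := mul_le_mul_of_nonneg_left e1 (by linarith : 0 ≤ q)
    rw [← mul_assoc, mul_one_div_cancel (by linarith), one_mul] at e2
    linarith
  have j9 : s ^ p + t ^ q ≤ T * (1 + s + t) := by
    have e1 := mul_le_mul_of_nonneg_left j7 hP0
    have e2 := mul_le_mul_of_nonneg_left j8 hQ0
    rw [hT]
    linarith
  have j10 : s + t ≤ M₀ := by
    have e1 := mul_le_mul_of_nonneg_left j9 hη0.le
    have e2 : η * T * (1 + s + t) ≤ 1 / 4 * (1 + s + t) :=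
      mul_le_mul_of_nonneg_right hηT (by positivity)
    rw [hM₀]
    linarith
  have j11 : N * C₀ * (1 + s + t) ≤ N * C₀ * (1 + M₀) :=
    mul_le_mul_of_nonneg_left (by linarith) hNC
  have j12 : 0 ≤ N * C₀ * (1 + M₀) := by positivity
  refine ⟨?_, ?_, ?_, ?_⟩ <;> linarith

/-- Because both integrals have the same limit, the Sobolev inequality passes to S A^{p/p*} ≤ A, and
the alternative for A applies. -/
lemma eq_zero_of_tendsto_integral (hΩo : IsOpen Ω) (hΩb : Bornology.IsBounded Ω) (hpN : p < N)
    {z : ℕ → W0 Ω p} {A : ℝ}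
    (h1 : Tendsto (fun j => ∫ x in Ω, ‖(z j).grad x‖ ^ p) atTop (𝓝 A))
    (h2 : Tendsto (fun j => ∫ x in Ω, ‖(z j).fn x‖ ^ critExp N p) atTop (𝓝 A))
    (hA : A < sobolevConst N p ^ (N / p)) : A = 0 := by
  have hp0 : 0 < p := by linarith [hp.out]
  have hpc : 0 < critExp N p := hp0.trans (lt_critExp hpN)
  have hA0 : 0 ≤ A := ge_of_tendsto' h1 fun j => integral_nonneg fun x => by positivity
  refine eq_zero_of_lt_sobolevConst_rpow hpN hA0 ?_ hA
  refine le_of_tendsto_of_tendsto' ((h2.rpow_const (Or.inr (by positivity))).const_mul _) h1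
    fun j => ?_
  exact (z j).sobolevConst_mul_le hΩo hΩb hpN

lemma mul_critLevel_le (hN : 0 < N) (p q : ℝ) :
    N * critLevel N p q ≤ sobolevConst N p ^ (N / p) ∧
      N * critLevel N p q ≤ sobolevConst N q ^ (N / q) := by
  have hN' : (N : ℝ) ≠ 0 := by positivity
  rw [critLevel, ← mul_assoc, mul_one_div_cancel hN', one_mul]
  exact ⟨min_le_left _ _, min_le_right _ _⟩

end System

/-! ### Nehari identities of the remainders and exclusion of concentration -/

section PalaisSmale

variable {N : ℕ} {Ω : Set (RN N)} {p q : ℝ} [hp : Fact (1 < p)] [hq : Fact (1 < q)]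

/-- A bounded sequence of almost solutions of one equation converges almost everywhere, along
a subsequence, together with its gradients. -/
lemma W0.exists_subseq_of_residual (hΩb : Bornology.IsBounded Ω) (hpN : p < N) {a b t : ℝ}
    (ha : 1 < a) (hb : 1 < b) (ht : 0 < t) (hab : a / critExp N p + b / t < 1) {c : ℝ}
    {u : ℕ → W0 Ω p} {v : ℕ → RN N → ℝ} {ε : ℕ → ℝ} {M : ℝ} (hε : ∀ j, 0 ≤ ε j)
    (hε0 : Tendsto ε atTop (𝓝 0))
    (hv : ∀ j, MemLp (v j) (ENNReal.ofReal t) (volume.restrict Ω)) (hM : ∀ j, ‖u j‖ ≤ M)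
    (huM : ∀ j, ∫ x in Ω, ‖(u j).fn x‖ ^ critExp N p ≤ M)
    (hvM : ∀ j, ∫ x in Ω, ‖v j x‖ ^ t ≤ M)
    (hres : ∀ j h, |W0.residual a b c (u j) (v j) h| ≤ ε j * ‖h‖) :
    ∃ (k : ℕ → ℕ) (u₀ : W0 Ω p), StrictMono k ∧
      (∀ᵐ x ∂volume.restrict Ω, Tendsto (fun j => (u (k j)).fn x) atTop (𝓝 (u₀.fn x))) ∧
      ∀ᵐ x ∂volume.restrict Ω, Tendsto (fun j => (u (k j)).grad x) atTop (𝓝 (u₀.grad x)) := by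
  obtain ⟨κ, hκ, H⟩ := W0.exists_abs_integral_inner_le hΩb hpN ha hb ht hab c
  have hM0 : 0 ≤ M := (norm_nonneg _).trans (hM 0)
  refine W0.exists_subseq_tendsto_ae hΩb hε hε0 (K := κ * (1 + M + M)) (by positivity) hM
    fun j h τ hτ hh => (H (u j) (v j) (hv j) h τ hτ hh).trans ?_
  refine add_le_add (mul_le_mul_of_nonneg_right (mul_le_mul_of_nonneg_left ?_ hκ) hτ) (hres j h)
  linarith [huM j, hvM j]

/-- The limit `u₀` of a sequence of almost solutions `u_j` of one equation satisfies the Nehari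
identity, and the remainders `u_j - u₀` satisfy the limiting critical Nehari identity. -/
lemma W0.nehari_of_tendsto_ae (hΩb : Bornology.IsBounded Ω) (hpN : p < N) {a b t : ℝ}
    (ha : 1 < a) (hb : 1 < b) (ht : 0 < t) (hab : a / critExp N p + b / t < 1) {c : ℝ}
    {u : ℕ → W0 Ω p} {v : ℕ → RN N → ℝ} {u₀ : W0 Ω p} {v₀ : RN N → ℝ} {ε : ℕ → ℝ} {M : ℝ}
    (hε : ∀ j, 0 ≤ ε j) (hε0 : Tendsto ε atTop (𝓝 0))
    (hv : ∀ j, MemLp (v j) (ENNReal.ofReal t) (volume.restrict Ω)) (hM : ∀ j, ‖u j‖ ≤ M)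
    (huM : ∀ j, ∫ x in Ω, ‖(u j).fn x‖ ^ critExp N p ≤ M)
    (hvM : ∀ j, ∫ x in Ω, ‖v j x‖ ^ t ≤ M)
    (hulim : ∀ᵐ x ∂volume.restrict Ω, Tendsto (fun j => (u j).fn x) atTop (𝓝 (u₀.fn x)))
    (hglim : ∀ᵐ x ∂volume.restrict Ω, Tendsto (fun j => (u j).grad x) atTop (𝓝 (u₀.grad x)))
    (hvlim : ∀ᵐ x ∂volume.restrict Ω, Tendsto (fun j => v j x) atTop (𝓝 (v₀ x)))
    (hres : ∀ j h, |W0.residual a b c (u j) (v j) h| ≤ ε j * ‖h‖) :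
    (∫ x in Ω, ‖u₀.grad x‖ ^ p) - c * (∫ x in Ω, |u₀.fn x| ^ a * |v₀ x| ^ b)
        - (∫ x in Ω, ‖u₀.fn x‖ ^ critExp N p) = 0 ∧
      Tendsto (fun j => (∫ x in Ω, ‖(u j - u₀).grad x‖ ^ p)
        - ∫ x in Ω, ‖(u j - u₀).fn x‖ ^ critExp N p) atTop (𝓝 0) ∧
      Tendsto (fun j => ∫ x in Ω, |(u j).fn x| ^ a * |v j x| ^ b) atTop
        (𝓝 (∫ x in Ω, |u₀.fn x| ^ a * |v₀ x| ^ b)) := by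
  have : IsFiniteMeasure (volume.restrict Ω) := ⟨by simpa using hΩb.measure_lt_top⟩
  have hp0 : 0 < p := by linarith [hp.out]
  have hpc0 : 0 < critExp N p := hp0.trans (lt_critExp hpN)
  have hM0 : 0 ≤ M := (norm_nonneg _).trans (hM 0)
  have hgM : ∀ j, ∫ x in Ω, ‖(u j).grad x‖ ^ p ≤ M ^ p := fun j =>
    (u j).integral_norm_grad_rpow_le.trans (Real.rpow_le_rpow (norm_nonneg _) (hM j) hp0.le)
  -- Tested with the fixed function u₀, the residuals along the sequence tend both to the residual
  -- of the limit and to 0.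
  have l0 : W0.residual a b c u₀ v₀ ((1 : ℝ) • u₀) = 0 := by
    refine tendsto_nhds_unique (W0.tendsto_residual hΩb hpN ha hb ht hab c hv
      (M := max M (M ^ p)) (fun j => (hgM j).trans (le_max_right _ _))
      (fun j => (huM j).trans (le_max_left _ _)) (fun j => (hvM j).trans (le_max_left _ _))
      hulim hglim hvlim _) ?_
    exact squeeze_zero_norm (fun j => hres j _) (by simpa using hε0.mul_const ‖(1 : ℝ) • u₀‖)
  rw [W0.residual_smul_self hpN ha, one_mul] at l0
  have l1 : Tendsto (fun j => (∫ x in Ω, ‖(u j).grad x‖ ^ p)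
      - c * (∫ x in Ω, |(u j).fn x| ^ a * |v j x| ^ b)
      - ∫ x in Ω, ‖(u j).fn x‖ ^ critExp N p) atTop (𝓝 0) := by
    refine squeeze_zero_norm (a := fun j => ε j * M) (fun j => ?_)
      (by simpa using hε0.mul_const M)
    have := hres j ((1 : ℝ) • u j)
    rw [W0.residual_smul_self hpN ha, one_mul, one_smul] at this
    exact this.trans (mul_le_mul_of_nonneg_left (hM j) (hε j))
  have l2 : Tendsto (fun j => ∫ x in Ω, |(u j).fn x| ^ a * |v j x| ^ b) atTop
        (𝓝 (∫ x in Ω, |u₀.fn x| ^ a * |v₀ x| ^ b)) :=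
    tendsto_integral_rpow_mul_rpow (μ := volume.restrict Ω) (E := ℝ) (F := ℝ)
      (u := fun j => (u j).fn) (v := v) (φ := fun x y => |x| ^ a * |y| ^ b) (K := 1) (C := M)
      (by linarith) (by linarith) hpc0 ht hab (fun j => (u j).memLp_fn_critExp hΩb hpN) hv
      hulim hvlim huM hvM
      ((continuous_fst.abs.rpow_const fun _ => Or.inr (by linarith)).mul
        (continuous_snd.abs.rpow_const fun _ => Or.inr (by linarith)))
      (fun x y => by
        rw [abs_of_nonneg (by positivity), one_mul]
        exact le_rfl)
  obtain ⟨l3, l4⟩ := W0.tendsto_integral_grad_sub hΩb hpN hM huM hulim hglim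
  refine ⟨l0, ?_, l2⟩
  -- Nehari relation for u_j, plus the coupling limit, with the Brezis–Lieb limits subtracted; the
  -- Nehari identity of u₀ makes the total limit 0.
  have l5 := ((l1.add (l2.const_mul c)).sub l3).add l4
  have e : 0 + c * (∫ x in Ω, |u₀.fn x| ^ a * |v₀ x| ^ b) - (∫ x in Ω, ‖u₀.grad x‖ ^ p)
      + ∫ x in Ω, ‖u₀.fn x‖ ^ critExp N p = 0 := by linarith
  rw [e] at l5
  refine l5.congr fun j => ?_
  ring

/-- Compactness below the critical level, for bounded sequences that converge almost everywhere
together with their gradients. -/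
lemma tendsto_of_tendsto_ae_of_residual (hΩo : IsOpen Ω) (hΩb : Bornology.IsBounded Ω)
    (hpN : p < N) (hqN : q < N) {a b : ℝ} (ha : 1 < a) (hb : 1 < b)
    (hab : a / critExp N p + b / critExp N q < 1) {lam : ℝ} (hlam : 0 < lam)
    (hγ : 1 ≤ a / p + b / q) {u : ℕ → W0 Ω p} {v : ℕ → W0 Ω q} {u₀ : W0 Ω p} {v₀ : W0 Ω q}
    {ε : ℕ → ℝ} {M : ℝ} (hε : ∀ j, 0 ≤ ε j) (hε0 : Tendsto ε atTop (𝓝 0))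
    (huN : ∀ j, ‖u j‖ ≤ M) (hvN : ∀ j, ‖v j‖ ≤ M)
    (huM : ∀ j, ∫ x in Ω, ‖(u j).fn x‖ ^ critExp N p ≤ M)
    (hvM : ∀ j, ∫ x in Ω, ‖(v j).fn x‖ ^ critExp N q ≤ M)
    (hu : ∀ᵐ x ∂volume.restrict Ω, Tendsto (fun j => (u j).fn x) atTop (𝓝 (u₀.fn x)))
    (hug : ∀ᵐ x ∂volume.restrict Ω, Tendsto (fun j => (u j).grad x) atTop (𝓝 (u₀.grad x)))
    (hv : ∀ᵐ x ∂volume.restrict Ω, Tendsto (fun j => (v j).fn x) atTop (𝓝 (v₀.fn x)))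
    (hvg : ∀ᵐ x ∂volume.restrict Ω, Tendsto (fun j => (v j).grad x) atTop (𝓝 (v₀.grad x)))
    (hr1 : ∀ j h, |W0.residual a b (lam * a / (a + b)) (u j) (v j).fn h| ≤ ε j * ‖h‖)
    (hr2 : ∀ j h, |W0.residual b a (lam * b / (a + b)) (v j) (u j).fn h| ≤ ε j * ‖h‖)
    {c : ℝ} (hc : c < critLevel N p q)
    (hE : Tendsto (fun j => energy Ω p q a b lam (WithLp.toLp 1 (u j, v j))) atTop (𝓝 c)) :
    ∃ k : ℕ → ℕ, StrictMono k ∧ Tendsto (fun j => u (k j)) atTop (𝓝 u₀) ∧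
      Tendsto (fun j => v (k j)) atTop (𝓝 v₀) := by
  have hp1 := hp.out
  have hq1 := hq.out
  have hN : (0 : ℝ) < N := by linarith
  have hpc : 0 < critExp N p := by linarith [lt_critExp hpN]
  have hqc : 0 < critExp N q := by linarith [lt_critExp hqN]
  have hL0 : 0 < lam / (a + b) := by positivity
  obtain ⟨x1, x2, x3⟩ := W0.nehari_of_tendsto_ae hΩb hpN ha hb hqc hab hε hε0
    (fun j => (v j).memLp_fn_critExp hΩb hqN) huN huM hvM hu hug hv hr1
  obtain ⟨y1, y2, -⟩ := W0.nehari_of_tendsto_ae hΩb hqN hb ha hpc (by linarith) hε hε0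
    (fun j => (u j).memLp_fn_critExp hΩb hpN) hvN hvM huM hv hvg hu hr2
  simp only [mul_comm (|v₀.fn _| ^ b)] at y1
  obtain ⟨x4, x5⟩ := W0.tendsto_integral_grad_sub hΩb hpN huN huM hu hug
  obtain ⟨y4, y5⟩ := W0.tendsto_integral_grad_sub hΩb hqN hvN hvM hv hvg
  have hI0 : 0 ≤ ∫ x in Ω, |u₀.fn x| ^ a * |v₀.fn x| ^ b := integral_nonneg fun x => by positivity
  have hU0 : 0 ≤ ∫ x in Ω, ‖u₀.fn x‖ ^ critExp N p := integral_nonneg fun x => by positivity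
  have hV0 : 0 ≤ ∫ x in Ω, ‖v₀.fn x‖ ^ critExp N q := integral_nonneg fun x => by positivity
  have hA0 : ∀ j, 0 ≤ ∫ x in Ω, ‖(u j - u₀).grad x‖ ^ p := fun j =>
    integral_nonneg fun x => by positivity
  have hB0 : ∀ j, 0 ≤ ∫ x in Ω, ‖(v j - v₀).grad x‖ ^ q := fun j =>
    integral_nonneg fun x => by positivity
  -- Brezis–Lieb reduces the energy to that of the remainders, and replacing their critical
  -- integrals by gradient integrals leaves the factor 1/p - 1/p* = 1/N, and likewise for q. Thus ℓ
  -- = N(c - E(u₀, v₀)), and E(u₀, v₀) ≥ 0 by `energy_identity` and the two Nehari identities.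
  have sum_lim : ∃ ℓ, ℓ ≤ N * c ∧ Tendsto (fun j => (∫ x in Ω, ‖(u j - u₀).grad x‖ ^ p)
      + ∫ x in Ω, ‖(v j - v₀).grad x‖ ^ q) atTop (𝓝 ℓ) := by
    have l := ((((((((hE.sub (x4.const_mul (1 / p))).sub (y4.const_mul (1 / q))).add
      (x3.const_mul (lam / (a + b)))).add (x5.const_mul (1 / critExp N p))).add
      (y5.const_mul (1 / critExp N q))).sub (x2.const_mul (1 / critExp N p))).sub
      (y2.const_mul (1 / critExp N q)))).const_mul (N : ℝ)
    refine ⟨_, ?_, l.congr fun j => ?_⟩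
    · refine mul_le_mul_of_nonneg_left ?_ hN.le
      have id := energy_identity hpN hqN (by linarith : a + b ≠ 0) lam
        (∫ x in Ω, ‖u₀.grad x‖ ^ p) (∫ x in Ω, ‖v₀.grad x‖ ^ q)
        (∫ x in Ω, |u₀.fn x| ^ a * |v₀.fn x| ^ b) (∫ x in Ω, ‖u₀.fn x‖ ^ critExp N p)
        (∫ x in Ω, ‖v₀.fn x‖ ^ critExp N q)
      rw [x1, y1] at id
      have j1 : 0 ≤ lam / (a + b) * (a / p + b / q - 1) *
          ∫ x in Ω, |u₀.fn x| ^ a * |v₀.fn x| ^ b :=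
        mul_nonneg (mul_nonneg hL0.le (by linarith)) hI0
      have j2 : 0 ≤ 1 / (N : ℝ) * ((∫ x in Ω, ‖u₀.fn x‖ ^ critExp N p)
          + ∫ x in Ω, ‖v₀.fn x‖ ^ critExp N q) := by positivity
      linarith
    · rw [energy_eq hΩb hpN hqN]
      simp only [WithLp.toLp_fst, WithLp.toLp_snd]
      have e1 := one_div_sub_one_div_critExp hpN
      have e2 := one_div_sub_one_div_critExp hqN
      have e3 : 1 / p = 1 / critExp N p + 1 / N := by linarith
      have e4 : 1 / q = 1 / critExp N q + 1 / N := by linarith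
      rw [e3, e4]
      field_simp
      ring
  obtain ⟨ℓ, hℓ, hsum⟩ := sum_lim
  -- Only the sum is known to converge. Boundedness gives a subsequence along which the first
  -- integral tends to some A, and the second then tends to ℓ - A.
  obtain ⟨D, hD⟩ := hsum.bddAbove_range
  obtain ⟨A, -, k, hk, hA⟩ := (isCompact_Icc (a := (0 : ℝ)) (b := D)).tendsto_subseq
    (x := fun j => ∫ x in Ω, ‖(u j - u₀).grad x‖ ^ p)
    fun j => ⟨hA0 j, by linarith [hD ⟨j, rfl⟩, hB0 j]⟩
  have hA : Tendsto (fun j => ∫ x in Ω, ‖(u (k j) - u₀).grad x‖ ^ p) atTop (𝓝 A) := hA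
  have hB : Tendsto (fun j => ∫ x in Ω, ‖(v (k j) - v₀).grad x‖ ^ q) atTop (𝓝 (ℓ - A)) :=
    ((hsum.comp hk.tendsto_atTop).sub hA).congr fun j => by simp
  have hA' : Tendsto (fun j => ∫ x in Ω, ‖(u (k j) - u₀).fn x‖ ^ critExp N p) atTop (𝓝 A) := by
    simpa using hA.sub (x2.comp hk.tendsto_atTop)
  have hB' : Tendsto (fun j => ∫ x in Ω, ‖(v (k j) - v₀).fn x‖ ^ critExp N q) atTop
      (𝓝 (ℓ - A)) := by
    simpa using hB.sub (y2.comp hk.tendsto_atTop)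
  have hA1 : 0 ≤ A := ge_of_tendsto' hA fun j => hA0 (k j)
  have hB1 : 0 ≤ ℓ - A := ge_of_tendsto' hB fun j => hB0 (k j)
  obtain ⟨c1, c2⟩ := mul_critLevel_le (by exact_mod_cast hN) p q
  have hNc : N * c < N * critLevel N p q := mul_lt_mul_of_pos_left hc hN
  -- Both A and ℓ - A are nonnegative, so each is at most ℓ ≤ N * c, strictly below both
  -- concentration thresholds.
  have zA := eq_zero_of_tendsto_integral hΩo hΩb hpN hA hA' (by linarith)
  have zB := eq_zero_of_tendsto_integral hΩo hΩb hqN hB hB' (by linarith)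
  rw [zA] at hA
  rw [zB] at hB
  exact ⟨k, hk, W0.tendsto_of_tendsto_integral_grad hΩb hpN hA,
    W0.tendsto_of_tendsto_integral_grad hΩb hqN hB⟩

lemma exists_bound_of_tendsto_zero {X : Type*} [NormedAddCommGroup X] [NormedSpace ℝ X]
    {D : ℕ → X →L[ℝ] ℝ} (h : Tendsto D atTop (𝓝 0)) : ∃ ε : ℕ → ℝ, (∀ j, 0 ≤ ε j) ∧
      Tendsto ε atTop (𝓝 0) ∧ ∀ j x, |D j x| ≤ ε j * ‖x‖ :=
  ⟨fun j => ‖D j‖, fun _ => norm_nonneg _, tendsto_zero_iff_norm_tendsto_zero.1 h,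
    fun j x => (D j).le_opNorm x⟩

lemma energyDeriv_inl (a b lam : ℝ) (w : W Ω p q) (h : W0 Ω p) :
    energyDeriv a b lam w (WithLp.toLp 1 (h, 0)) =
      W0.residual a b (lam * a / (a + b)) w.fst w.snd.fn h := by
  refine (energyDeriv_eq a b lam w _).trans ?_
  change W0.residual a b (lam * a / (a + b)) w.fst w.snd.fn h
    + W0.residual b a (lam * b / (a + b)) w.snd w.fst.fn 0 = _
  rw [W0.residual_zero, add_zero]

lemma energyDeriv_inr (a b lam : ℝ) (w : W Ω p q) (h : W0 Ω q) :
    energyDeriv a b lam w (WithLp.toLp 1 (0, h)) =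
      W0.residual b a (lam * b / (a + b)) w.snd w.fst.fn h := by
  refine (energyDeriv_eq a b lam w _).trans ?_
  change W0.residual a b (lam * a / (a + b)) w.fst w.snd.fn 0
    + W0.residual b a (lam * b / (a + b)) w.snd w.fst.fn h = _
  rw [W0.residual_zero, zero_add]

lemma palaisSmale_energy (hΩo : IsOpen Ω) (hΩb : Bornology.IsBounded Ω)
    (hpN : p < N) (hqN : q < N) {a b : ℝ} (ha : 1 < a) (hb : 1 < b)
    (hab : a / critExp N p + b / critExp N q < 1) {lam : ℝ} (hlam : 0 < lam)
    (hγ : 1 ≤ a / p + b / q)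
    (hD : ∀ w h, fderiv ℝ (energy Ω p q a b lam) w h = energyDeriv a b lam w h)
    {c : ℝ} (hc : c < critLevel N p q) : PalaisSmale (energy Ω p q a b lam) c := by
  intro w hw hw'
  have hpc : 0 < critExp N p := by linarith [hp.out, lt_critExp hpN]
  have hqc : 0 < critExp N q := by linarith [hq.out, lt_critExp hqN]
  obtain ⟨ε, hε, hε0, hle⟩ := exists_bound_of_tendsto_zero hw'
  -- Testing with (h, 0), whose norm in W is ‖h‖, isolates the first equation with the same error ε
  -- j.
  have hr1 : ∀ j h, |W0.residual a b (lam * a / (a + b)) (w j).fst (w j).snd.fn h|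
      ≤ ε j * ‖h‖ := fun j h => by
    have := hle j (WithLp.toLp 1 (h, 0))
    rwa [hD, energyDeriv_inl, WithLp.norm_toLp_fst] at this
  have hr2 : ∀ j h, |W0.residual b a (lam * b / (a + b)) (w j).snd (w j).fst.fn h|
      ≤ ε j * ‖h‖ := fun j h => by
    have := hle j (WithLp.toLp 1 (0, h))
    rwa [hD, energyDeriv_inr, WithLp.norm_toLp_snd] at this
  obtain ⟨C₁, hC₁⟩ := hw.abs.bddAbove_range
  obtain ⟨C₂, hC₂⟩ := hε0.bddAbove_range
  have hC₁' : ∀ j, |energy Ω p q a b lam (w j)| ≤ max C₁ C₂ := fun j =>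
    (hC₁ ⟨j, rfl⟩).trans (le_max_left _ _)
  have hC₂' : ∀ j, ε j ≤ max C₁ C₂ := fun j => (hC₂ ⟨j, rfl⟩).trans (le_max_right _ _)
  obtain ⟨M, hM⟩ := exists_bound_of_energy (Ω := Ω) hΩb hpN hqN ha hb hab hlam hγ
    ((hε 0).trans (hC₂' 0))
  have hM' := fun j => hM (w j) (hC₁' j)
    (fun h => (hr1 j h).trans (mul_le_mul_of_nonneg_right (hC₂' j) (norm_nonneg _)))
    (fun h => (hr2 j h).trans (mul_le_mul_of_nonneg_right (hC₂' j) (norm_nonneg _)))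
  -- Almost everywhere convergence of one component uses only bounds on the other, so the two
  -- subsequences can be extracted in succession.
  obtain ⟨k₁, u₀, hk₁, f1, g1⟩ := W0.exists_subseq_of_residual hΩb hpN ha hb hqc hab hε hε0
    (fun j => (w j).snd.memLp_fn_critExp hΩb hqN) (fun j => (hM' j).1)
    (fun j => (hM' j).2.2.1) (fun j => (hM' j).2.2.2) hr1
  obtain ⟨k₂, v₀, hk₂, f2, g2⟩ := W0.exists_subseq_of_residual hΩb hqN hb ha hpc
    (by linarith) (fun j => hε (k₁ j)) (hε0.comp hk₁.tendsto_atTop)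
    (fun j => (w (k₁ j)).fst.memLp_fn_critExp hΩb hpN) (fun j => (hM' (k₁ j)).2.1)
    (fun j => (hM' (k₁ j)).2.2.2) (fun j => (hM' (k₁ j)).2.2.1) (fun j => hr2 (k₁ j))
  obtain ⟨k₃, hk₃, hu, hv⟩ := tendsto_of_tendsto_ae_of_residual hΩo hΩb hpN hqN ha hb hab hlam hγ
    (u := fun j => (w (k₁ (k₂ j))).fst) (v := fun j => (w (k₁ (k₂ j))).snd)
    (fun j => hε (k₁ (k₂ j))) (hε0.comp (hk₁.comp hk₂).tendsto_atTop)
    (fun j => (hM' _).1) (fun j => (hM' _).2.1) (fun j => (hM' _).2.2.1)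
    (fun j => (hM' _).2.2.2)
    (by filter_upwards [f1] with x hx using hx.comp hk₂.tendsto_atTop)
    (by filter_upwards [g1] with x hx using hx.comp hk₂.tendsto_atTop) f2 g2
    (fun j => hr1 _) (fun j => hr2 _) hc (hw.comp (hk₁.comp hk₂).tendsto_atTop)
  refine ⟨fun j => k₁ (k₂ (k₃ j)), WithLp.toLp 1 (u₀, v₀), hk₁.comp (hk₂.comp hk₃), ?_⟩
  exact ((WithLp.prod_continuous_toLp 1 (W0 Ω p) (W0 Ω q)).tendsto (u₀, v₀)).comp
    (hu.prodMk_nhds hv)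

end PalaisSmale

end CriticalSystem

end

theorem lemma201 (N : ℕ) (Ω : Set (CriticalSystem.RN N))
    (hΩo : IsOpen Ω) (hΩc : IsConnected Ω) (hΩb : Bornology.IsBounded Ω)
    (p q : ℝ) [Fact (1 < p)] [Fact (1 < q)] (hpN : p < N) (hqN : q < N)
    (a b : ℝ) (ha : 1 < a) (hb : 1 < b)
    (p₀ q₀ : ℝ) (hp₀ : 1 < p₀) (hp₀' : p₀ < CriticalSystem.critExp N p)
    (hq₀ : 1 < q₀) (hq₀' : q₀ < CriticalSystem.critExp N q)
    (hab : a / p₀ + b / q₀ = 1)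
    (lam : ℝ) (hlam : 0 < lam)
    (hγ : 1 ≤ a / p + b / q) :
    ContDiff ℝ 1 (CriticalSystem.energy Ω p q a b lam) ∧
      ∀ c : ℝ, c < CriticalSystem.critLevel N p q →
        CriticalSystem.PalaisSmale (CriticalSystem.energy Ω p q a b lam) c := by
  -- The strict inequalities p₀ < p* and q₀ < q* turn exact homogeneity 1 at (p₀, q₀) into strict
  -- subcriticality of the coupling.
  have hlt : a / CriticalSystem.critExp N p + b / CriticalSystem.critExp N q < 1 := by
    rw [← hab]
    exact add_lt_add (div_lt_div_of_pos_left (by linarith) (by linarith) hp₀')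
      (div_lt_div_of_pos_left (by linarith) (by linarith) hq₀')
  obtain ⟨hE, hD⟩ := CriticalSystem.contDiff_energy hΩb hpN hqN ha hb hp₀ hp₀' hq₀ hq₀' hab lam
  exact ⟨hE, fun c hc => CriticalSystem.palaisSmale_energy hΩo hΩb hpN hqN ha hb hlt hlam hγ hD hc⟩
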